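/- Setting. Let $\mathcal H$ and $\mathcal H'$ be separable real Hilbert spaces, where $\mathcal H'$ is a vector-valued reproducing kernel Hilbert space of functions from a Polish space $X$ to a separable real Hilbert space $Y$. For $x\in X$ let $K_x:Y\to\mathcal H'$ be the adjoint of evaluation at $x$; assume $\sup_x\|K_x\|_{HS}^2\le\kappa^2<\infty$ and that $(x,t)\mapsto\langle K_tv,K_xw\rangle_{\mathcal H'}$ is measurable for all $v,w\in Y$. Let $\rho$ be a probability measure on $X\times Y$ with marginal $\nu$ on $X$, conditional distributions $\rho(\cdot|x)$ and $\int\|y\|^2d\rho<\infty$. Let $I_\nu:\mathcal H'\to L^2(X,\nu;Y)$ be the canonical injection, $T_\nu=I_\nu^*I_\nu$ and $\mathcal N(\lambda)=\operatorname{Tr}((T_\nu+\lambda I)^{-1}T_\nu)$. Let $L:\mathcal D(L)\subset\mathcal H\to\mathcal H$ be densely defined, closed, self-adjoint and strictly positive with $\ell_L\|f\|\le\|Lf\|$ on $\mathcal D(L)$ for some $\ell_L>0$, and for $a\in\mathbb R$ let $\|f\|_{\mathcal H_a}=\|L^af\|_{\mathcal H}$ and $\mathcal H_a=\mathcal D(L^a)$.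 Let $A:\mathcal D(A)\subset\mathcal H\to\mathcal H'$ have convex closed domain and be weak-to-weak sequentially continuous, let $\bar f\in\mathcal D(A)\cap\mathcal D(L)$ and $\hat f\in\operatorname{int}\mathcal D(A)$, and suppose $\int y\,d\rho(y|x)=A(\hat f)(x)$ for $\nu$-almost all $x$. Assume the following. 1. (Noise) With $\varepsilon=y-A(\hat f)(x)$ and constants $M>0$, $\Sigma\ge 0$: $\int\big(e^{\|\varepsilon\|/M}-\|\varepsilon\|/M-1\big)d\rho(y|x)\le\frac{\Sigma^2}{2M^2}$ for $\nu$-almost all $x$. 2. (Lipschitz continuity and stability) There are $Q\subset\mathcal D(A)\cap\{f\in\mathcal H_\theta:\|f-\hat f\|_{\mathcal H_\theta}\le d\}$ with $d>0$, $\theta\ge0$, and a radius $\varrho>0$ so large that $\|f-\hat f\|\le\varrho$ on $Q$, such that $\|A(f)-A(\tilde f)\|_{\mathcal H'}\le\ell_A\|f-\tilde f\|$ for all $f,\tilde f\in\mathcal D(A)$ within distance $\varrho$ of $\hat f$; and there are constants $p\ge0$, $0<s\le1$, $\alpha,\beta>0$ with $$\|f-\hat f\|_{\mathcal H_{-p}}\le\alpha\|I_\nu(A(f)-A(\hat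 f))\|_{L^2}^s\le\beta\|f-\hat f\|_{\mathcal H_{-p}}\qquad\text{for all }f\in Q.$$ 3. (Source condition) $\hat f-\bar f=L^{-r}v$ with $\|v\|\le R^\dagger$, where $r\ge0$. 4. (Logarithmic decay) There are $C_0>0$ and $\lambda_0\in(0,1)$ with $\mathcal N(\lambda)\le C_0\log(1/\lambda)$ for $0<\lambda\le\lambda_0$. Let $1\le q\le2+p$. Given an i.i.d. sample $\mathbf z=((x_i,y_i))_{i=1}^m\sim\rho^m$, let $f_{\mathbf z,\lambda}$ be a global minimizer over $f\in\mathcal D(A)\cap\mathcal D(L)$ of $\frac1m\sum_{i=1}^m\|A(f)(x_i)-y_i\|_Y^2+\lambda\|L(f-\bar f)\|^2$. Statement. There is a constant $C>0$ depending only on $p,q,s,r,\alpha,\beta,\ell_L,\ell_A,\varrho,\kappa,M,\Sigma,R^\dagger,C_0,\lambda_0$ such that the following holds for every $m$. Put $\lambda^*=\left(\frac{\log m}{m}\right)^{\frac1{2r+1}}$, and suppose that $0<\lambda^*\le1$, that $\mathcal N(\lambda^*)\le m\lambda^*$, and that almost surely $f_{\mathbf z,\lambda^*}\in Q$. Then for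 every $0<\eta<1$, with probability at least $1-\eta$, $$\|f_{\mathbf z,\lambda^*}-\hat f\|_{\mathcal H}\le C(\lambda^*)^{\frac{2u(s+p)-p}{2(p+1)}}\log\left(\frac4\eta\right)$$ in each of the following two cases: (a) $r\ge q$ and $u=\dfrac{p+q}{2(p+q)-2s(q-1)}$; (b) $r\le q$, $r+p\le2q$ and $u=\dfrac{p+r}{2(p+r)-2s(r-1)}$, provided that $\hat f^{R}\in Q$ for $R=(R^\dagger)^{\frac{(p+q)-s(q-1)}{(p+r)-s(r-1)}}(\lambda^*)^{\frac{s(r-q)}{2(p+r)-2s(r-1)}}$, where $\hat f^{R}$ minimizes $\|f-\hat f\|$ over all $f$ with $f-\bar f=L^{-q}v$, $\|v\|\le R$. -/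

import Mathlib

open MeasureTheory Filter Topology Set
open scoped RealInnerProductSpace ENNReal

noncomputable section

namespace HilbertScale

section Trace

variable (E : Type*) [NormedAddCommGroup E] [InnerProductSpace ℝ E] [CompleteSpace E]

/-- Index set of a fixed orthonormal (Hilbert) basis of `E`. -/
def onbSet : Set E := (exists_hilbertBasis ℝ E).choose

/-- A fixed orthonormal (Hilbert) basis of `E`. -/
def onb : HilbertBasis (onbSet E) ℝ E := (exists_hilbertBasis ℝ E).choose_spec.choose

variable {E} {F : Type*} [NormedAddCommGroup F] [InnerProductSpace ℝ F]

/-- The squared Hilbert-Schmidt norm `∑ ‖T eᵢ‖²`; it is finite exactly if `T` is a Hilbert-Schmidt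
operator, and equals `tr (T* T)`. -/
def hsNormSq (T : E →L[ℝ] F) : ℝ≥0∞ := ∑' i, ‖T (onb E i)‖ₑ ^ 2

/-- The trace `∑ ⟪eᵢ, T eᵢ⟫` of a trace class operator. -/
def trace (T : E →L[ℝ] E) : ℝ := ∑' i, ⟪onb E i, T (onb E i)⟫

end Trace

section Scale

variable {H : Type*} [NormedAddCommGroup H] [InnerProductSpace ℝ H] [CompleteSpace H]

/-- `L` is a densely defined, closed, self-adjoint, strictly positive operator with
`ℓ ‖f‖ ≤ ‖L f‖` on its domain. -/
structure IsScaleGenerator (L : H →ₗ.[ℝ] H) (ℓ : ℝ) : Prop where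
  dense : Dense (L.domain : Set H)
  closed : L.IsClosed
  selfAdjoint : IsSelfAdjoint L
  pos : ∀ f : L.domain, f ≠ 0 → 0 < ⟪L f, (f : H)⟫
  bound : ∀ f : L.domain, ℓ * ‖(f : H)‖ ≤ ‖L f‖

/-- `B` is the bounded, everywhere defined inverse of `L`. -/
def IsBoundedInverse (L : H →ₗ.[ℝ] H) (B : H →L[ℝ] H) : Prop :=
  ∀ x y : H, B x = y ↔ ∃ hy : y ∈ L.domain, L ⟨y, hy⟩ = x

theorem IsScaleGenerator.exists_inverse {L : H →ₗ.[ℝ] H} {ℓ : ℝ} (hℓ : 0 < ℓ)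
    (hL : IsScaleGenerator L ℓ) : ∃ B : H →L[ℝ] H, IsBoundedInverse L B := by
  have hinj : ∀ f g : L.domain, L f = L g → f = g := by
    intro f g h
    have h1 := hL.bound (f - g)
    rw [LinearPMap.map_sub, h, sub_self, norm_zero] at h1
    have h2 : ‖((f - g : L.domain) : H)‖ = 0 := by
      have := norm_nonneg ((f - g : L.domain) : H)
      nlinarith
    rw [norm_eq_zero] at h2
    exact sub_eq_zero.mp (Subtype.ext h2)
  set S : Submodule ℝ H := LinearMap.range L.toFun with hS
  have hclosed : IsClosed (S : Set H) := by
    apply IsSeqClosed.isClosed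
    intro u y hu huy
    choose f hf using fun n => LinearMap.mem_range.mp (hu n)
    have hf' : ∀ n, L (f n) = u n := hf
    have hcf : CauchySeq fun n => (f n : H) := by
      rw [Metric.cauchySeq_iff']
      intro ε hε
      obtain ⟨N, hN⟩ := Metric.cauchySeq_iff'.mp huy.cauchySeq (ℓ * ε) (mul_pos hℓ hε)
      refine ⟨N, fun n hn => ?_⟩
      have h1 := hL.bound (f n - f N)
      have h2 := hN n hn
      rw [LinearPMap.map_sub, hf', hf', ← dist_eq_norm] at h1
      have h3 : dist (f n : H) (f N) = ‖((f n - f N : L.domain) : H)‖ := by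
        rw [dist_eq_norm]; rfl
      rw [h3]
      exact lt_of_mul_lt_mul_left (lt_of_le_of_lt h1 h2) hℓ.le
    obtain ⟨x, hx⟩ := cauchySeq_tendsto_of_complete hcf
    have hmem : (x, y) ∈ (L.graph : Set (H × H)) := by
      have hc : IsClosed (L.graph : Set (H × H)) := hL.closed
      refine hc.mem_of_tendsto (hx.prodMk_nhds huy) (Eventually.of_forall fun n => ?_)
      exact LinearPMap.mem_graph_iff _ |>.mpr ⟨f n, rfl, hf' n⟩
    obtain ⟨g, -, hg⟩ := (LinearPMap.mem_graph_iff _).mp hmem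
    exact ⟨g, hg⟩
  have htop : S = ⊤ := by
    have : CompleteSpace S := hclosed.completeSpace_coe
    rw [← Submodule.orthogonal_eq_bot_iff, Submodule.eq_bot_iff]
    intro w hw
    have hz : ∀ f : L.domain, ⟪(0 : H), f⟫ = ⟪w, L f⟫ := by
      intro f
      rw [inner_zero_left, real_inner_comm]
      exact ((Submodule.mem_orthogonal S w).mp hw (L f) ⟨f, rfl⟩).symm
    have hd := LinearPMap.mem_adjoint_domain_of_exists (T := L) w ⟨0, hz⟩
    have h0 := LinearPMap.adjoint_apply_eq hL.dense ⟨w, hd⟩ hz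
    have hgr : (w, (0 : H)) ∈ L.adjoint.graph :=
      (LinearPMap.mem_graph_iff _).mpr ⟨⟨w, hd⟩, rfl, h0⟩
    rw [LinearPMap.isSelfAdjoint_def.mp hL.selfAdjoint] at hgr
    obtain ⟨g, hg1, hg2⟩ := (LinearPMap.mem_graph_iff _).mp hgr
    have h3 : g = 0 := hinj g 0 (by rw [hg2, LinearPMap.map_zero])
    exact hg1.symm.trans (by rw [h3]; rfl)
  let e : L.domain ≃ₗ[ℝ] H := LinearEquiv.ofBijective L.toFun
    ⟨fun f g h => hinj f g h, LinearMap.range_eq_top.mp htop⟩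
  have he : ∀ f : L.domain, e f = L f := fun _ => rfl
  refine ⟨LinearMap.mkContinuous (L.domain.subtype ∘ₗ e.symm.toLinearMap) ℓ⁻¹ fun x => ?_,
    fun x y => ?_⟩
  · have := hL.bound (e.symm x)
    rw [← he, e.apply_symm_apply] at this
    rw [inv_mul_eq_div, le_div_iff₀' hℓ]
    exact this
  · change ((e.symm x : L.domain) : H) = y ↔ _
    constructor
    · rintro rfl
      exact ⟨(e.symm x).2, by rw [← he]; exact e.apply_symm_apply x⟩
    · rintro ⟨hy, rfl⟩
      rw [← he, e.symm_apply_apply]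

open scoped Classical in
/-- The bounded inverse `L⁻¹`. -/
def inv (L : H →ₗ.[ℝ] H) : H →L[ℝ] H :=
  if h : ∃ B : H →L[ℝ] H, IsBoundedInverse L B then h.choose else 0

/-- Continuous functional calculus `φ(B)` of a bounded positive self-adjoint operator on a real
Hilbert space: the operator norm limit of `P(B)` as the polynomial `P` tends to `φ` uniformly
on `[0, ‖B‖]`. -/
def funcCalc (B : H →L[ℝ] H) (φ : ℝ → ℝ) : H →L[ℝ] H :=
  limUnder (⨅ ε ∈ Ioi (0 : ℝ), 𝓟 {P : Polynomial ℝ | ∀ t ∈ Icc 0 ‖B‖, |P.eval t - φ t| ≤ ε})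
    (fun P => Polynomial.aeval B P)

/-- The bounded operator `L⁻ᵃ` for `a ≥ 0`. -/
def negPow (L : H →ₗ.[ℝ] H) (a : ℝ) : H →L[ℝ] H := funcCalc (inv L) (fun t => t ^ a)

/-- The closed ball of radius `μ` around `f₀` in the space `H_θ = D(L^θ) = ran L^{-θ}`, `θ ≥ 0`,
whose norm is `‖L^{-θ} w‖_θ = ‖w‖`. -/
def scaleBall (L : H →ₗ.[ℝ] H) (θ : ℝ) (f₀ : H) (μ : ℝ) : Set H :=
  {f | f ∈ range (negPow L θ) ∧ ∃ w, f - f₀ = negPow L θ w ∧ ‖w‖ ≤ μ}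

/-- `g` minimizes `‖f - fhat‖` over all `f` with `f - fbar = L^{-q} v`, `‖v‖ ≤ R`. -/
def IsDistMinimizer (L : H →ₗ.[ℝ] H) (q : ℝ) (fbar fhat : H) (R : ℝ) (g : H) : Prop :=
  IsMinOn (fun f => ‖f - fhat‖) {f | ∃ v, f - fbar = negPow L q v ∧ ‖v‖ ≤ R} g ∧
    g ∈ {f | ∃ v, f - fbar = negPow L q v ∧ ‖v‖ ≤ R}

end Scale

section Learning

variable {H : Type*} [NormedAddCommGroup H] [InnerProductSpace ℝ H] [CompleteSpace H]
variable {X : Type*} [MeasurableSpace X]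
variable {Y : Type*} [NormedAddCommGroup Y] [InnerProductSpace ℝ Y] [CompleteSpace Y]
  [SecondCountableTopology Y] [MeasurableSpace Y] [BorelSpace Y]
variable {H' : Type*} [NormedAddCommGroup H'] [InnerProductSpace ℝ H'] [CompleteSpace H']
  [RKHS ℝ H' X Y]

/-- The conditions on the kernel of the vector valued reproducing kernel Hilbert space `H'`. -/
structure KernelAssumption (H' : Type*) [NormedAddCommGroup H'] [InnerProductSpace ℝ H']
    [CompleteSpace H'] [RKHS ℝ H' X Y] (κ : ℝ) : Prop where
  hilbertSchmidt : ∀ x : X, hsNormSq (RKHS.kerFun H' x) ≤ ENNReal.ofReal (κ ^ 2)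
  measurable : ∀ v w : Y, Measurable fun xt : X × X =>
    ⟪RKHS.kerFun H' xt.2 v, RKHS.kerFun H' xt.1 w⟫

/-- `J` is the canonical injection of `H'` into `L²(X, ν; Y)`. -/
def IsInjection (ν : Measure X) (J : H' →L[ℝ] Lp Y 2 ν) : Prop :=
  ∀ g : H', (J g : X → Y) =ᵐ[ν] fun x => g x

theorem KernelAssumption.measurable_coe {κ : ℝ} (hK : KernelAssumption (X := X) (Y := Y) H' κ)
    (g : H') : Measurable (fun x => g x : X → Y) := by
  have hw : ∀ w : Y, Measurable fun x => ⟪g x, w⟫ := by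
    intro w
    have hg : g ∈ closure (Submodule.span ℝ {RKHS.kerFun H' x v | (x) (v)} : Set H') := by
      rw [← Submodule.topologicalClosure_coe, RKHS.kerFun_dense]; trivial
    obtain ⟨u, hu, hlim⟩ := mem_closure_iff_seq_limit.mp hg
    refine measurable_of_tendsto_metrizable (f := fun n x => ⟪u n x, w⟫) (fun n => ?_) ?_
    · refine Submodule.span_induction (p := fun h _ => Measurable fun x => ⟪h x, w⟫)
        ?_ ?_ ?_ ?_ (hu n)
      · rintro _ ⟨t, v, rfl⟩
        have := (hK.measurable v w).comp (measurable_id.prodMk (measurable_const (a := t)))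
        simpa [Function.comp_def] using this
      · simp
      · intro a b _ _ ha hb
        simp only [RKHS.coe_add, Pi.add_apply, inner_add_left]
        exact ha.add hb
      · intro c a _ ha
        simpa [inner_smul_left] using ha.const_mul c
    · rw [tendsto_pi_nhds]
      intro x
      exact (((RKHS.continuous_eval (𝕜 := ℝ) (H := H') x).tendsto g).comp hlim).inner
        tendsto_const_nhds
  have hball : ∀ (y : Y) (ε : ℝ), 0 ≤ ε → MeasurableSet {x | ‖g x - y‖ ≤ ε} := by
    intro y ε hε
    have : {x | ‖g x - y‖ ≤ ε} =
        ⋂ n : ℕ, {x | ⟪g x, TopologicalSpace.denseSeq Y n⟫ - ⟪y, TopologicalSpace.denseSeq Y n⟫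
          ≤ ε * ‖TopologicalSpace.denseSeq Y n‖} := by
      ext x
      simp only [mem_ofPred_eq, mem_iInter, ← inner_sub_left]
      constructor
      · intro h n
        exact (real_inner_le_norm _ _).trans (mul_le_mul_of_nonneg_right h (norm_nonneg _))
      · intro h
        have h2 : ∀ v : Y, ⟪g x - y, v⟫ ≤ ε * ‖v‖ := by
          intro v
          refine (TopologicalSpace.denseRange_denseSeq Y).induction_on v ?_ h
          exact isClosed_le (by fun_prop) (by fun_prop)
        have h3 := h2 (g x - y)
        rw [real_inner_self_eq_norm_mul_norm] at h3
        by_contra hlt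
        push Not at hlt
        nlinarith [norm_nonneg (g x - y)]
    rw [this]
    exact MeasurableSet.iInter fun n => measurableSet_le ((hw _).sub_const _) measurable_const
  refine measurable_of_isOpen fun U hU => ?_
  obtain rfl | hne := U.eq_empty_or_nonempty
  · simp
  obtain ⟨S, hS, hSU⟩ := TopologicalSpace.isOpen_iUnion_countable
    (fun p : {p : Y × ℝ // 0 ≤ p.2 ∧ Metric.closedBall p.1 p.2 ⊆ U} =>
      Metric.ball p.1.1 p.1.2) (fun _ => Metric.isOpen_ball)
  have hU' : U = ⋃ p ∈ S, Metric.closedBall p.1.1 p.1.2 := by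
    apply Subset.antisymm
    · intro y hy
      obtain ⟨ε, hε, hεU⟩ := Metric.nhds_basis_closedBall.mem_iff.mp (hU.mem_nhds hy)
      have : y ∈ ⋃ p : {p : Y × ℝ // 0 ≤ p.2 ∧ Metric.closedBall p.1 p.2 ⊆ U},
          Metric.ball p.1.1 p.1.2 :=
        mem_iUnion.mpr ⟨⟨(y, ε), hε.le, hεU⟩, Metric.mem_ball_self hε⟩
      rw [← hSU] at this
      exact iUnion₂_mono (fun p _ => Metric.ball_subset_closedBall) this
    · exact iUnion₂_subset fun p _ => p.2.2
  rw [hU', preimage_iUnion₂]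
  refine MeasurableSet.biUnion hS fun p _ => ?_
  have := hball p.1.1 p.1.2 p.2.1
  simpa [Set.preimage, Metric.mem_closedBall, dist_eq_norm] using this

theorem KernelAssumption.exists_injection {κ : ℝ} (hK : KernelAssumption (X := X) (Y := Y) H' κ)
    (ν : Measure X) [IsFiniteMeasure ν] : ∃ J : H' →L[ℝ] Lp Y 2 ν, IsInjection ν J := by
  have hb : ∀ (x : X) (g : H'), ‖g x‖ ≤ |κ| * ‖g‖ := by
    intro x g
    have h1 : ‖g x‖ₑ ^ 2 ≤ ENNReal.ofReal (κ ^ 2) * ‖g‖ₑ ^ 2 := by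
      have hP : ‖g x‖ₑ ^ 2 = ∑' i, ‖⟪onb Y i, g x⟫‖ₑ ^ 2 := by
        have h := (onb Y).hasSum_inner_mul_inner (g x) (g x)
        have h' : HasSum (fun i => ‖⟪onb Y i, g x⟫‖ ^ 2) (‖g x‖ ^ 2) := by
          rw [real_inner_self_eq_norm_sq] at h
          refine h.congr_fun fun i => ?_
          rw [real_inner_comm, Real.norm_eq_abs, sq_abs, sq]
        have h2 := ENNReal.ofReal_tsum_of_nonneg (fun i => by positivity) h'.summable
        rw [h'.tsum_eq] at h2
        simpa only [ENNReal.ofReal_pow (norm_nonneg _), ofReal_norm] using h2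
      rw [hP]
      calc ∑' i, ‖⟪onb Y i, g x⟫‖ₑ ^ 2
          ≤ ∑' i, ‖RKHS.kerFun H' x (onb Y i)‖ₑ ^ 2 * ‖g‖ₑ ^ 2 := by
            refine ENNReal.tsum_le_tsum fun i => ?_
            rw [← mul_pow, ← RKHS.kerFun_inner (𝕜 := ℝ)]
            gcongr
            rw [← ofReal_norm, ← ofReal_norm, ← ofReal_norm, ← ENNReal.ofReal_mul (norm_nonneg _)]
            exact ENNReal.ofReal_le_ofReal (norm_inner_le_norm _ _)
        _ ≤ _ := by
            rw [ENNReal.tsum_mul_right]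
            gcongr
            exact hK.hilbertSchmidt x
    have h2 : ‖g x‖ ^ 2 ≤ (|κ| * ‖g‖) ^ 2 := by
      rw [← ofReal_norm, ← ofReal_norm, ← ENNReal.ofReal_pow (norm_nonneg _),
        ← ENNReal.ofReal_pow (norm_nonneg _), ← ENNReal.ofReal_mul (sq_nonneg _),
        ENNReal.ofReal_le_ofReal_iff (by positivity)] at h1
      rwa [mul_pow, sq_abs]
    exact le_of_sq_le_sq h2 (by positivity)
  have hmem : ∀ g : H', MemLp (fun x => g x : X → Y) 2 ν := fun g =>
    MemLp.of_bound (hK.measurable_coe g).aestronglyMeasurable (|κ| * ‖g‖)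
      (Eventually.of_forall fun x => hb x g)
  let J : H' →ₗ[ℝ] Lp Y 2 ν :=
    { toFun := fun g => (hmem g).toLp _
      map_add' := fun g h => by
        rw [← MemLp.toLp_add]
        exact MemLp.toLp_congr _ _ (Eventually.of_forall fun x => by simp)
      map_smul' := fun c g => by
        rw [RingHom.id_apply, ← MemLp.toLp_const_smul]
        exact MemLp.toLp_congr _ _ (Eventually.of_forall fun x => by simp) }
  refine ⟨J.mkContinuous ((measureUnivNNReal ν : ℝ) ^ (2 : ℝ)⁻¹ * |κ|) fun g => ?_,
    fun g => (hmem g).coeFn_toLp⟩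
  have h1 := Lp.norm_le_of_ae_bound (f := J g) (C := |κ| * ‖g‖) (by positivity) (by
    filter_upwards [(hmem g).coeFn_toLp] with x hx
    change ‖((hmem g).toLp _ : X → Y) x‖ ≤ _
    rw [hx]; exact hb x g)
  rw [mul_assoc]
  simpa using h1

open scoped Classical in
/-- The canonical injection `I_ν` of `H'` into `L²(X, ν; Y)`. -/
def injection (H' : Type*) [NormedAddCommGroup H'] [InnerProductSpace ℝ H']
    [CompleteSpace H'] [RKHS ℝ H' X Y] (ν : Measure X) : H' →L[ℝ] Lp Y 2 ν :=
  if h : ∃ J : H' →L[ℝ] Lp Y 2 ν, IsInjection ν J then h.choose else 0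

/-- The covariance operator `T_ν = I_ν* I_ν`. -/
def covOp (H' : Type*) [NormedAddCommGroup H'] [InnerProductSpace ℝ H']
    [CompleteSpace H'] [RKHS ℝ H' X Y] (ν : Measure X) : H' →L[ℝ] H' :=
  (injection H' ν).adjoint ∘L injection H' ν

/-- The effective dimension `N(lam) = Tr((T_ν + lam I)⁻¹ T_ν)`. -/
def effDim (H' : Type*) [NormedAddCommGroup H'] [InnerProductSpace ℝ H']
    [CompleteSpace H'] [RKHS ℝ H' X Y] (ν : Measure X) (lam : ℝ) : ℝ :=
  trace (Ring.inverse (covOp H' ν + lam • 1) * covOp H' ν)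

/-- `∫ y dρ(y|x) = A(fhat)(x)`, the noise having finite second moment, and `fhat ∈ int D(A)`. -/
structure TrueSolution (ρ : Measure (X × Y)) [IsFiniteMeasure ρ] (D : Set H) (A : H → H')
    (fhat : H) : Prop where
  secondMoment : Integrable (fun z : X × Y => ‖z.2‖ ^ 2) ρ
  mem_interior : fhat ∈ interior D
  condExp : ∀ᵐ x ∂ρ.fst, ∫ y, y ∂(ρ.condKernel x) = A fhat x

/-- The Bernstein-type noise condition for `ε = y - A(fhat)(x)`. -/
def NoiseCondition (ρ : Measure (X × Y)) [IsFiniteMeasure ρ] (A : H → H') (fhat : H)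
    (M σ : ℝ) : Prop :=
  ∀ᵐ x ∂ρ.fst,
    ∫⁻ y, ENNReal.ofReal (Real.exp (‖y - A fhat x‖ / M) - ‖y - A fhat x‖ / M - 1)
      ∂(ρ.condKernel x) ≤ ENNReal.ofReal (σ ^ 2 / (2 * M ^ 2))

/-- The assumptions on the nonlinear operator `A` with domain `D`: convexity and closedness of the
domain, weak-to-weak sequential continuity, Lipschitz continuity on a ball of radius `ϱ` around
`fhat` that is so large as to contain `Q`, and the conditional stability estimate on `Q`. Only the
values of `A` on `D` matter. -/
structure OperatorAssumption (L : H →ₗ.[ℝ] H) (ν : Measure X) (D : Set H) (A : H → H')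
    (fhat : H) (Q : Set H) (p s α d θ ℓA ϱ : ℝ) : Prop where
  convex : Convex ℝ D
  closed : IsClosed D
  weakCont : ∀ (f : ℕ → H) (f₀ : H), (∀ n, f n ∈ D) → f₀ ∈ D →
    (∀ w : H, Tendsto (fun n => ⟪f n, w⟫) atTop (𝓝 ⟪f₀, w⟫)) →
    ∀ g : H', Tendsto (fun n => ⟪A (f n), g⟫) atTop (𝓝 ⟪A f₀, g⟫)
  lipschitz : ∀ f ∈ Metric.closedBall fhat ϱ ∩ D, ∀ f' ∈ Metric.closedBall fhat ϱ ∩ D,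
    ‖A f - A f'‖ ≤ ℓA * ‖f - f'‖
  large : Q ⊆ Metric.closedBall fhat ϱ
  subset : Q ⊆ scaleBall L θ fhat d ∩ D
  stability : ∀ f ∈ Q,
    ‖negPow L p (f - fhat)‖ ≤ α * ‖injection H' ν (A f - A fhat)‖ ^ s

/-- The Tikhonov functional in the Hilbert scale. -/
def tikhonov (L : H →ₗ.[ℝ] H) (A : H → H') (fbar : L.domain) {m : ℕ} (z : Fin m → X × Y)
    (lam : ℝ) (f : L.domain) : ℝ :=
  (1 / (m : ℝ)) * ∑ i, ‖A (f : H) (z i).1 - (z i).2‖ ^ 2 + lam * ‖L (f - fbar)‖ ^ 2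

/-- `f` is a global minimizer of the Tikhonov functional over `D(A) ∩ D(L)`. -/
def IsTikhonovMinimizer (L : H →ₗ.[ℝ] H) (D : Set H) (A : H → H') (fbar : L.domain) {m : ℕ}
    (z : Fin m → X × Y) (lam : ℝ) (f : H) : Prop :=
  f ∈ D ∧ ∃ hf : f ∈ L.domain, ∀ g : L.domain, (g : H) ∈ D →
    tikhonov L A fbar z lam ⟨f, hf⟩ ≤ tikhonov L A fbar z lam g

end Learning

/-- The regularization parameter `(log m / m)^{1/(2r+1)}`. -/
def regParam (r : ℝ) (m : ℕ) : ℝ := (Real.log m / m) ^ (1 / (2 * r + 1))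

/-- `u = (p+t) / (2(p+t) - 2s(t-1))`, used with `t = q` and with `t = r`. -/
def uIndex (p s t : ℝ) : ℝ := (p + t) / (2 * (p + t) - 2 * s * (t - 1))

/-- The exponent `(2u(s+p) - p) / (2(p+1))` of the rate. -/
def rateExp (p s u : ℝ) : ℝ := (2 * u * (s + p) - p) / (2 * (p + 1))

/-- The benchmark radius
`R(lam) = Rd^{((p+q)-s(q-1))/((p+r)-s(r-1))} lam^{s(r-q)/(2(p+r)-2s(r-1))}`. -/
def benchRadius (p q s r Rd lam : ℝ) : ℝ :=
  Rd ^ (((p + q) - s * (q - 1)) / ((p + r) - s * (r - 1))) *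
    lam ^ (s * (r - q) / (2 * (p + r) - 2 * s * (r - 1)))

end HilbertScale

end

set_option linter.unusedSectionVars false

/-! Write `B` for the inverse of `L`. The minimizer `f` is compared with an element `f₀` satisfying
`f₀ - fbar = B^q w`: the true solution itself if `q ≤ r`, otherwise the distance minimizer. Put `k =
L (f - f₀)`, let `x` be the `L²` norm of `A f - A fhat`, and let `y = ‖k‖`. Expanding the penalty
(`IsTikhonovMinimizer.compare`) and replacing empirical by population quantities
(`GoodSample.risk_bounds`) turns minimality into: `x² + λ y²` is at most the squared residual of
`f₀`, plus the sampling error, plus `2 λ ‖B^(q-1) k‖ ‖w‖`.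

Conditional stability bounds `‖B^(p+1) k‖` by `x^s` plus the error of `f₀`. Interpolating between
this and `‖k‖` (`norm_funcCalc_rpow_interp`) controls both `‖B k‖ = ‖f - f₀‖` and `‖B^(q-1) k‖`; the
condition `q ≤ p + 2` keeps the second power in range. The exponent `u` is chosen so that for `x ~
λ^u` and `y ~ λ^(u-1/2)` nothing on the right exceeds the order `λ^(2u)`. In these units the left
side is quadratic and the right side at most linear, so `balance_bound` bounds both unknowns.

The sampling error is controlled uniformly over `H'` by duality (`measure_sampling_le`). With `W =
(T + λ)^(-1/2)` every `g` is `W g'`, so it suffices to bound two random sums, of the vectors `W K_x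
ε` and of the Hilbert-Schmidt operators `W K_x K_x*`. Their tails follow from a recursion for the
mean of `cosh ‖·‖` (`cosh_norm_add_le`, `measure_norm_sum_ge_le`). The variances are governed by the
effective dimension, which is `O(log m)`; since `m λ^(2r+1) = log m`, the error is of order
`log(4/η) λ^(r+1/2)` (`measure_not_goodSample_le`).

If `r ≤ q`, the distance minimizer obeys a Lagrange multiplier equation (`exists_multiplier`), and
bounds on the symbol of that equation give its strong and weak errors (`norm_distMin_le`). The
converse stability estimate then bounds its residual. -/

namespace HilbertScale

/-! ### Continuous functional calculus of a positive operator on a real Hilbert space. -/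

section FunctionalCalculus

variable {H : Type*} [NormedAddCommGroup H] [InnerProductSpace ℝ H] [CompleteSpace H]

/-- A polynomial in a positive operator acts on a vector like the same polynomial in the compression
of the operator to a Krylov subspace. -/
theorem norm_aeval_apply_le {B : H →L[ℝ] H} (hB : B.IsPositive) (P : Polynomial ℝ) {c : ℝ}
    (hc : 0 ≤ c) (hP : ∀ t ∈ Icc 0 ‖B‖, |P.eval t| ≤ c) (f : H) :
    ‖Polynomial.aeval B P f‖ ≤ c * ‖f‖ := by
  set V : Submodule ℝ H := Submodule.span ℝ (range fun k : Fin (P.natDegree + 1) => (B ^ (k : ℕ)) f)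
  have hV : ∀ k ≤ P.natDegree, (B ^ k) f ∈ V := fun k hk =>
    Submodule.subset_span ⟨⟨k, Nat.lt_succ_of_le hk⟩, rfl⟩
  have hfin : FiniteDimensional ℝ V := FiniteDimensional.span_of_finite ℝ (finite_range _)
  set T : V →ₗ[ℝ] V := ((V.orthogonalProjectionOnto ∘L B ∘L V.subtypeL : V →L[ℝ] V) : V →ₗ[ℝ] V)
    with hT
  have hTin : ∀ v w : V, ⟪T v, w⟫ = ⟪B (v : H), (w : H)⟫ := fun v w => by
    rw [hT]
    simp
  have hsym : T.IsSymmetric := fun v w => by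
    rw [hTin, ← real_inner_comm v, hTin, real_inner_comm]
    exact (hB.inner_left_eq_inner_right _ _).symm
  set f' : V := ⟨f, by simpa using hV 0 (Nat.zero_le _)⟩
  have hpow : ∀ k ≤ P.natDegree, ((T ^ k) f' : H) = (B ^ k) f := by
    intro k
    induction k with
    | zero => intro _; simp [f']
    | succ k ih =>
      intro hk
      have h1 : (B ^ (k + 1)) f = B ((B ^ k) f) := by rw [pow_succ']; rfl
      have h2 : (T ^ (k + 1)) f' = T ((T ^ k) f') := by rw [pow_succ']; rfl
      -- The next Krylov vector still lies in `V`, because `k + 1` is at most the degree; so the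
      -- projection acts as the identity on it.
      have h3 := hV (k + 1) hk
      rw [h2, h1, ← ih (by omega)]
      rw [h1, ← ih (by omega)] at h3
      change ((V.orthogonalProjectionOnto (B ((T ^ k) f' : H)) : V) : H) = _
      exact V.starProjection_eq_self_iff.mpr h3
  have hPf : ((Polynomial.aeval T P f' : V) : H) = Polynomial.aeval B P f := by
    rw [Polynomial.aeval_eq_sum_range, Polynomial.aeval_eq_sum_range]
    simp only [LinearMap.sum_apply, LinearMap.smul_apply, sum_apply, smul_apply, Submodule.coe_sum, Submodule.coe_smul]
    refine Finset.sum_congr rfl fun k hk => ?_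
    rw [hpow k (Nat.lt_succ_iff.mp (Finset.mem_range.mp hk))]
  set b := hsym.eigenvectorBasis rfl
  set μ := hsym.eigenvalues rfl
  -- Each eigenvalue of the compression is a Rayleigh quotient of `B` at a unit vector, hence lies
  -- in `[0, ‖B‖]`.
  have hμ : ∀ i, |P.eval (μ i)| ≤ c := fun i => by
    have h1 : ⟪B (b i : H), (b i : H)⟫ = μ i := by
      rw [← hTin, hsym.apply_eigenvectorBasis, inner_smul_left]
      simp [b, μ]
    have hn : ‖(b i : H)‖ = 1 := b.orthonormal.1 i
    refine hP _ ⟨?_, ?_⟩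
    · rw [← h1]; exact hB.inner_nonneg_left _
    · rw [← h1]
      refine (real_inner_le_norm _ _).trans ?_
      rw [hn, mul_one]
      simpa [hn] using B.le_opNorm (b i : H)
  have hb : ∀ i, Polynomial.aeval T P (b i) = P.eval (μ i) • b i := fun i =>
    Module.End.aeval_apply_of_hasEigenvector (hsym.hasEigenvector_eigenvectorBasis rfl i)
  have hsum : ∀ i, ⟪b i, Polynomial.aeval T P f'⟫ = P.eval (μ i) * ⟪b i, f'⟫ := fun i => by
    conv_lhs => rw [← b.sum_repr' f', map_sum]
    simp only [map_smul, hb, smul_smul]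
    rw [b.orthonormal.inner_right_fintype, mul_comm]
  have h1 : ‖Polynomial.aeval T P f'‖ ^ 2 ≤ (c * ‖f'‖) ^ 2 := by
    rw [← b.sum_sq_norm_inner_right, mul_pow, ← b.sum_sq_norm_inner_right, Finset.mul_sum]
    refine Finset.sum_le_sum fun i _ => ?_
    rw [hsum, norm_mul, mul_pow]
    gcongr
    exact hμ i
  rw [← hPf]
  exact le_of_sq_le_sq h1 (by positivity)

theorem norm_aeval_le {B : H →L[ℝ] H} (hB : B.IsPositive) (P : Polynomial ℝ) {c : ℝ}
    (hP : ∀ t ∈ Icc 0 ‖B‖, |P.eval t| ≤ c) : ‖Polynomial.aeval B P‖ ≤ c := by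
  have hc : 0 ≤ c := (abs_nonneg _).trans (hP 0 ⟨le_rfl, norm_nonneg _⟩)
  exact ContinuousLinearMap.opNorm_le_bound _ hc (norm_aeval_apply_le hB P hc hP)

/-- The polynomials that are `ε`-close to `φ` on `[0, ‖B‖]`. -/
def nearPoly (B : H →L[ℝ] H) (φ : ℝ → ℝ) (ε : ℝ) : Set (Polynomial ℝ) :=
  {P | ∀ t ∈ Icc 0 ‖B‖, |P.eval t - φ t| ≤ ε}

theorem hasBasis_nearPoly (B : H →L[ℝ] H) (φ : ℝ → ℝ) :
    (⨅ ε ∈ Ioi (0 : ℝ), 𝓟 (nearPoly B φ ε)).HasBasis (fun ε => 0 < ε) (nearPoly B φ) := by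
  refine hasBasis_biInf_principal (S := Ioi (0 : ℝ)) ?_ ⟨1, mem_Ioi.mpr one_pos⟩
  intro a ha b hb
  exact ⟨min a b, mem_Ioi.mpr (lt_min ha hb), fun P hP t ht => (hP t ht).trans (min_le_left _ _),
    fun P hP t ht => (hP t ht).trans (min_le_right _ _)⟩

theorem norm_aeval_sub_aeval_le {B : H →L[ℝ] H} (hB : B.IsPositive) {φ : ℝ → ℝ} {ε δ : ℝ}
    {P Q : Polynomial ℝ} (hP : P ∈ nearPoly B φ ε) (hQ : Q ∈ nearPoly B φ δ) :
    ‖Polynomial.aeval B P - Polynomial.aeval B Q‖ ≤ ε + δ := by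
  rw [← map_sub]
  refine norm_aeval_le hB _ fun t ht => ?_
  rw [Polynomial.eval_sub]
  have := abs_sub_le (P.eval t) (φ t) (Q.eval t)
  have h1 := hP t ht
  have h2 := hQ t ht
  rw [abs_sub_comm] at h2
  linarith

/-- Weierstrass approximation makes the defining filter nontrivial and the norm bound on polynomials
makes its image Cauchy, so `limUnder` is a genuine limit. -/
theorem norm_aeval_sub_funcCalc_le {B : H →L[ℝ] H} (hB : B.IsPositive) {φ : ℝ → ℝ}
    (hφ : ContinuousOn φ (Icc 0 ‖B‖)) {P : Polynomial ℝ} {ε : ℝ} (hP : P ∈ nearPoly B φ ε) :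
    ‖Polynomial.aeval B P - funcCalc B φ‖ ≤ ε := by
  have hbas := hasBasis_nearPoly B φ
  have hne : ∀ δ, 0 < δ → (nearPoly B φ δ).Nonempty := fun δ hδ =>
    (exists_polynomial_near_of_continuousOn 0 ‖B‖ φ hφ δ hδ).imp fun P hP t ht => (hP t ht).le
  have hbot : (⨅ ε ∈ Ioi (0 : ℝ), 𝓟 (nearPoly B φ ε)).NeBot :=
    hbas.neBot_iff.mpr fun {δ} hδ => hne δ hδ
  have hlim : Tendsto (fun P => Polynomial.aeval B P) (⨅ ε ∈ Ioi (0 : ℝ), 𝓟 (nearPoly B φ ε))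
      (𝓝 (funcCalc B φ)) := by
    refine tendsto_nhds_limUnder (cauchy_iff_exists_le_nhds.mp ?_)
    rw [Metric.cauchy_iff]
    refine ⟨hbot.map _, fun δ hδ => ⟨_, image_mem_map (hbas.mem_of_mem (i := δ / 3) (by positivity)),
      ?_⟩⟩
    rintro _ ⟨P, hP, rfl⟩ _ ⟨Q, hQ, rfl⟩
    rw [dist_eq_norm]
    have := norm_aeval_sub_aeval_le hB hP hQ
    linarith
  refine le_of_forall_pos_le_add fun δ hδ => ?_
  have h1 := (tendsto_const_nhds (x := Polynomial.aeval B P)).sub hlim |>.norm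
  refine le_of_tendsto h1 ?_
  filter_upwards [hbas.mem_of_mem hδ] with Q hQ
  exact norm_aeval_sub_aeval_le hB hP hQ

/-- Uniform approximation of `φ` on `[0, ‖B‖]` by polynomials. -/
def PolyApprox (B : H →L[ℝ] H) (P : ℕ → Polynomial ℝ) (φ : ℝ → ℝ) : Prop :=
  ∃ Φ : C(Icc 0 ‖B‖, ℝ), (∀ t, Φ t = φ t) ∧
    Tendsto (fun n => (P n).toContinuousMapOnAlgHom (Icc 0 ‖B‖)) atTop (𝓝 Φ)

theorem exists_polyApprox (B : H →L[ℝ] H) {φ : ℝ → ℝ} (hφ : ContinuousOn φ (Icc 0 ‖B‖)) :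
    ∃ P, PolyApprox B P φ := by
  have h := mem_closure_iff_seq_limit.mp (continuousMap_mem_polynomialFunctions_closure 0 ‖B‖
    ⟨fun t => φ t, continuousOn_iff_continuous_domRestrict.mp hφ⟩)
  obtain ⟨u, hu, hlim⟩ := h
  choose P hP using hu
  refine ⟨P, ⟨fun t => φ t, continuousOn_iff_continuous_domRestrict.mp hφ⟩, fun t => rfl, ?_⟩
  convert hlim using 2 with n
  exact (hP n).2

namespace PolyApprox

variable {B : H →L[ℝ] H} {P Q : ℕ → Polynomial ℝ} {φ ψ : ℝ → ℝ}

theorem mul (hP : PolyApprox B P φ) (hQ : PolyApprox B Q ψ) :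
    PolyApprox B (fun n => P n * Q n) (fun t => φ t * ψ t) := by
  obtain ⟨Φ, h1, h2⟩ := hP
  obtain ⟨Ψ, h3, h4⟩ := hQ
  exact ⟨Φ * Ψ, fun t => by simp [h1, h3], by simpa only [map_mul] using h2.mul h4⟩

theorem add (hP : PolyApprox B P φ) (hQ : PolyApprox B Q ψ) :
    PolyApprox B (fun n => P n + Q n) (fun t => φ t + ψ t) := by
  obtain ⟨Φ, h1, h2⟩ := hP
  obtain ⟨Ψ, h3, h4⟩ := hQ
  exact ⟨Φ + Ψ, fun t => by simp [h1, h3], by simpa only [map_add] using h2.add h4⟩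

theorem continuousOn (hP : PolyApprox B P φ) : ContinuousOn φ (Icc 0 ‖B‖) := by
  obtain ⟨Φ, h1, -⟩ := hP
  rw [continuousOn_iff_continuous_domRestrict]
  convert Φ.continuous using 1
  exact funext fun t => (h1 t).symm

theorem tendsto (hB : B.IsPositive) (hP : PolyApprox B P φ) :
    Tendsto (fun n => Polynomial.aeval B (P n)) atTop (𝓝 (funcCalc B φ)) := by
  have hc := hP.continuousOn
  obtain ⟨Φ, h1, h2⟩ := hP
  rw [tendsto_iff_norm_sub_tendsto_zero] at h2 ⊢
  refine squeeze_zero (fun _ => norm_nonneg _) (fun n => ?_) h2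
  refine norm_aeval_sub_funcCalc_le hB hc fun t ht => ?_
  rw [← h1 ⟨t, ht⟩]
  exact ContinuousMap.norm_coe_le_norm ((P n).toContinuousMapOnAlgHom (Icc 0 ‖B‖) - Φ) ⟨t, ht⟩

end PolyApprox

variable {B : H →L[ℝ] H} {φ ψ : ℝ → ℝ}

theorem funcCalc_congr (h : EqOn φ ψ (Icc 0 ‖B‖)) : funcCalc B φ = funcCalc B ψ := by
  have : ∀ ε, {P : Polynomial ℝ | ∀ t ∈ Icc 0 ‖B‖, |P.eval t - φ t| ≤ ε} =
      {P : Polynomial ℝ | ∀ t ∈ Icc 0 ‖B‖, |P.eval t - ψ t| ≤ ε} := fun ε => by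
    ext P
    exact forall₂_congr fun t ht => by rw [h ht]
  simp only [funcCalc, this]

theorem funcCalc_mul (hB : B.IsPositive) (hφ : ContinuousOn φ (Icc 0 ‖B‖))
    (hψ : ContinuousOn ψ (Icc 0 ‖B‖)) :
    funcCalc B (fun t => φ t * ψ t) = funcCalc B φ * funcCalc B ψ := by
  obtain ⟨P, hP⟩ := exists_polyApprox B hφ
  obtain ⟨Q, hQ⟩ := exists_polyApprox B hψ
  refine tendsto_nhds_unique ((hP.mul hQ).tendsto hB) ?_
  simpa only [map_mul] using (hP.tendsto hB).mul (hQ.tendsto hB)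

theorem funcCalc_add (hB : B.IsPositive) (hφ : ContinuousOn φ (Icc 0 ‖B‖))
    (hψ : ContinuousOn ψ (Icc 0 ‖B‖)) :
    funcCalc B (fun t => φ t + ψ t) = funcCalc B φ + funcCalc B ψ := by
  obtain ⟨P, hP⟩ := exists_polyApprox B hφ
  obtain ⟨Q, hQ⟩ := exists_polyApprox B hψ
  refine tendsto_nhds_unique ((hP.add hQ).tendsto hB) ?_
  simpa only [map_add] using (hP.tendsto hB).add (hQ.tendsto hB)

theorem funcCalc_polynomial (hB : B.IsPositive) (P : Polynomial ℝ) :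
    funcCalc B (fun t => P.eval t) = Polynomial.aeval B P := by
  have := norm_aeval_sub_funcCalc_le hB (φ := fun t => P.eval t) P.continuous.continuousOn (P := P)
    (ε := 0) fun t _ => by simp
  exact (sub_eq_zero.mp (norm_le_zero_iff.mp this)).symm

theorem funcCalc_const (hB : B.IsPositive) (c : ℝ) : funcCalc B (fun _ => c) = c • 1 := by
  have := funcCalc_polynomial hB (Polynomial.C c)
  simpa [Algebra.algebraMap_eq_smul_one] using this

theorem funcCalc_id (hB : B.IsPositive) : funcCalc B (fun t => t) = B := by
  simpa using funcCalc_polynomial hB Polynomial.X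

theorem funcCalc_const_mul (hB : B.IsPositive) (hφ : ContinuousOn φ (Icc 0 ‖B‖)) (c : ℝ) :
    funcCalc B (fun t => c * φ t) = c • funcCalc B φ := by
  rw [funcCalc_mul hB continuousOn_const hφ, funcCalc_const hB, smul_mul_assoc, one_mul]

theorem norm_funcCalc_le (hB : B.IsPositive) (hφ : ContinuousOn φ (Icc 0 ‖B‖)) {c : ℝ}
    (h : ∀ t ∈ Icc 0 ‖B‖, |φ t| ≤ c) : ‖funcCalc B φ‖ ≤ c := by
  refine le_of_forall_pos_le_add fun δ hδ => ?_
  obtain ⟨P, hP⟩ := exists_polynomial_near_of_continuousOn 0 ‖B‖ φ hφ (δ / 2) (by positivity)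
  have h1 := norm_aeval_sub_funcCalc_le hB hφ (P := P) (ε := δ / 2) fun t ht => (hP t ht).le
  have h2 : ‖Polynomial.aeval B P‖ ≤ c + δ / 2 := norm_aeval_le hB P fun t ht => by
    have h3 := hP t ht
    have h4 := h t ht
    have h5 := abs_sub_abs_le_abs_sub (P.eval t) (φ t)
    linarith
  have h3 := norm_sub_norm_le (funcCalc B φ) (Polynomial.aeval B P)
  rw [norm_sub_rev] at h3
  linarith

theorem inner_funcCalc_left (hB : B.IsPositive) (hφ : ContinuousOn φ (Icc 0 ‖B‖)) (x y : H) :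
    ⟪funcCalc B φ x, y⟫ = ⟪x, funcCalc B φ y⟫ := by
  obtain ⟨P, hP⟩ := exists_polyApprox B hφ
  have hpow : ∀ (n : ℕ) (x y : H), ⟪(B ^ n) x, y⟫ = ⟪x, (B ^ n) y⟫ := by
    intro n
    induction n with
    | zero => simp
    | succ n ih =>
      intro x y
      conv_lhs => rw [pow_succ]
      rw [pow_succ', mul_apply_eq_comp, mul_apply_eq_comp, ih]
      exact hB.inner_left_eq_inner_right _ _
  have hp : ∀ Q : Polynomial ℝ, ⟪Polynomial.aeval B Q x, y⟫ = ⟪x, Polynomial.aeval B Q y⟫ := by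
    intro Q
    simp only [Polynomial.aeval_eq_sum_range, sum_apply, smul_apply, sum_inner, inner_sum,
      inner_smul_left, inner_smul_right, hpow, conj_trivial]
  have h1 : ∀ z, Tendsto (fun n => Polynomial.aeval B (P n) z) atTop (𝓝 (funcCalc B φ z)) :=
    fun z => ((ContinuousLinearMap.apply ℝ H z).continuous.tendsto _).comp (hP.tendsto hB)
  refine tendsto_nhds_unique ((h1 x).inner tendsto_const_nhds) ?_
  simp only [hp]
  exact tendsto_const_nhds.inner (h1 y)

/-- Writing `φ` as the square of `√φ` exhibits the quadratic form as a squared norm. -/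
theorem inner_funcCalc_nonneg (hB : B.IsPositive) (hφ : ContinuousOn φ (Icc 0 ‖B‖))
    (h : ∀ t ∈ Icc 0 ‖B‖, 0 ≤ φ t) (x : H) : 0 ≤ ⟪funcCalc B φ x, x⟫ := by
  have hs : ContinuousOn (fun t => √(φ t)) (Icc 0 ‖B‖) := hφ.sqrt
  rw [funcCalc_congr (ψ := fun t => √(φ t) * √(φ t)) fun t ht => (Real.mul_self_sqrt (h t ht)).symm,
    funcCalc_mul hB hs hs, mul_apply_eq_comp, inner_funcCalc_left hB hs]
  exact real_inner_self_nonneg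

theorem norm_sq_funcCalc (hB : B.IsPositive) (hφ : ContinuousOn φ (Icc 0 ‖B‖)) (x : H) :
    ‖funcCalc B φ x‖ ^ 2 = ⟪funcCalc B (fun t => φ t * φ t) x, x⟫ := by
  rw [← real_inner_self_eq_norm_sq, inner_funcCalc_left hB hφ, funcCalc_mul hB hφ hφ,
    mul_apply_eq_comp, real_inner_comm]

end FunctionalCalculus

/-! ### Fractional powers and interpolation. -/

section Powers

variable {H : Type*} [NormedAddCommGroup H] [InnerProductSpace ℝ H] [CompleteSpace H]
variable {B : H →L[ℝ] H}

theorem continuousOn_rpow_Icc {a b : ℝ} (ha : 0 ≤ a) : ContinuousOn (fun t : ℝ => t ^ a) (Icc 0 b) :=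
  fun _ _ => (Real.continuousAt_rpow_const _ _ (Or.inr ha)).continuousWithinAt

theorem funcCalc_rpow_add (hB : B.IsPositive) {a b : ℝ} (ha : 0 ≤ a) (hb : 0 ≤ b) :
    funcCalc B (fun t => t ^ (a + b)) = funcCalc B (fun t => t ^ a) * funcCalc B (fun t => t ^ b) := by
  rw [← funcCalc_mul hB (continuousOn_rpow_Icc ha) (continuousOn_rpow_Icc hb)]
  exact funcCalc_congr fun t ht => Real.rpow_add_of_nonneg ht.1 ha hb

theorem funcCalc_rpow_zero (hB : B.IsPositive) : funcCalc B (fun t => t ^ (0 : ℝ)) = 1 := by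
  simpa using funcCalc_const hB 1

theorem funcCalc_rpow_one (hB : B.IsPositive) : funcCalc B (fun t => t ^ (1 : ℝ)) = B := by
  simpa using funcCalc_id hB

/-- Integer powers are injective as compositions of `B`, and every integer power above `a` factors
through the power `a`. -/
theorem funcCalc_rpow_injective (hB : B.IsPositive) (hinj : Function.Injective B) {a : ℝ}
    (ha : 0 ≤ a) {x : H} (hx : funcCalc B (fun t => t ^ a) x = 0) : x = 0 := by
  have hn : ∀ n : ℕ, Function.Injective (funcCalc B (fun t => t ^ (n : ℝ))) := by
    intro n
    induction n with
    | zero => rw [Nat.cast_zero, funcCalc_rpow_zero hB]; exact Function.injective_id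
    | succ n ih =>
      rw [Nat.cast_succ, funcCalc_rpow_add hB (Nat.cast_nonneg n) zero_le_one, funcCalc_rpow_one hB]
      exact ih.comp hinj
  obtain ⟨n, hn'⟩ := exists_nat_ge a
  apply hn n
  rw [map_zero, ← sub_add_cancel (n : ℝ) a, funcCalc_rpow_add hB (by linarith) ha,
    mul_apply_eq_comp, hx, map_zero]

theorem norm_funcCalc_rpow_le (hB : B.IsPositive) {a c : ℝ} (ha : 0 ≤ a) (hc : ‖B‖ ≤ c) :
    ‖funcCalc B (fun t => t ^ a)‖ ≤ c ^ a :=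
  norm_funcCalc_le hB (continuousOn_rpow_Icc ha) fun t ht => by
    rw [abs_of_nonneg (Real.rpow_nonneg ht.1 _)]
    exact Real.rpow_le_rpow ht.1 (ht.2.trans hc) ha

/-- The interpolation inequality `‖B^{θ b} x‖ ≤ ‖B^b x‖^θ ‖x‖^{1-θ}`. -/
theorem norm_funcCalc_rpow_interp (hB : B.IsPositive) (hinj : Function.Injective B) {b θ : ℝ}
    (hb : 0 ≤ b) (hθ : 0 ≤ θ) (hθ1 : θ ≤ 1) (x : H) :
    ‖funcCalc B (fun t => t ^ (θ * b)) x‖ ≤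
      ‖funcCalc B (fun t => t ^ b) x‖ ^ θ * ‖x‖ ^ (1 - θ) := by
  obtain rfl | hx := eq_or_ne x 0
  · simp only [map_zero, norm_zero]; positivity
  have hx' : funcCalc B (fun t => t ^ b) x ≠ 0 := fun h => hx (funcCalc_rpow_injective hB hinj hb h)
  set X := ‖funcCalc B (fun t => t ^ b) x‖ with hX
  set Y := ‖x‖
  have hX0 : 0 < X := norm_pos_iff.mpr hx'
  have hY0 : 0 < Y := norm_pos_iff.mpr hx
  -- `K` is the square of the claimed bound. Weighted AM-GM at each `t` bounds `t^(2θb)` by a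
  -- combination of `t^(2b)` and `1` whose quadratic form at `x` is exactly `K`.
  set K := (X ^ 2) ^ θ * (Y ^ 2) ^ (1 - θ)
  have hK : 0 < K := by positivity
  have hcb : ContinuousOn (fun t : ℝ => t ^ b) (Icc 0 ‖B‖) := continuousOn_rpow_Icc hb
  have hcθ : ContinuousOn (fun t : ℝ => t ^ (θ * b)) (Icc 0 ‖B‖) :=
    continuousOn_rpow_Icc (by positivity)
  set φ : ℝ → ℝ := fun t => K * θ / X ^ 2 * (t ^ b * t ^ b) + K * (1 - θ) / Y ^ 2 +
    (-1) * (t ^ (θ * b) * t ^ (θ * b)) with hφ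
  have hφ0 : ∀ t ∈ Icc 0 ‖B‖, 0 ≤ φ t := fun t ht => by
    have h0 : 0 ≤ t ^ b := Real.rpow_nonneg ht.1 _
    have h1 := Real.geom_mean_le_arith_mean2_weighted hθ (sub_nonneg.mpr hθ1)
      (p₁ := (t ^ b) ^ 2 / X ^ 2) (p₂ := 1 / Y ^ 2) (by positivity) (by positivity) (by ring)
    rw [Real.div_rpow (by positivity) (by positivity), Real.div_rpow (by positivity) (by positivity),
      Real.one_rpow] at h1
    have h2 : ((t ^ b) ^ 2) ^ θ = t ^ (θ * b) * t ^ (θ * b) := by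
      rw [← sq, ← Real.rpow_natCast, ← Real.rpow_natCast, ← Real.rpow_mul ht.1, ← Real.rpow_mul ht.1,
        ← Real.rpow_mul ht.1]
      ring_nf
    rw [h2] at h1
    have h3 := mul_le_mul_of_nonneg_left h1 hK.le
    have h4 : K * (t ^ (θ * b) * t ^ (θ * b) / (X ^ 2) ^ θ * (1 / (Y ^ 2) ^ (1 - θ))) =
        t ^ (θ * b) * t ^ (θ * b) := by
      simp only [K]
      field_simp
    rw [h4] at h3
    have h5 : K * (θ * ((t ^ b) ^ 2 / X ^ 2) + (1 - θ) * (1 / Y ^ 2)) =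
      K * θ / X ^ 2 * (t ^ b * t ^ b) + K * (1 - θ) / Y ^ 2 := by ring
    rw [h5] at h3
    simp only [hφ]
    linarith
  have hc1 : ContinuousOn (fun t : ℝ => t ^ b * t ^ b) (Icc 0 ‖B‖) := hcb.mul hcb
  have hc2 : ContinuousOn (fun t : ℝ => t ^ (θ * b) * t ^ (θ * b)) (Icc 0 ‖B‖) := hcθ.mul hcθ
  have hc3 : ContinuousOn (fun t : ℝ => K * θ / X ^ 2 * (t ^ b * t ^ b)) (Icc 0 ‖B‖) :=
    continuousOn_const.mul hc1
  have hc4 : ContinuousOn (fun t : ℝ => (-1) * (t ^ (θ * b) * t ^ (θ * b))) (Icc 0 ‖B‖) :=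
    continuousOn_const.mul hc2
  have hc5 : ContinuousOn (fun t : ℝ => K * θ / X ^ 2 * (t ^ b * t ^ b) + K * (1 - θ) / Y ^ 2)
      (Icc 0 ‖B‖) := hc3.add continuousOn_const
  have hpos := inner_funcCalc_nonneg hB (φ := φ) (hc5.add hc4) hφ0 x
  rw [hφ, funcCalc_add hB hc5 hc4, funcCalc_add hB hc3 continuousOn_const,
    funcCalc_const_mul hB hc1, funcCalc_const_mul hB hc2, funcCalc_const hB] at hpos
  simp only [add_apply, smul_apply, inner_add_left,
    inner_smul_left, one_apply_eq_self, real_inner_self_eq_norm_sq, conj_trivial] at hpos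
  rw [← norm_sq_funcCalc hB hcb, ← norm_sq_funcCalc hB hcθ, ← hX] at hpos
  have h6 : K * θ / X ^ 2 * X ^ 2 + K * (1 - θ) / Y ^ 2 * ‖x‖ ^ 2 = K := by
    change K * θ / X ^ 2 * X ^ 2 + K * (1 - θ) / Y ^ 2 * Y ^ 2 = K
    field_simp
    ring
  have h7 : K = (X ^ θ * Y ^ (1 - θ)) ^ 2 := by
    simp only [K]
    rw [mul_pow, Real.rpow_pow_comm hX0.le, Real.rpow_pow_comm hY0.le]
  rw [h6, h7] at hpos
  exact le_of_sq_le_sq (by linarith) (by positivity)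

end Powers

/-! ### Exponential tail bounds in Hilbert space. -/

section Concentration

/-- In the variable `v` the function is the series `∑ v^n / (2n)!`, a nonnegative combination of
monomials convex on `v ≥ 0`. -/
theorem convexOn_cosh_sqrt : ConvexOn ℝ (Ici 0) fun v => Real.cosh (√v) := by
  have hsum : ∀ v ∈ Ici (0 : ℝ), HasSum (fun n : ℕ => v ^ n / (2 * n).factorial) (Real.cosh (√v)) := by
    intro v hv
    have := Real.hasSum_cosh (√v)
    simpa only [pow_mul, Real.sq_sqrt hv] using this
  refine ⟨convex_Ici 0, fun x hx y hy a b ha hb hab => ?_⟩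
  have hxy : a • x + b • y ∈ Ici (0 : ℝ) := convex_Ici 0 hx hy ha hb hab
  refine hasSum_le (fun n => ?_) (hsum _ hxy) (((hsum x hx).mul_left a).add ((hsum y hy).mul_left b))
  have := (convexOn_pow n).2 hx hy ha hb hab
  simp only [smul_eq_mul] at this ⊢
  rw [← mul_div_assoc, ← mul_div_assoc, ← add_div]
  gcongr

variable {G : Type*} [NormedAddCommGroup G] [InnerProductSpace ℝ G]

/-- Second order upper bound for `cosh ‖·‖` in an inner product space. -/
theorem cosh_norm_add_le (S ζ : G) :
    Real.cosh ‖S + ζ‖ ≤ Real.cosh ‖S‖ * (Real.exp ‖ζ‖ - ‖ζ‖) +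
      ⟪(Real.sinh ‖S‖ / ‖S‖) • S, ζ⟫ := by
  set a := ‖S‖ with ha
  set b := ‖ζ‖ with hb
  have ha0 : 0 ≤ a := norm_nonneg _
  have hb0 : 0 ≤ b := norm_nonneg _
  have hsb : 0 ≤ Real.sinh b - b := sub_nonneg.mpr (Real.self_le_sinh_iff.mpr hb0)
  have hexp : Real.exp b = Real.cosh b + Real.sinh b := (Real.cosh_add_sinh b).symm
  have hsa : 0 ≤ Real.sinh a := Real.sinh_nonneg_iff.mpr ha0
  have hca : Real.sinh a ≤ Real.cosh a := (Real.sinh_lt_cosh a).le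
  have hcos : |⟪S, ζ⟫| ≤ a * b := abs_real_inner_le_norm S ζ
  obtain hab | hab := (mul_nonneg ha0 hb0).eq_or_lt
  · have h0 : ⟪S, ζ⟫ = 0 := abs_nonpos_iff.mp (hab ▸ hcos)
    rw [inner_smul_left, h0, mul_zero, add_zero]
    rcases mul_eq_zero.mp hab.symm with h | h
    · rw [norm_eq_zero.mp (ha.symm.trans h), zero_add, ← hb, h, Real.cosh_zero, hexp]
      linarith
    · rw [norm_eq_zero.mp (hb.symm.trans h), add_zero, ← ha, h, Real.exp_zero]
      simp
  have ha1 : a ≠ 0 := fun h => by simp [h] at hab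
  have hb1 : b ≠ 0 := fun h => by simp [h] at hab
  -- `2θ - 1` is the cosine of the angle between `S` and `ζ`, so `‖S + ζ‖²` is the convex
  -- combination of `(a + b)²` and `(a - b)²` with weights `θ` and `1 - θ`.
  set θ := (1 + ⟪S, ζ⟫ / (a * b)) / 2 with hθ
  have hcos' := abs_le.mp hcos
  have hc1 : ⟪S, ζ⟫ / (a * b) ≤ 1 := (div_le_one hab).mpr hcos'.2
  have hc2 : -1 ≤ ⟪S, ζ⟫ / (a * b) := (le_div_iff₀ hab).mpr (by linarith)
  have hin : ⟪S, ζ⟫ = (2 * θ - 1) * (a * b) := by rw [hθ]; field_simp; ring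
  have hθ0 : 0 ≤ θ := by rw [hθ]; linarith
  have hθ1 : 0 ≤ 1 - θ := by rw [hθ]; linarith
  have hconv := convexOn_cosh_sqrt.2 (mem_Ici.mpr (sq_nonneg (a + b)))
    (mem_Ici.mpr (sq_nonneg (a - b))) hθ0 hθ1 (by ring)
  have hv : θ • (a + b) ^ 2 + (1 - θ) • (a - b) ^ 2 = ‖S + ζ‖ ^ 2 := by
    rw [norm_add_sq_real, hin, smul_eq_mul, smul_eq_mul]
    ring
  have hlin : ⟪(Real.sinh a / a) • S, ζ⟫ = Real.sinh a * ((2 * θ - 1) * b) := by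
    rw [inner_smul_left, hin]
    simp only [conj_trivial]
    field_simp
  beta_reduce at hconv
  rw [hv] at hconv
  simp only [Real.sqrt_sq_eq_abs, abs_norm, Real.cosh_abs,
    Real.cosh_add, Real.cosh_sub, smul_eq_mul] at hconv
  rw [hlin, hexp]
  -- After convexity the gap to the claim is `(sinh b - b) (cosh a - (2θ - 1) sinh a)`, the sum of
  -- these two nonnegative terms.
  have h1 : 0 ≤ θ * ((Real.cosh a - Real.sinh a) * (Real.sinh b - b)) :=
    mul_nonneg hθ0 (mul_nonneg (by linarith) hsb)
  have h2 : 0 ≤ (1 - θ) * ((Real.cosh a + Real.sinh a) * (Real.sinh b - b)) :=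
    mul_nonneg hθ1 (mul_nonneg (by linarith) hsb)
  linarith [h1, h2, hconv]

variable [CompleteSpace G] {Z : Type*} [MeasurableSpace Z]

/-- The linear term of `cosh_norm_add_le` integrates to zero because `ξ` is centred, and the moment
condition bounds the remaining factor by `1 + v`. -/
theorem lintegral_cosh_norm_add_le {μ : Measure Z} [IsProbabilityMeasure μ] {ξ : Z → G}
    (hξ : Integrable ξ μ) (h0 : ∫ z, ξ z ∂μ = 0) {v : ℝ} (hv0 : 0 ≤ v)
    (hv : ∫⁻ z, ENNReal.ofReal (Real.exp ‖ξ z‖ - ‖ξ z‖ - 1) ∂μ ≤ ENNReal.ofReal v) (S : G) :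
    ∫⁻ z, ENNReal.ofReal (Real.cosh ‖S + ξ z‖) ∂μ ≤ ENNReal.ofReal (Real.cosh ‖S‖ * (1 + v)) := by
  have hnn : ∀ z, 0 ≤ Real.exp ‖ξ z‖ - ‖ξ z‖ - 1 := fun z => by
    linarith [Real.add_one_le_exp ‖ξ z‖]
  have hm : AEStronglyMeasurable (fun z => Real.exp ‖ξ z‖ - ‖ξ z‖ - 1) μ :=
    ((Real.continuous_exp.comp_aestronglyMeasurable hξ.1.norm).sub hξ.1.norm).sub
      aestronglyMeasurable_const
  have hint : Integrable (fun z => Real.exp ‖ξ z‖ - ‖ξ z‖ - 1) μ := by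
    refine ⟨hm, ?_⟩
    rw [hasFiniteIntegral_iff_ofReal (Eventually.of_forall hnn)]
    exact hv.trans_lt ENNReal.ofReal_lt_top
  have hvi : ∫ z, (Real.exp ‖ξ z‖ - ‖ξ z‖ - 1) ∂μ ≤ v := by
    rw [integral_eq_lintegral_of_nonneg_ae (Eventually.of_forall hnn) hm]
    exact ENNReal.toReal_le_of_le_ofReal hv0 hv
  set l := (Real.sinh ‖S‖ / ‖S‖) • S
  have hl : Integrable (fun z => ⟪l, ξ z⟫) μ := hξ.const_inner l
  set F : Z → ℝ := fun z => Real.cosh ‖S‖ * (1 + (Real.exp ‖ξ z‖ - ‖ξ z‖ - 1)) + ⟪l, ξ z⟫ with hF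
  have hF1 : Integrable (fun z => Real.cosh ‖S‖ * (1 + (Real.exp ‖ξ z‖ - ‖ξ z‖ - 1))) μ :=
    ((integrable_const 1).add hint).const_mul _
  have hFi : Integrable F μ := hF1.add hl
  have hle : ∀ z, Real.cosh ‖S + ξ z‖ ≤ F z := fun z => by
    have := cosh_norm_add_le S (ξ z)
    simp only [hF]
    convert this using 3
    ring
  have hF0 : ∀ z, 0 ≤ F z := fun z => (Real.cosh_pos _).le.trans (hle z)
  calc ∫⁻ z, ENNReal.ofReal (Real.cosh ‖S + ξ z‖) ∂μ
      ≤ ∫⁻ z, ENNReal.ofReal (F z) ∂μ :=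
        lintegral_mono fun z => ENNReal.ofReal_le_ofReal (hle z)
    _ = ENNReal.ofReal (∫ z, F z ∂μ) :=
        (ofReal_integral_eq_lintegral_ofReal hFi (Eventually.of_forall hF0)).symm
    _ ≤ _ := by
        refine ENNReal.ofReal_le_ofReal ?_
        rw [hF, integral_add hF1 hl, integral_inner hξ, h0, inner_zero_right, add_zero,
          integral_const_mul, integral_add (integrable_const 1) hint]
        simp only [integral_const, probReal_univ, smul_eq_mul, one_mul]
        gcongr

/-- The starting point `S` is left free so that the induction can absorb the first sample into it;
each sample costs one factor `1 + v`. -/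
theorem lintegral_cosh_norm_sum_le {μ : Measure Z} [IsProbabilityMeasure μ] {ξ : Z → G}
    (hm : StronglyMeasurable ξ)
    (hξ : Integrable ξ μ) (h0 : ∫ z, ξ z ∂μ = 0) {v : ℝ} (hv0 : 0 ≤ v)
    (hv : ∫⁻ z, ENNReal.ofReal (Real.exp ‖ξ z‖ - ‖ξ z‖ - 1) ∂μ ≤ ENNReal.ofReal v) (m : ℕ) :
    ∀ S : G, ∫⁻ z, ENNReal.ofReal (Real.cosh ‖S + ∑ i, ξ (z i)‖) ∂(Measure.pi fun _ : Fin m => μ) ≤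
      ENNReal.ofReal (Real.cosh ‖S‖ * (1 + v) ^ m) := by
  induction m with
  | zero => intro S; simp
  | succ m ih =>
    intro S
    have hsm : ∀ n : ℕ, StronglyMeasurable fun z : Fin n → Z => ∑ i, ξ (z i) := fun n =>
      Finset.stronglyMeasurable_fun_sum _ fun i _ => hm.comp_measurable (measurable_pi_apply i)
    have hmeas : ∀ (S : G) (n : ℕ), Measurable fun z : Fin n → Z =>
        ENNReal.ofReal (Real.cosh ‖S + ∑ i, ξ (z i)‖) := fun S n =>
      (Real.continuous_cosh.measurable.comp
        (stronglyMeasurable_const.add (hsm n)).norm.measurable).ennreal_ofReal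
    have hmp := (measurePreserving_piFinSuccAbove (fun _ : Fin (m + 1) => μ) 0).symm
    rw [← hmp.lintegral_comp (hmeas S (m + 1))]
    have hmc := (hmeas S (m + 1)).comp hmp.measurable
    simp only [Function.comp_def] at hmc
    rw [lintegral_prod _ hmc.aemeasurable]
    have hsplit : ∀ (x : Z) (y : Fin m → Z), S + ∑ i, ξ
        ((MeasurableEquiv.piFinSuccAbove (fun _ : Fin (m + 1) => Z) 0).symm (x, y) i) =
        S + ξ x + ∑ i, ξ (y i) := fun x y => by
      rw [Fin.sum_univ_succ, add_assoc]
      rfl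
    simp only [hsplit]
    calc _ ≤ ∫⁻ x, ENNReal.ofReal (Real.cosh ‖S + ξ x‖ * (1 + v) ^ m) ∂μ :=
          lintegral_mono fun x => ih (S + ξ x)
      _ = (∫⁻ x, ENNReal.ofReal (Real.cosh ‖S + ξ x‖) ∂μ) * ENNReal.ofReal ((1 + v) ^ m) := by
          rw [← lintegral_mul_const']
          · refine lintegral_congr fun x => ENNReal.ofReal_mul (Real.cosh_pos _).le
          · exact ENNReal.ofReal_ne_top
      _ ≤ ENNReal.ofReal (Real.cosh ‖S‖ * (1 + v)) * ENNReal.ofReal ((1 + v) ^ m) := by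
          gcongr
          exact lintegral_cosh_norm_add_le hξ h0 hv0 hv S
      _ = _ := by
          rw [← ENNReal.ofReal_mul (by have := Real.cosh_pos ‖S‖; positivity)]
          ring_nf

/-- Exponential tail bound for sums of independent centred random vectors in a Hilbert space. -/
theorem measure_norm_sum_ge_le {μ : Measure Z} [IsProbabilityMeasure μ] {ξ : Z → G}
    (hm : StronglyMeasurable ξ)
    (hξ : Integrable ξ μ) (h0 : ∫ z, ξ z ∂μ = 0) {v : ℝ} (hv0 : 0 ≤ v)
    (hv : ∫⁻ z, ENNReal.ofReal (Real.exp ‖ξ z‖ - ‖ξ z‖ - 1) ∂μ ≤ ENNReal.ofReal v) (m : ℕ) (a : ℝ) :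
    (Measure.pi fun _ : Fin m => μ) {z | a ≤ ‖∑ i, ξ (z i)‖} ≤
      ENNReal.ofReal (2 * Real.exp (m * v - a)) := by
  have hsm : StronglyMeasurable fun z : Fin m → Z => ∑ i, ξ (z i) :=
    Finset.stronglyMeasurable_fun_sum _ fun i _ => hm.comp_measurable (measurable_pi_apply i)
  have hmeas : Measurable fun z : Fin m → Z =>
      ENNReal.ofReal (Real.cosh ‖0 + ∑ i, ξ (z i)‖) :=
    (Real.continuous_cosh.measurable.comp
      (stronglyMeasurable_const.add hsm).norm.measurable).ennreal_ofReal
  have h1 := mul_meas_ge_le_lintegral (μ := Measure.pi fun _ : Fin m => μ) hmeas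
    (ENNReal.ofReal (Real.exp a / 2))
  have h2 := h1.trans (lintegral_cosh_norm_sum_le hm hξ h0 hv0 hv m 0)
  have h3 : {z : Fin m → Z | a ≤ ‖∑ i, ξ (z i)‖} ⊆
      {z | ENNReal.ofReal (Real.exp a / 2) ≤ ENNReal.ofReal (Real.cosh ‖0 + ∑ i, ξ (z i)‖)} := by
    intro z hz
    refine ENNReal.ofReal_le_ofReal ?_
    rw [zero_add, Real.cosh_eq]
    have := Real.exp_le_exp.mpr (show a ≤ ‖∑ i, ξ (z i)‖ from hz)
    have := Real.exp_pos (-‖∑ i, ξ (z i)‖)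
    linarith
  have h4 : 0 < Real.exp a / 2 := by positivity
  have h5 : (1 + v) ^ m ≤ Real.exp (m * v) := by
    rw [Real.exp_nat_mul]
    have := Real.add_one_le_exp v
    gcongr
    linarith
  calc _ ≤ _ := measure_mono h3
    _ ≤ ENNReal.ofReal (Real.cosh ‖(0 : G)‖ * (1 + v) ^ m) / ENNReal.ofReal (Real.exp a / 2) := by
        rw [ENNReal.le_div_iff_mul_le (Or.inl (by simpa using h4)) (Or.inl ENNReal.ofReal_ne_top),
          mul_comm]
        exact h2
    _ ≤ _ := by
        rw [← ENNReal.ofReal_div_of_pos h4, norm_zero, Real.cosh_zero, one_mul]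
        refine ENNReal.ofReal_le_ofReal ?_
        rw [Real.exp_sub]
        calc (1 + v) ^ m / (Real.exp a / 2) ≤ Real.exp (m * v) / (Real.exp a / 2) := by gcongr
          _ = _ := by field_simp

end Concentration

/-! ### Orthonormal bases, Hilbert-Schmidt sums and measurability. -/

section Bases

/-- Distinct members are at distance `√2`, so the balls of radius `1/2` around them are disjoint
open sets. -/
theorem countable_of_orthonormal {E ι : Type*} [NormedAddCommGroup E] [InnerProductSpace ℝ E]
    [TopologicalSpace.SeparableSpace E] {v : ι → E} (hv : Orthonormal ℝ v) : Countable ι := by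
  have hdisj : Pairwise (Function.onFun Disjoint fun i => Metric.ball (v i) (1 / 2)) := by
    intro i j hij
    refine Metric.ball_disjoint_ball ?_
    rw [dist_eq_norm]
    have h : ‖v i - v j‖ ^ 2 = 2 := by
      rw [norm_sub_sq_real, hv.1 i, hv.1 j, hv.2 hij]; norm_num
    nlinarith [norm_nonneg (v i - v j)]
  exact hdisj.countable_of_isOpen_disjoint (fun _ => Metric.isOpen_ball)
    fun i => ⟨v i, Metric.mem_ball_self (by norm_num)⟩

variable {E : Type*} [NormedAddCommGroup E] [InnerProductSpace ℝ E] [CompleteSpace E]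
variable {F : Type*} [NormedAddCommGroup F] [InnerProductSpace ℝ F] [CompleteSpace F]

instance countable_onbSet [TopologicalSpace.SeparableSpace E] : Countable (onbSet E) :=
  countable_of_orthonormal (onb E).orthonormal

theorem enorm_sq_eq_tsum {ι : Type*} (b : HilbertBasis ι ℝ E) (x : E) :
    ‖x‖ₑ ^ 2 = ∑' i, ‖⟪b i, x⟫‖ₑ ^ 2 := by
  have h := b.hasSum_inner_mul_inner x x
  have h' : HasSum (fun i => ‖⟪b i, x⟫‖ ^ 2) (‖x‖ ^ 2) := by
    rw [real_inner_self_eq_norm_sq] at h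
    refine h.congr_fun fun i => ?_
    rw [real_inner_comm, Real.norm_eq_abs, sq_abs, sq]
  have h2 := ENNReal.ofReal_tsum_of_nonneg (fun i => by positivity) h'.summable
  rw [h'.tsum_eq] at h2
  simpa only [ENNReal.ofReal_pow (norm_nonneg _), ofReal_norm] using h2

/-- Both sides are the same double sum of squared matrix entries; thus the Hilbert-Schmidt norm
depends neither on the basis nor on passing to the adjoint. -/
theorem tsum_enorm_sq_adjoint {ι ι' : Type*} (b : HilbertBasis ι ℝ E) (b' : HilbertBasis ι' ℝ F)
    (S : E →L[ℝ] F) : ∑' j, ‖S.adjoint (b' j)‖ₑ ^ 2 = ∑' i, ‖S (b i)‖ₑ ^ 2 := by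
  simp only [enorm_sq_eq_tsum b, enorm_sq_eq_tsum b']
  rw [ENNReal.tsum_comm]
  refine tsum_congr fun i => tsum_congr fun j => ?_
  rw [ContinuousLinearMap.adjoint_inner_right, real_inner_comm]

theorem enorm_apply_sq_le_hsNormSq (S : E →L[ℝ] F) (x : E) :
    ‖S x‖ₑ ^ 2 ≤ hsNormSq S * ‖x‖ₑ ^ 2 := by
  obtain ⟨w, b', -⟩ := exists_hilbertBasis ℝ F
  rw [enorm_sq_eq_tsum b', hsNormSq, ← tsum_enorm_sq_adjoint (onb E) b', ← ENNReal.tsum_mul_right]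
  refine ENNReal.tsum_le_tsum fun j => ?_
  rw [← ContinuousLinearMap.adjoint_inner_left, ← mul_pow]
  gcongr
  rw [← ofReal_norm, ← ofReal_norm, ← ofReal_norm, ← ENNReal.ofReal_mul (norm_nonneg _)]
  exact ENNReal.ofReal_le_ofReal (norm_inner_le_norm _ _)

theorem hsNormSq_comp_le {G : Type*} [NormedAddCommGroup G] [InnerProductSpace ℝ G]
    (W : F →L[ℝ] G) (S : E →L[ℝ] F) : hsNormSq (W ∘L S) ≤ ‖W‖ₑ ^ 2 * hsNormSq S := by
  rw [hsNormSq, hsNormSq, ← ENNReal.tsum_mul_left]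
  refine ENNReal.tsum_le_tsum fun i => ?_
  rw [← mul_pow]
  gcongr
  exact W.le_opENorm _

/-- Weak measurability implies strong measurability in a separable Hilbert space. -/
theorem stronglyMeasurable_of_inner {Z ι : Type*} [MeasurableSpace Z] [Countable ι]
    (b : HilbertBasis ι ℝ E) {f : Z → E} (hf : ∀ i, Measurable fun z => ⟪b i, f z⟫) :
    StronglyMeasurable f := by
  refine stronglyMeasurable_of_tendsto (f := fun s z => ∑ i ∈ s, ⟪b i, f z⟫ • b i)
    (atTop : Filter (Finset ι)) (fun s => ?_) ?_
  · exact Finset.stronglyMeasurable_fun_sum _ fun i _ =>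
      (hf i).stronglyMeasurable.smul stronglyMeasurable_const
  · rw [tendsto_pi_nhds]
    intro z
    have := b.hasSum_repr (f z)
    simpa only [HasSum, SummationFilter.unconditional_filter, b.repr_apply_apply] using this

theorem stronglyMeasurable_lp {Z ι : Type*} [MeasurableSpace Z] [Countable ι]
    {f : Z → lp (fun _ : ι => E) 2} (hf : ∀ i, StronglyMeasurable fun z => f z i) :
    StronglyMeasurable f := by
  classical
  refine stronglyMeasurable_of_tendsto (f := fun s z => ∑ i ∈ s, lp.single 2 i (f z i))
    (atTop : Filter (Finset ι)) (fun s => ?_) ?_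
  · refine Finset.stronglyMeasurable_fun_sum _ fun i _ => ?_
    have hc : Continuous fun x : E => lp.single (E := fun _ : ι => E) 2 i x :=
      (lp.isometry_single (E := fun _ : ι => E) (p := 2) i).continuous
    exact hc.comp_stronglyMeasurable (hf i)
  · rw [tendsto_pi_nhds]
    intro z
    have := lp.hasSum_single (p := 2) (by simp) (f z)
    simpa only [HasSum, SummationFilter.unconditional_filter] using this

end Bases

/-! ### The function `exp x - x - 1`. -/

section ExpBounds

theorem exp_sub_sub_one_mono {x y : ℝ} (hx : 0 ≤ x) (hxy : x ≤ y) :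
    Real.exp x - x - 1 ≤ Real.exp y - y - 1 := by
  have h1 := Real.add_one_le_exp (y - x)
  have h2 : Real.exp y = Real.exp x * Real.exp (y - x) := by rw [← Real.exp_add]; ring_nf
  have h3 := Real.one_le_exp hx
  nlinarith

/-- The power series starts at degree two, where `θ^n ≤ θ²`. Keeping the square is what lets the
effective dimension appear as a variance later. -/
theorem exp_mul_sub_sub_one_le {θ w : ℝ} (hθ : 0 ≤ θ) (hθ1 : θ ≤ 1) (hw : 0 ≤ w) :
    Real.exp (θ * w) - θ * w - 1 ≤ θ ^ 2 * (Real.exp w - w - 1) := by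
  have h : ∀ x : ℝ, HasSum (fun n : ℕ => x ^ (n + 2) / (n + 2).factorial) (Real.exp x - x - 1) := by
    intro x
    have := (hasSum_nat_add_iff' 2).mpr (NormedSpace.expSeries_div_hasSum_exp x)
    rw [← Real.exp_eq_exp_ℝ] at this
    have h2 : Real.exp x - ∑ i ∈ Finset.range 2, x ^ i / (i.factorial : ℝ) = Real.exp x - x - 1 := by
      rw [Finset.sum_range_succ, Finset.sum_range_one]
      norm_num
      ring
    rwa [h2] at this
  refine hasSum_le (fun n => ?_) (h (θ * w)) ((h w).mul_left (θ ^ 2))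
  rw [mul_pow, ← mul_div_assoc]
  exact div_le_div_of_nonneg_right (mul_le_mul_of_nonneg_right
    (pow_le_pow_of_le_one hθ hθ1 (Nat.le_add_left 2 n)) (by positivity)) (by positivity)

end ExpBounds

/-! ### Tail bound for bounded random vectors. -/

section BoundedConcentration

variable {G : Type*} [NormedAddCommGroup G] [InnerProductSpace ℝ G] [CompleteSpace G]
  {Z : Type*} [MeasurableSpace Z]

/-- Tail bound for centred sums of bounded independent random vectors in a Hilbert space. -/
theorem measure_norm_sum_sub_mean_ge_le {μ : Measure Z} [IsProbabilityMeasure μ] {ζ : Z → G}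
    (hm : StronglyMeasurable ζ) {b V t : ℝ} (hb : ∀ z, ‖ζ z‖ ≤ b) (hV0 : 0 ≤ V)
    (hV : ∫⁻ z, ‖ζ z‖ₑ ^ 2 ∂μ ≤ ENNReal.ofReal V) (ht : 0 ≤ t) (htb : 2 * t * b ≤ 1) (m : ℕ)
    (a : ℝ) :
    (Measure.pi fun _ : Fin m => μ) {z | a ≤ ‖∑ i, t • (ζ (z i) - ∫ z, ζ z ∂μ)‖} ≤
      ENNReal.ofReal (2 * Real.exp (m * (t ^ 2 * V) - a)) := by
  set c := ∫ z, ζ z ∂μ with hc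
  have hζ : Integrable ζ μ := Integrable.of_bound hm.aestronglyMeasurable b (Eventually.of_forall hb)
  have hcb : ‖c‖ ≤ b := by
    simpa using norm_integral_le_of_norm_le_const (μ := μ) (Eventually.of_forall hb)
  have hsq : Integrable (fun z => ‖ζ z‖ ^ 2) μ :=
    Integrable.of_bound (hm.norm.pow 2).aestronglyMeasurable (b ^ 2) (Eventually.of_forall fun z => by
      rw [norm_pow, norm_norm]; gcongr; exact hb z)
  have hin : Integrable (fun z => ⟪c, ζ z⟫) μ := hζ.const_inner c
  have hVr : ∫ z, ‖ζ z‖ ^ 2 ∂μ ≤ V := by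
    rw [integral_eq_lintegral_of_nonneg_ae (Eventually.of_forall fun z => by positivity) hsq.1]
    refine ENNReal.toReal_le_of_le_ofReal hV0 ?_
    simpa only [ENNReal.ofReal_pow (norm_nonneg _), ofReal_norm] using hV
  -- Centring lowers the second moment by `‖c‖²`.
  have hvar : ∫ z, ‖ζ z - c‖ ^ 2 ∂μ ≤ V := by
    have h1 : ∀ z, ‖ζ z - c‖ ^ 2 = ‖ζ z‖ ^ 2 - 2 * ⟪c, ζ z⟫ + ‖c‖ ^ 2 := fun z => by
      rw [norm_sub_sq_real, real_inner_comm]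
    have h2 : Integrable (fun z => ‖ζ z‖ ^ 2 - 2 * ⟪c, ζ z⟫) μ := hsq.sub (hin.const_mul 2)
    simp only [h1]
    rw [integral_add h2 (integrable_const _), integral_sub hsq (hin.const_mul 2), integral_const_mul, integral_inner hζ, ← hc]
    simp only [real_inner_self_eq_norm_sq, integral_const, probReal_univ, smul_eq_mul, one_mul]
    linarith [sq_nonneg ‖c‖]
  have hsub : Integrable (fun z => ζ z - c) μ := hζ.sub (integrable_const c)
  refine measure_norm_sum_ge_le (ξ := fun z => t • (ζ z - c))
    ((hm.sub stronglyMeasurable_const).const_smul t) (hsub.smul t) ?_ (v := t ^ 2 * V) (by positivity)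
    ?_ m a
  · rw [integral_smul, integral_sub hζ (integrable_const c)]
    simp [hc]
  · have hn : ∀ z, ‖t • (ζ z - c)‖ ≤ 1 := fun z => by
      rw [norm_smul, Real.norm_of_nonneg ht]
      have : ‖ζ z - c‖ ≤ 2 * b := (norm_sub_le _ _).trans (by linarith [hb z])
      nlinarith
    have hsq' : Integrable (fun z => t ^ 2 * ‖ζ z - c‖ ^ 2) μ := by
      refine Integrable.const_mul ?_ _
      refine Integrable.of_bound ((hm.sub stronglyMeasurable_const).norm.pow 2).aestronglyMeasurable
        ((2 * b) ^ 2) (Eventually.of_forall fun z => ?_)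
      rw [norm_pow, norm_norm]
      gcongr
      exact (norm_sub_le _ _).trans (by linarith [hb z])
    -- By `htb` the scaled vectors have norm at most one, where `exp x - x - 1 ≤ x²`.
    calc _ ≤ ∫⁻ z, ENNReal.ofReal (t ^ 2 * ‖ζ z - c‖ ^ 2) ∂μ := by
          refine lintegral_mono fun z => ENNReal.ofReal_le_ofReal ?_
          have h1 := Real.abs_exp_sub_one_sub_id_le (x := ‖t • (ζ z - c)‖) (by
            rw [abs_norm]; exact hn z)
          have h2 := (le_abs_self _).trans h1
          have h3 : ‖t • (ζ z - c)‖ ^ 2 = t ^ 2 * ‖ζ z - c‖ ^ 2 := by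
            rw [norm_smul, Real.norm_of_nonneg ht, mul_pow]
          linarith
      _ = ENNReal.ofReal (∫ z, t ^ 2 * ‖ζ z - c‖ ^ 2 ∂μ) :=
          (ofReal_integral_eq_lintegral_ofReal hsq' (Eventually.of_forall fun z => by positivity)).symm
      _ ≤ _ := by
          rw [integral_const_mul]
          gcongr

end BoundedConcentration

/-! ### Square roots of the shifted operator and of its inverse. -/

section Resolvent

variable {H : Type*} [NormedAddCommGroup H] [InnerProductSpace ℝ H] [CompleteSpace H]

/-- The operator `(T + lam)^{-1/2}`. -/
noncomputable def invSqrt (T : H →L[ℝ] H) (lam : ℝ) : H →L[ℝ] H :=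
  funcCalc T fun t => (√(t + lam))⁻¹

/-- The operator `(T + lam)^{1/2}`. -/
noncomputable def shiftSqrt (T : H →L[ℝ] H) (lam : ℝ) : H →L[ℝ] H := funcCalc T fun t => √(t + lam)

variable {T : H →L[ℝ] H} {lam : ℝ}

theorem continuousOn_invSqrt (hlam : 0 < lam) :
    ContinuousOn (fun t => (√(t + lam))⁻¹) (Icc 0 ‖T‖) := by
  refine ContinuousOn.inv₀ (by fun_prop) fun t ht => ?_
  exact (Real.sqrt_pos.mpr (by linarith [ht.1])).ne'

theorem invSqrt_shiftSqrt (hT : T.IsPositive) (hlam : 0 < lam) (g : H) :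
    invSqrt T lam (shiftSqrt T lam g) = g := by
  rw [← mul_apply_eq_comp, invSqrt, shiftSqrt, ← funcCalc_mul hT (continuousOn_invSqrt hlam)
    (by fun_prop), funcCalc_congr (ψ := fun _ => 1) fun t ht => ?_, funcCalc_const hT, one_smul]
  · rfl
  · exact inv_mul_cancel₀ (Real.sqrt_pos.mpr (by linarith [ht.1])).ne'

theorem inner_invSqrt_left (hT : T.IsPositive) (hlam : 0 < lam) (x y : H) :
    ⟪invSqrt T lam x, y⟫ = ⟪x, invSqrt T lam y⟫ :=
  inner_funcCalc_left hT (continuousOn_invSqrt hlam) x y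

theorem adjoint_invSqrt (hT : T.IsPositive) (hlam : 0 < lam) :
    (invSqrt T lam).adjoint = invSqrt T lam :=
  (ContinuousLinearMap.eq_adjoint_iff _ _ |>.mpr (inner_invSqrt_left hT hlam)).symm

theorem funcCalc_shift (hT : T.IsPositive) : funcCalc T (fun t => t + lam) = T + lam • 1 := by
  rw [funcCalc_add hT (φ := fun t => t) (by fun_prop) continuousOn_const, funcCalc_const hT,
    funcCalc_id hT]

/-- For `T = covOp H' ν` this is the energy in which all sampling errors are measured. -/
theorem norm_sq_shiftSqrt (hT : T.IsPositive) (hlam : 0 < lam) (g : H) :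
    ‖shiftSqrt T lam g‖ ^ 2 = ⟪T g, g⟫ + lam * ‖g‖ ^ 2 := by
  rw [shiftSqrt, norm_sq_funcCalc hT (by fun_prop), funcCalc_congr (ψ := fun t => t + lam)
    fun t ht => Real.mul_self_sqrt (by linarith [ht.1]), funcCalc_shift hT]
  simp only [add_apply, smul_apply, inner_add_left, inner_smul_left, conj_trivial,
    one_apply_eq_self, real_inner_self_eq_norm_sq]

theorem norm_sq_invSqrt_le (hT : T.IsPositive) (hlam : 0 < lam) : ‖invSqrt T lam‖ ^ 2 ≤ 1 / lam := by
  have : ‖invSqrt T lam‖ ≤ (√lam)⁻¹ := by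
    refine norm_funcCalc_le hT (continuousOn_invSqrt hlam) fun t ht => ?_
    rw [abs_of_nonneg (by positivity)]
    gcongr
    linarith [ht.1]
  calc ‖invSqrt T lam‖ ^ 2 ≤ ((√lam)⁻¹) ^ 2 := by gcongr
    _ = 1 / lam := by rw [inv_pow, Real.sq_sqrt hlam.le, one_div]

/-- The symmetric form turns the trace in `effDim` into a sum of squares; the factors commute
because all are functions of `T`. -/
theorem inverse_shift_mul (hT : T.IsPositive) (hlam : 0 < lam) :
    Ring.inverse (T + lam • 1) * T = invSqrt T lam * T * invSqrt T lam := by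
  have hcW := continuousOn_invSqrt (T := T) hlam
  have hWW : invSqrt T lam * invSqrt T lam = funcCalc T fun t => (t + lam)⁻¹ := by
    rw [invSqrt, ← funcCalc_mul hT hcW hcW]
    exact funcCalc_congr fun t ht => by
      rw [← mul_inv, Real.mul_self_sqrt (by linarith [ht.1])]
  have hci : ContinuousOn (fun t => (t + lam)⁻¹) (Icc 0 ‖T‖) :=
    ContinuousOn.inv₀ (by fun_prop) fun t ht => by linarith [ht.1]
  have hid : funcCalc T (fun t => t) = T := funcCalc_id hT
  have hc0 : ContinuousOn (fun t : ℝ => t) (Icc 0 ‖T‖) := continuousOn_id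
  have hcs : ContinuousOn (fun t : ℝ => t + lam) (Icc 0 ‖T‖) := by fun_prop
  have hcomm : T * invSqrt T lam = invSqrt T lam * T := by
    have e1 := funcCalc_mul hT hc0 hcW
    have e2 := funcCalc_mul hT hcW hc0
    rw [hid] at e1 e2
    rw [invSqrt, ← e1, ← e2]
    exact funcCalc_congr fun t _ => mul_comm _ _
  have h1 : (T + lam • 1) * (invSqrt T lam * invSqrt T lam) = 1 := by
    rw [hWW, ← funcCalc_shift hT, ← funcCalc_mul hT hcs hci,
      funcCalc_congr (ψ := fun _ => 1) fun t ht => ?_, funcCalc_const hT, one_smul]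
    exact mul_inv_cancel₀ (by linarith [ht.1])
  have h2 : (invSqrt T lam * invSqrt T lam) * (T + lam • 1) = 1 := by
    rw [hWW, ← funcCalc_shift hT, ← funcCalc_mul hT hci hcs,
      funcCalc_congr (ψ := fun _ => 1) fun t ht => ?_, funcCalc_const hT, one_smul]
    exact inv_mul_cancel₀ (by linarith [ht.1])
  rw [show T + lam • 1 = ((⟨_, _, h1, h2⟩ : (H →L[ℝ] H)ˣ) : H →L[ℝ] H) from rfl, Ring.inverse_unit]
  change invSqrt T lam * invSqrt T lam * T = _
  rw [mul_assoc, mul_assoc, hcomm]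

end Resolvent

/-! ### Kernel operators and the effective dimension. -/

section Kernel

variable {X : Type*} [MeasurableSpace X]
variable {Y : Type*} [NormedAddCommGroup Y] [InnerProductSpace ℝ Y] [CompleteSpace Y]
  [SecondCountableTopology Y] [MeasurableSpace Y] [BorelSpace Y]
variable {H' : Type*} [NormedAddCommGroup H'] [InnerProductSpace ℝ H'] [CompleteSpace H']
  [RKHS ℝ H' X Y]
variable {κ : ℝ} {ν : Measure X} [IsProbabilityMeasure ν]

theorem injection_apply (hK : KernelAssumption (X := X) (Y := Y) H' κ) (g : H') :
    (injection H' ν g : X → Y) =ᵐ[ν] fun x => g x := by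
  have h := hK.exists_injection ν
  have : injection H' ν = h.choose := dif_pos h
  rw [this]
  exact h.choose_spec g

theorem isPositive_covOp : (covOp H' ν : H' →L[ℝ] H').IsPositive :=
  ContinuousLinearMap.isPositive_adjoint_comp_self _

theorem inner_covOp_self (g : H') : ⟪covOp H' ν g, g⟫ = ‖injection H' ν g‖ ^ 2 := by
  rw [covOp, ContinuousLinearMap.comp_apply, ContinuousLinearMap.adjoint_inner_left,
    real_inner_self_eq_norm_sq]

theorem norm_sq_injection (hK : KernelAssumption (X := X) (Y := Y) H' κ) (g : H') :
    ‖injection H' ν g‖ ^ 2 = ∫ x, ‖g x‖ ^ 2 ∂ν := by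
  rw [← real_inner_self_eq_norm_sq, L2.inner_def]
  refine integral_congr_ae ?_
  filter_upwards [injection_apply hK g] with x hx
  rw [hx, real_inner_self_eq_norm_sq]

theorem norm_kerFun_le (hK : KernelAssumption (X := X) (Y := Y) H' κ) (hκ : 0 ≤ κ) (x : X) (y : Y) :
    ‖RKHS.kerFun H' x y‖ ≤ κ * ‖y‖ := by
  have h := (enorm_apply_sq_le_hsNormSq (RKHS.kerFun H' x) y).trans
    (mul_le_mul_left (hK.hilbertSchmidt x) _)
  rw [← ofReal_norm, ← ofReal_norm, ← ENNReal.ofReal_pow (norm_nonneg _),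
    ← ENNReal.ofReal_pow (norm_nonneg _), ← ENNReal.ofReal_mul (sq_nonneg _),
    ENNReal.ofReal_le_ofReal_iff (by positivity), ← mul_pow] at h
  exact le_of_sq_le_sq h (by positivity)

theorem norm_apply_le_mul_norm (hK : KernelAssumption (X := X) (Y := Y) H' κ) (hκ : 0 ≤ κ) (x : X)
    (g : H') : ‖g x‖ ≤ κ * ‖g‖ := by
  have h1 : ‖g x‖ ^ 2 ≤ ‖g x‖ * (κ * ‖g‖) := by
    rw [← real_inner_self_eq_norm_sq, ← RKHS.kerFun_inner (𝕜 := ℝ)]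
    refine (real_inner_le_norm _ _).trans ?_
    have := mul_le_mul_of_nonneg_right (norm_kerFun_le hK hκ x (g x)) (norm_nonneg g)
    linarith
  have h0 := norm_nonneg (g x)
  have h2 : 0 ≤ κ * ‖g‖ := by positivity
  by_contra hlt
  push Not at hlt
  nlinarith

theorem integrable_norm_sq_apply (hK : KernelAssumption (X := X) (Y := Y) H' κ) (hκ : 0 ≤ κ)
    (g : H') : Integrable (fun x => ‖g x‖ ^ 2) ν := by
  refine Integrable.of_bound ((hK.measurable_coe g).norm.pow_const 2).aestronglyMeasurable
    ((κ * ‖g‖) ^ 2) (Eventually.of_forall fun x => ?_)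
  rw [norm_pow, norm_norm]
  gcongr
  exact norm_apply_le_mul_norm hK hκ x g

/-- The squared Hilbert-Schmidt norm of `W K_x` for symmetric `W`. -/
theorem hsNormSq_comp_kerFun {W : H' →L[ℝ] H'} (hW : W.adjoint = W) (x : X) :
    hsNormSq (W ∘L RKHS.kerFun H' x) = ∑' i, ‖(W (onb H' i)) x‖ₑ ^ 2 := by
  rw [hsNormSq, ← tsum_enorm_sq_adjoint (onb Y) (onb H')]
  refine tsum_congr fun i => ?_
  rw [ContinuousLinearMap.adjoint_comp, hW, ContinuousLinearMap.comp_apply, RKHS.adjoint_kerFun]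

theorem hsNormSq_kerFun (x : X) :
    hsNormSq (RKHS.kerFun H' x) = ∑' i, ‖(onb H' i) x‖ₑ ^ 2 := by
  have := hsNormSq_comp_kerFun (H' := H') (W := ContinuousLinearMap.id ℝ H')
    ContinuousLinearMap.adjoint_id x
  simpa using this

variable [TopologicalSpace.SeparableSpace H']

theorem measurable_hsNormSq (hK : KernelAssumption (X := X) (Y := Y) H' κ)
    {W : H' →L[ℝ] H'} (hW : W.adjoint = W) :
    Measurable fun x => hsNormSq (W ∘L RKHS.kerFun H' x) := by
  simp only [hsNormSq_comp_kerFun hW]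
  exact Measurable.tsum fun i => (hK.measurable_coe _).enorm.pow_const 2

theorem lintegral_hsNormSq (hK : KernelAssumption (X := X) (Y := Y) H' κ) (hκ : 0 ≤ κ)
    {W : H' →L[ℝ] H'} (hW : W.adjoint = W) :
    ∫⁻ x, hsNormSq (W ∘L RKHS.kerFun H' x) ∂ν = ∑' i, ‖injection H' ν (W (onb H' i))‖ₑ ^ 2 := by
  simp only [hsNormSq_comp_kerFun hW]
  rw [lintegral_tsum fun i => ((hK.measurable_coe _).enorm.pow_const 2).aemeasurable]
  refine tsum_congr fun i => ?_
  rw [← ofReal_norm, ← ENNReal.ofReal_pow (norm_nonneg _), norm_sq_injection hK,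
    ofReal_integral_eq_lintegral_ofReal (integrable_norm_sq_apply hK hκ _)
      (Eventually.of_forall fun x => by positivity)]
  simp only [ENNReal.ofReal_pow (norm_nonneg _), ofReal_norm]

theorem hsNormSq_invSqrt_le (hK : KernelAssumption (X := X) (Y := Y) H' κ) {lam : ℝ} (hlam : 0 < lam)
    (x : X) :
    hsNormSq (invSqrt (covOp H' ν) lam ∘L RKHS.kerFun H' x) ≤ ENNReal.ofReal (κ ^ 2 / lam) := by
  refine (hsNormSq_comp_le _ _).trans ?_
  calc _ ≤ ENNReal.ofReal (1 / lam) * ENNReal.ofReal (κ ^ 2) := by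
        gcongr
        · rw [← ofReal_norm, ← ENNReal.ofReal_pow (norm_nonneg _)]
          exact ENNReal.ofReal_le_ofReal (norm_sq_invSqrt_le isPositive_covOp hlam)
        · exact hK.hilbertSchmidt x
    _ = _ := by
        rw [← ENNReal.ofReal_mul (by positivity)]
        ring_nf

theorem effDim_eq_tsum {lam : ℝ} (hlam : 0 < lam) :
    effDim H' ν lam = ∑' i, ‖injection H' ν (invSqrt (covOp H' ν) lam (onb H' i))‖ ^ 2 := by
  rw [effDim, trace]
  refine tsum_congr fun i => ?_
  rw [inverse_shift_mul isPositive_covOp hlam, mul_apply_eq_comp, mul_apply_eq_comp,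
    ← inner_invSqrt_left isPositive_covOp hlam, real_inner_comm, inner_covOp_self]

/-- Identifies the effective dimension as the mean squared Hilbert-Schmidt norm of the
preconditioned kernel, hence as the variance scale of both random sums. -/
theorem lintegral_hsNormSq_invSqrt (hK : KernelAssumption (X := X) (Y := Y) H' κ) (hκ : 0 ≤ κ)
    {lam : ℝ} (hlam : 0 < lam) :
    ∫⁻ x, hsNormSq (invSqrt (covOp H' ν) lam ∘L RKHS.kerFun H' x) ∂ν =
      ENNReal.ofReal (effDim H' ν lam) := by
  have hW := adjoint_invSqrt (isPositive_covOp (H' := H') (ν := ν)) hlam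
  have h1 := lintegral_hsNormSq (ν := ν) hK hκ hW
  -- Finiteness is needed first: `effDim` is a real `tsum`, which would be zero for a divergent
  -- series.
  have h2 : ∫⁻ x, hsNormSq (invSqrt (covOp H' ν) lam ∘L RKHS.kerFun H' x) ∂ν ≠ ⊤ := by
    refine ne_top_of_le_ne_top (ENNReal.ofReal_ne_top (r := κ ^ 2 / lam)) ?_
    calc _ ≤ ∫⁻ _, ENNReal.ofReal (κ ^ 2 / lam) ∂ν :=
          lintegral_mono fun x => hsNormSq_invSqrt_le hK hlam x
      _ = _ := by simp
  rw [h1] at h2 ⊢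
  rw [effDim_eq_tsum hlam, ENNReal.ofReal_tsum_of_nonneg (fun _ => by positivity)]
  · simp only [ENNReal.ofReal_pow (norm_nonneg _), ofReal_norm]
  · have h3 := ENNReal.summable_toReal h2
    simpa using h3

theorem effDim_nonneg {lam : ℝ} (hlam : 0 < lam) : 0 ≤ effDim H' ν lam := by
  rw [effDim_eq_tsum hlam]
  exact tsum_nonneg fun _ => by positivity

/-- The crude bound, for parameters outside the range of the logarithmic decay. -/
theorem effDim_le (hK : KernelAssumption (X := X) (Y := Y) H' κ) (hκ : 0 ≤ κ) {lam : ℝ}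
    (hlam : 0 < lam) : effDim H' ν lam ≤ κ ^ 2 / lam := by
  rw [← ENNReal.ofReal_le_ofReal_iff (by positivity), ← lintegral_hsNormSq_invSqrt hK hκ hlam]
  calc _ ≤ ∫⁻ _, ENNReal.ofReal (κ ^ 2 / lam) ∂ν :=
        lintegral_mono fun x => hsNormSq_invSqrt_le hK hlam x
    _ = _ := by simp

end Kernel

/-! ### Uniform control of the empirical noise and the empirical norm. -/

section Sampling

variable {X : Type*} [MeasurableSpace X]
variable {Y : Type*} [NormedAddCommGroup Y] [InnerProductSpace ℝ Y] [CompleteSpace Y]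
  [SecondCountableTopology Y] [MeasurableSpace Y] [BorelSpace Y]
variable {H' : Type*} [NormedAddCommGroup H'] [InnerProductSpace ℝ H'] [CompleteSpace H']
  [RKHS ℝ H' X Y] [TopologicalSpace.SeparableSpace H']
variable {κ M σ lam t : ℝ}

/-- The preconditioned noise `t W K_x (y - g₀(x))` at a sample point. -/
noncomputable def noiseVec (W : H' →L[ℝ] H') (g₀ : H') (t : ℝ) (z : X × Y) : H' :=
  t • W (RKHS.kerFun H' z.1 (z.2 - g₀ z.1))

theorem measurable_noise (hK : KernelAssumption (X := X) (Y := Y) H' κ) (g₀ : H') :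
    Measurable fun z : X × Y => z.2 - g₀ z.1 :=
  measurable_snd.sub ((hK.measurable_coe g₀).comp measurable_fst)

theorem stronglyMeasurable_comp_kerFun (hK : KernelAssumption (X := X) (Y := Y) H' κ)
    {W : H' →L[ℝ] H'} (hW : W.adjoint = W) {Z : Type*} [MeasurableSpace Z] {x : Z → X} {y : Z → Y}
    (hx : Measurable x) (hy : Measurable y) :
    StronglyMeasurable fun z => W (RKHS.kerFun H' (x z) (y z)) := by
  refine stronglyMeasurable_of_inner (onb H') fun i => ?_
  have : ∀ z, ⟪onb H' i, W (RKHS.kerFun H' (x z) (y z))⟫ = ⟪(W (onb H' i)) (x z), y z⟫ := fun z => by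
    rw [← ContinuousLinearMap.adjoint_inner_left, hW, RKHS.inner_kerFun]
  simp only [this]
  exact ((hK.measurable_coe _).comp hx).inner hy

variable {ρ : Measure (X × Y)} [IsProbabilityMeasure ρ] {g₀ : H'}

theorem integrable_noise (hK : KernelAssumption (X := X) (Y := Y) H' κ) (hκ : 0 ≤ κ)
    (h2 : Integrable (fun z : X × Y => ‖z.2‖ ^ 2) ρ) :
    Integrable (fun z : X × Y => z.2 - g₀ z.1) ρ := by
  have h1 : Integrable (fun z : X × Y => z.2) ρ := by
    have : MemLp (fun z : X × Y => z.2) 2 ρ :=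
      (memLp_two_iff_integrable_sq_norm measurable_snd.aestronglyMeasurable).mpr h2
    exact this.integrable (by norm_num)
  refine h1.sub (Integrable.of_bound
    ((hK.measurable_coe g₀).comp measurable_fst).aestronglyMeasurable (κ * ‖g₀‖)
    (Eventually.of_forall fun z => norm_apply_le_mul_norm hK hκ _ _))

theorem integrable_noiseVec (hK : KernelAssumption (X := X) (Y := Y) H' κ) (hκ : 0 ≤ κ)
    (h2 : Integrable (fun z : X × Y => ‖z.2‖ ^ 2) ρ) {W : H' →L[ℝ] H'} (hW : W.adjoint = W) :
    Integrable (noiseVec W g₀ t) ρ := by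
  have hm := stronglyMeasurable_comp_kerFun hK hW measurable_fst (measurable_noise hK g₀)
  refine Integrable.smul t ?_
  refine ((integrable_noise (g₀ := g₀) hK hκ h2).norm.const_mul (‖W‖ * κ)).mono'
    hm.aestronglyMeasurable (Eventually.of_forall fun z => ?_)
  refine (W.le_opNorm _).trans ?_
  rw [mul_assoc]
  gcongr
  exact norm_kerFun_le hK hκ _ _

/-- Given `x`, the vector is a fixed continuous linear map applied to the noise, whose conditional
mean is zero. -/
theorem integral_noiseVec (hK : KernelAssumption (X := X) (Y := Y) H' κ) (hκ : 0 ≤ κ)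
    (h2 : Integrable (fun z : X × Y => ‖z.2‖ ^ 2) ρ)
    (hc : ∀ᵐ x ∂ρ.fst, ∫ y, y ∂(ρ.condKernel x) = g₀ x) {W : H' →L[ℝ] H'} (hW : W.adjoint = W) :
    ∫ z, noiseVec W g₀ t z ∂ρ = 0 := by
  rw [← Measure.integral_condKernel (integrable_noiseVec hK hκ h2 hW)]
  refine integral_eq_zero_of_ae ?_
  filter_upwards [hc, (integrable_noise (g₀ := g₀) hK hκ h2).condKernel_ae] with x hx hi
  have h1 : ∀ y, noiseVec W g₀ t (x, y) = (t • (W ∘L RKHS.kerFun H' x)) (y - g₀ x) := fun y => rfl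
  simp only [h1]
  have hy : Integrable (fun y => y) (ρ.condKernel x) := by
    have := hi.add (integrable_const (g₀ x))
    refine this.congr (Eventually.of_forall fun y => ?_)
    simp
  rw [ContinuousLinearMap.integral_comp_comm _ hi, integral_sub hy (integrable_const _), hx]
  simp

theorem lintegral_mul_condKernel_le {h : X → ℝ≥0∞} {F : X × Y → ℝ≥0∞} (hh : Measurable h)
    (hF : Measurable F) {K : ℝ≥0∞} (hK : ∀ᵐ x ∂ρ.fst, ∫⁻ y, F (x, y) ∂(ρ.condKernel x) ≤ K) :
    ∫⁻ z, h z.1 * F z ∂ρ ≤ (∫⁻ x, h x ∂ρ.fst) * K := by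
  have hm : Measurable fun z : X × Y => h z.1 * F z := (hh.comp measurable_fst).mul hF
  rw [← Measure.lintegral_condKernel hm, ← lintegral_mul_const _ hh]
  refine lintegral_mono_ae ?_
  filter_upwards [hK] with x hx
  have hx' : Measurable fun y => F (x, y) := hF.comp measurable_prodMk_left
  rw [lintegral_const_mul _ hx']
  gcongr

/-- Let `k` be the squared Hilbert-Schmidt norm of `W K_x`. The vector has norm at most `t √k M`
times `‖ε‖ / M`, and `htM` makes this factor at most one. `exp_mul_sub_sub_one_le` extracts its
square, after which the noise condition handles the integral in `y` and the effective dimension the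
integral of `k`. -/
theorem lintegral_noiseVec_le (hK : KernelAssumption (X := X) (Y := Y) H' κ) (hκ : 0 ≤ κ)
    (hM : 0 < M)
    (hn : ∀ᵐ x ∂ρ.fst, ∫⁻ y, ENNReal.ofReal (Real.exp (‖y - g₀ x‖ / M) - ‖y - g₀ x‖ / M - 1)
      ∂(ρ.condKernel x) ≤ ENNReal.ofReal (σ ^ 2 / (2 * M ^ 2)))
    (hlam : 0 < lam) (ht : 0 ≤ t) (htM : t * (κ * M) ≤ √lam) :
    ∫⁻ z, ENNReal.ofReal (Real.exp ‖noiseVec (invSqrt (covOp H' ρ.fst) lam) g₀ t z‖ -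
      ‖noiseVec (invSqrt (covOp H' ρ.fst) lam) g₀ t z‖ - 1) ∂ρ ≤
      ENNReal.ofReal (t ^ 2 * (σ ^ 2 / 2) * effDim H' ρ.fst lam) := by
  set W := invSqrt (covOp H' ρ.fst) lam with hWdef
  have hW : W.adjoint = W := adjoint_invSqrt isPositive_covOp hlam
  set h : X → ℝ≥0∞ := fun x => hsNormSq (W ∘L RKHS.kerFun H' x) with hh
  have hhm : Measurable h := measurable_hsNormSq hK hW
  have hhb : ∀ x, h x ≤ ENNReal.ofReal (κ ^ 2 / lam) := hsNormSq_invSqrt_le hK hlam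
  have hpt : ∀ z : X × Y, ENNReal.ofReal (Real.exp ‖noiseVec W g₀ t z‖ - ‖noiseVec W g₀ t z‖ - 1) ≤
      ENNReal.ofReal (t ^ 2 * M ^ 2) * h z.1 *
        ENNReal.ofReal (Real.exp (‖z.2 - g₀ z.1‖ / M) - ‖z.2 - g₀ z.1‖ / M - 1) := by
    intro z
    have hne : h z.1 ≠ ⊤ := ne_top_of_le_ne_top ENNReal.ofReal_ne_top (hhb z.1)
    set k := (h z.1).toReal with hk
    have hk0 : 0 ≤ k := ENNReal.toReal_nonneg
    have hkh : h z.1 = ENNReal.ofReal k := (ENNReal.ofReal_toReal hne).symm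
    have hkb : k ≤ κ ^ 2 / lam := ENNReal.toReal_le_of_le_ofReal (by positivity) (hhb z.1)
    set e := z.2 - g₀ z.1
    have h1 : ‖W (RKHS.kerFun H' z.1 e)‖ ≤ √k * ‖e‖ := by
      have h2 := enorm_apply_sq_le_hsNormSq (W ∘L RKHS.kerFun H' z.1) e
      change _ ≤ h z.1 * _ at h2
      rw [hkh, ← ofReal_norm, ← ofReal_norm, ← ENNReal.ofReal_pow (norm_nonneg _),
        ← ENNReal.ofReal_pow (norm_nonneg _), ← ENNReal.ofReal_mul hk0,
        ENNReal.ofReal_le_ofReal_iff (by positivity)] at h2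
      refine le_of_sq_le_sq ?_ (by positivity)
      rw [mul_pow, Real.sq_sqrt hk0]
      exact h2
    have h3 : ‖noiseVec W g₀ t z‖ ≤ (t * √k * M) * (‖e‖ / M) := by
      rw [noiseVec, norm_smul, Real.norm_of_nonneg ht]
      calc _ ≤ t * (√k * ‖e‖) := by gcongr
        _ = _ := by field_simp
    have h4 : t * √k * M ≤ 1 := by
      have h5 : √k ≤ κ / √lam := by
        rw [← Real.sqrt_sq hκ, ← Real.sqrt_div' _ hlam.le]
        exact Real.sqrt_le_sqrt hkb
      calc t * √k * M ≤ t * (κ / √lam) * M := by gcongr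
        _ = t * (κ * M) / √lam := by ring
        _ ≤ 1 := (div_le_one (Real.sqrt_pos.mpr hlam)).mpr htM
    rw [hkh, ← ENNReal.ofReal_mul (by positivity), ← ENNReal.ofReal_mul (by positivity)]
    refine ENNReal.ofReal_le_ofReal ((exp_sub_sub_one_mono (norm_nonneg _) h3).trans
      ((exp_mul_sub_sub_one_le (by positivity) h4 (by positivity)).trans (le_of_eq ?_)))
    rw [mul_pow, mul_pow, Real.sq_sqrt hk0]
    ring
  have hm2 : Measurable fun z : X × Y =>
      ENNReal.ofReal (Real.exp (‖z.2 - g₀ z.1‖ / M) - ‖z.2 - g₀ z.1‖ / M - 1) := by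
    have := (measurable_noise hK g₀).norm.div_const M
    exact (((Real.measurable_exp.comp this).sub this).sub_const 1).ennreal_ofReal
  calc _ ≤ _ := lintegral_mono hpt
    _ ≤ (∫⁻ x, ENNReal.ofReal (t ^ 2 * M ^ 2) * h x ∂ρ.fst) * ENNReal.ofReal (σ ^ 2 / (2 * M ^ 2)) :=
        lintegral_mul_condKernel_le (hhm.const_mul _) hm2 hn
    _ = ENNReal.ofReal (t ^ 2 * M ^ 2) * ENNReal.ofReal (effDim H' ρ.fst lam) *
          ENNReal.ofReal (σ ^ 2 / (2 * M ^ 2)) := by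
        rw [lintegral_const_mul _ hhm, lintegral_hsNormSq_invSqrt hK hκ hlam]
    _ = _ := by
        rw [← ENNReal.ofReal_mul (by positivity), ← ENNReal.ofReal_mul
          (mul_nonneg (by positivity) (effDim_nonneg hlam))]
        congr 1
        field_simp

theorem memℓp_covVec (hK : KernelAssumption (X := X) (Y := Y) H' κ) (W : H' →L[ℝ] H') (x : X) :
    Memℓp (fun i => W (RKHS.kerFun H' x ((onb H' i) x))) 2 ∧
      ∑' i, ‖W (RKHS.kerFun H' x ((onb H' i) x))‖ₑ ^ 2 ≤
        hsNormSq (W ∘L RKHS.kerFun H' x) * ENNReal.ofReal (κ ^ 2) := by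
  have h1 : ∑' i, ‖W (RKHS.kerFun H' x ((onb H' i) x))‖ₑ ^ 2 ≤
        hsNormSq (W ∘L RKHS.kerFun H' x) * ENNReal.ofReal (κ ^ 2) := by
    calc _ ≤ ∑' i, hsNormSq (W ∘L RKHS.kerFun H' x) * ‖(onb H' i) x‖ₑ ^ 2 :=
          ENNReal.tsum_le_tsum fun i =>
            enorm_apply_sq_le_hsNormSq (W ∘L RKHS.kerFun H' x) ((onb H' i) x)
      _ ≤ _ := by
          rw [ENNReal.tsum_mul_left, ← hsNormSq_kerFun]
          gcongr
          exact hK.hilbertSchmidt x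
  refine ⟨?_, h1⟩
  have h2 : hsNormSq (W ∘L RKHS.kerFun H' x) * ENNReal.ofReal (κ ^ 2) ≠ ⊤ :=
    ENNReal.mul_ne_top (ne_top_of_le_ne_top
      (ENNReal.mul_ne_top (by simp) ENNReal.ofReal_ne_top)
      ((hsNormSq_comp_le W _).trans (mul_le_mul_right (hK.hilbertSchmidt x) _)))
      ENNReal.ofReal_ne_top
  have h3 := ENNReal.summable_toReal (ne_top_of_le_ne_top h2 h1)
  refine memℓp_gen ?_
  simpa using h3

/-- The operator `W K_x K_x*` as a vector in the space of Hilbert-Schmidt operators. -/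
noncomputable def covVec (hK : KernelAssumption (X := X) (Y := Y) H' κ) (W : H' →L[ℝ] H') (x : X) :
    lp (fun _ : onbSet H' => H') 2 :=
  ⟨_, (memℓp_covVec hK W x).1⟩

theorem enorm_sq_lp {ι : Type*} (f : lp (fun _ : ι => H') 2) : ‖f‖ₑ ^ 2 = ∑' i, ‖f i‖ₑ ^ 2 := by
  have h := lp.hasSum_norm (p := 2) (by norm_num) f
  have h' : HasSum (fun i => ‖f i‖ ^ 2) (‖f‖ ^ 2) := by simpa using h
  have h2 := ENNReal.ofReal_tsum_of_nonneg (fun i => by positivity) h'.summable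
  rw [h'.tsum_eq] at h2
  simpa only [ENNReal.ofReal_pow (norm_nonneg _), ofReal_norm] using h2

theorem stronglyMeasurable_covVec (hK : KernelAssumption (X := X) (Y := Y) H' κ)
    {W : H' →L[ℝ] H'} (hW : W.adjoint = W) : StronglyMeasurable (covVec hK W) :=
  stronglyMeasurable_lp fun i =>
    stronglyMeasurable_comp_kerFun hK hW measurable_id (hK.measurable_coe (onb H' i))

theorem enorm_sq_covVec_le (hK : KernelAssumption (X := X) (Y := Y) H' κ) (W : H' →L[ℝ] H')
    (x : X) : ‖covVec hK W x‖ₑ ^ 2 ≤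
      hsNormSq (W ∘L RKHS.kerFun H' x) * ENNReal.ofReal (κ ^ 2) := by
  rw [enorm_sq_lp]
  exact (memℓp_covVec hK W x).2

/-- The rank one operator `⟪g, ·⟫ g'` as a vector in the space of Hilbert-Schmidt operators. -/
theorem exists_rankOne (g g' : H') : ∃ r : lp (fun _ : onbSet H' => H') 2,
    (∀ i, r i = ⟪onb H' i, g⟫ • g') ∧ ‖r‖ = ‖g‖ * ‖g'‖ := by
  have hsum : ∑' i, ‖⟪onb H' i, g⟫ • g'‖ₑ ^ 2 = ‖g‖ₑ ^ 2 * ‖g'‖ₑ ^ 2 := by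
    rw [enorm_sq_eq_tsum (onb H') g, ← ENNReal.tsum_mul_right]
    exact tsum_congr fun i => by rw [enorm_smul, mul_pow]
  have hmem : Memℓp (fun i => ⟪onb H' i, g⟫ • g') 2 := by
    have h3 := ENNReal.summable_toReal (f := fun i => ‖⟪onb H' i, g⟫ • g'‖ₑ ^ 2) (by
      rw [hsum]; exact ENNReal.mul_ne_top (by simp) (by simp))
    refine memℓp_gen ?_
    simpa using h3
  refine ⟨⟨_, hmem⟩, fun i => rfl, ?_⟩
  have h := enorm_sq_lp (⟨_, hmem⟩ : lp (fun _ : onbSet H' => H') 2)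
  have h1 : ‖(⟨_, hmem⟩ : lp (fun _ : onbSet H' => H') 2)‖ₑ ^ 2 = (‖g‖ₑ * ‖g'‖ₑ) ^ 2 := by
    rw [h, mul_pow, ← hsum]
  rw [← ofReal_norm, ← ofReal_norm, ← ofReal_norm, ← ENNReal.ofReal_mul (norm_nonneg _),
    ← ENNReal.ofReal_pow (norm_nonneg _), ← ENNReal.ofReal_pow (by positivity),
    ENNReal.ofReal_eq_ofReal_iff (by positivity) (by positivity)] at h1
  exact (sq_eq_sq₀ (by positivity) (by positivity)).mp h1

/-- By Parseval the Hilbert-Schmidt pairing is the trace `⟪W g', K_x K_x* g⟫`. A quadratic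
expression in `g` thus becomes linear in the random operator. -/
theorem inner_covVec_rankOne (hK : KernelAssumption (X := X) (Y := Y) H' κ)
    {W : H' →L[ℝ] H'} (hW : W.adjoint = W) {g g' : H'} (hg : W g' = g)
    {r : lp (fun _ : onbSet H' => H') 2} (hr : ∀ i, r i = ⟪onb H' i, g⟫ • g') (x : X) :
    ⟪r, covVec hK W x⟫ = ‖g x‖ ^ 2 := by
  rw [lp.inner_eq_tsum]
  have h : ∀ i, ⟪r i, covVec hK W x i⟫ = ⟪g, onb H' i⟫ * ⟪onb H' i, RKHS.kerFun H' x (g x)⟫ := by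
    intro i
    change ⟪r i, W (RKHS.kerFun H' x ((onb H' i) x))⟫ = _
    rw [hr, inner_smul_left, ← ContinuousLinearMap.adjoint_inner_left, hW, hg, RKHS.inner_kerFun,
      RKHS.inner_kerFun, real_inner_comm g, real_inner_comm (g x)]
    rfl
  simp only [h]
  rw [(onb H').tsum_inner_mul_inner, RKHS.inner_kerFun, real_inner_self_eq_norm_sq]

/-- With high probability the empirical noise and the empirical `L²` norm are controlled uniformly
on the reproducing kernel Hilbert space. -/
theorem measure_sampling_le (hK : KernelAssumption (X := X) (Y := Y) H' κ) (hκ : 0 ≤ κ)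
    (hM : 0 < M) (h2 : Integrable (fun z : X × Y => ‖z.2‖ ^ 2) ρ)
    (hc : ∀ᵐ x ∂ρ.fst, ∫ y, y ∂(ρ.condKernel x) = g₀ x)
    (hn : ∀ᵐ x ∂ρ.fst, ∫⁻ y, ENNReal.ofReal (Real.exp (‖y - g₀ x‖ / M) - ‖y - g₀ x‖ / M - 1)
      ∂(ρ.condKernel x) ≤ ENNReal.ofReal (σ ^ 2 / (2 * M ^ 2)))
    (hlam : 0 < lam) (ht : 0 < t) (htM : t * (κ * M) ≤ √lam) (htκ : t * (2 * κ ^ 2) ≤ √lam)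
    {m : ℕ} {c₀ Λ : ℝ} (hc1 : m * t ^ 2 * effDim H' ρ.fst lam * (σ ^ 2 / 2) ≤ c₀)
    (hc2 : m * t ^ 2 * effDim H' ρ.fst lam * κ ^ 2 ≤ c₀) :
    (Measure.pi fun _ : Fin m => ρ) {z | ¬ ∀ g : H',
      |∑ i, ⟪g (z i).1, (z i).2 - g₀ (z i).1⟫| ≤
        (Λ + c₀) / t * √(‖injection H' ρ.fst g‖ ^ 2 + lam * ‖g‖ ^ 2) ∧
      |∑ i, (‖g (z i).1‖ ^ 2 - ‖injection H' ρ.fst g‖ ^ 2)| ≤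
        (Λ + c₀) / t * (‖g‖ * √(‖injection H' ρ.fst g‖ ^ 2 + lam * ‖g‖ ^ 2))} ≤
      ENNReal.ofReal (4 * Real.exp (-Λ)) := by
  have hTpos : (covOp H' ρ.fst : H' →L[ℝ] H').IsPositive := isPositive_covOp
  set W := invSqrt (covOp H' ρ.fst) lam with hWdef
  have hW : W.adjoint = W := adjoint_invSqrt isPositive_covOp hlam
  have hN0 := effDim_nonneg (H' := H') (ν := ρ.fst) hlam
  set N := effDim H' ρ.fst lam
  have hm1 : StronglyMeasurable (noiseVec W g₀ t) :=
    (stronglyMeasurable_comp_kerFun hK hW measurable_fst (measurable_noise hK g₀)).const_smul t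
  have hP1 := measure_norm_sum_ge_le hm1 (integrable_noiseVec hK hκ h2 hW)
    (integral_noiseVec hK hκ h2 hc hW) (v := t ^ 2 * (σ ^ 2 / 2) * N) (by positivity)
    (lintegral_noiseVec_le hK hκ hM hn hlam ht.le htM) m (Λ + c₀)
  have hm2 : StronglyMeasurable fun z : X × Y => covVec hK W z.1 :=
    (stronglyMeasurable_covVec hK hW).comp_measurable measurable_fst
  have hb : ∀ x, ‖covVec hK W x‖ ≤ κ ^ 2 / √lam := by
    intro x
    have h := (enorm_sq_covVec_le hK W x).trans
      (mul_le_mul_left (hsNormSq_invSqrt_le hK hlam x) _)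
    rw [← ofReal_norm, ← ENNReal.ofReal_pow (norm_nonneg _), ← ENNReal.ofReal_mul (by positivity),
      ENNReal.ofReal_le_ofReal_iff (by positivity)] at h
    refine le_of_sq_le_sq (h.trans (le_of_eq ?_)) (by positivity)
    rw [div_pow, Real.sq_sqrt hlam.le]
    ring
  have hV : ∫⁻ z : X × Y, ‖covVec hK W z.1‖ₑ ^ 2 ∂ρ ≤ ENNReal.ofReal (N * κ ^ 2) := by
    have hmm : Measurable fun x => hsNormSq (W ∘L RKHS.kerFun H' x) * ENNReal.ofReal (κ ^ 2) :=
      (measurable_hsNormSq hK hW).mul_const _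
    calc _ ≤ ∫⁻ z : X × Y, hsNormSq (W ∘L RKHS.kerFun H' z.1) * ENNReal.ofReal (κ ^ 2) ∂ρ :=
          lintegral_mono fun z => enorm_sq_covVec_le hK W z.1
      _ = ∫⁻ x, hsNormSq (W ∘L RKHS.kerFun H' x) * ENNReal.ofReal (κ ^ 2) ∂ρ.fst :=
          (lintegral_map hmm measurable_fst).symm
      _ = _ := by
          rw [lintegral_mul_const _ (measurable_hsNormSq hK hW),
            lintegral_hsNormSq_invSqrt hK hκ hlam, ← ENNReal.ofReal_mul hN0]
  have hP2 := measure_norm_sum_sub_mean_ge_le hm2 (fun z => hb z.1) (by positivity) hV ht.le (by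
    rw [← mul_div_assoc, div_le_one (Real.sqrt_pos.mpr hlam)]
    linarith) m (Λ + c₀)
  set mean := ∫ z : X × Y, covVec hK W z.1 ∂ρ with hmean
  have hint : Integrable (fun z : X × Y => covVec hK W z.1) ρ :=
    Integrable.of_bound hm2.aestronglyMeasurable _ (Eventually.of_forall fun z => hb z.1)
  set S1 := {z : Fin m → X × Y | Λ + c₀ ≤ ‖∑ i, noiseVec W g₀ t (z i)‖}
  set S2 := {z : Fin m → X × Y | Λ + c₀ ≤ ‖∑ i, t • (covVec hK W (z i).1 - mean)‖}
  refine (measure_mono (t := S1 ∪ S2) ?_).trans ((measure_union_le _ _).trans ?_)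
  · intro z hz
    by_contra hnot
    rw [mem_union, not_or] at hnot
    have hz1 : ‖∑ i, noiseVec W g₀ t (z i)‖ < Λ + c₀ := not_le.mp hnot.1
    have hz2 : ‖∑ i, t • (covVec hK W (z i).1 - mean)‖ < Λ + c₀ := not_le.mp hnot.2
    refine hz fun g => ?_
    -- Duality yields uniformity in `g`: both expressions become pairings of a random sum,
    -- independent of `g`, with a vector built from `g` and `g'`, and `‖g'‖` is the energy norm of
    -- `g`.
    set g' := shiftSqrt (covOp H' ρ.fst) lam g with hg'
    have hWg : W g' = g := invSqrt_shiftSqrt hTpos hlam g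
    have hng : ‖g'‖ = √(‖injection H' ρ.fst g‖ ^ 2 + lam * ‖g‖ ^ 2) := by
      rw [← inner_covOp_self, ← norm_sq_shiftSqrt hTpos hlam, Real.sqrt_sq (norm_nonneg _)]
    rw [← hng]
    constructor
    · have h3 : ⟪g', ∑ i, noiseVec W g₀ t (z i)⟫ = t * ∑ i, ⟪g (z i).1, (z i).2 - g₀ (z i).1⟫ := by
        rw [inner_sum, Finset.mul_sum]
        refine Finset.sum_congr rfl fun i _ => ?_
        rw [noiseVec, inner_smul_right, ← ContinuousLinearMap.adjoint_inner_left, hW, hWg,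
          RKHS.inner_kerFun]
      have h4 := abs_real_inner_le_norm g' (∑ i, noiseVec W g₀ t (z i))
      rw [h3, abs_mul, abs_of_pos ht] at h4
      have h5 : ‖g'‖ * ‖∑ i, noiseVec W g₀ t (z i)‖ ≤ ‖g'‖ * (Λ + c₀) := by gcongr
      rw [div_mul_eq_mul_div, le_div_iff₀ ht]
      linarith
    · obtain ⟨r, hr, hrn⟩ := exists_rankOne g g'
      have hrm : ⟪r, mean⟫ = ‖injection H' ρ.fst g‖ ^ 2 := by
        rw [hmean, ← integral_inner hint, norm_sq_injection hK, Measure.fst,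
          integral_map measurable_fst.aemeasurable
            ((hK.measurable_coe g).norm.pow_const 2).aestronglyMeasurable]
        exact integral_congr_ae (Eventually.of_forall fun z => inner_covVec_rankOne hK hW hWg hr z.1)
      have h3 : ⟪r, ∑ i, t • (covVec hK W (z i).1 - mean)⟫ =
          t * ∑ i, (‖g (z i).1‖ ^ 2 - ‖injection H' ρ.fst g‖ ^ 2) := by
        rw [inner_sum, Finset.mul_sum]
        refine Finset.sum_congr rfl fun i _ => ?_
        rw [inner_smul_right, inner_sub_right, hrm, inner_covVec_rankOne hK hW hWg hr]
      have h4 := abs_real_inner_le_norm r (∑ i, t • (covVec hK W (z i).1 - mean))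
      rw [h3, abs_mul, abs_of_pos ht, hrn] at h4
      have h5 : ‖g‖ * ‖g'‖ * ‖∑ i, t • (covVec hK W (z i).1 - mean)‖ ≤ ‖g‖ * ‖g'‖ * (Λ + c₀) := by
        gcongr
      rw [div_mul_eq_mul_div, le_div_iff₀ ht]
      linarith
  -- Since `c₀` dominates `m` times each variance, each of the two tails is at most `2 exp(-Λ)`.
  · have h3 : ∀ v : ℝ, v ≤ c₀ → 2 * Real.exp (v - (Λ + c₀)) ≤ 2 * Real.exp (-Λ) := fun v hv => by
      have := Real.exp_le_exp.mpr (by linarith : v - (Λ + c₀) ≤ -Λ)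
      linarith
    calc _ ≤ ENNReal.ofReal (2 * Real.exp (-Λ)) + ENNReal.ofReal (2 * Real.exp (-Λ)) := by
          refine add_le_add (hP1.trans (ENNReal.ofReal_le_ofReal (h3 _ ?_)))
            (hP2.trans (ENNReal.ofReal_le_ofReal (h3 _ ?_)))
          · linarith
          · linarith
      _ = _ := by
          rw [← ENNReal.ofReal_add (by positivity) (by positivity)]
          ring_nf

end Sampling

/-! ### The bounded inverse of the scale generator. -/

section Generator

variable {H : Type*} [NormedAddCommGroup H] [InnerProductSpace ℝ H] [CompleteSpace H]
variable {L : H →ₗ.[ℝ] H} {ℓ : ℝ}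

theorem IsScaleGenerator.inv_spec (hL : IsScaleGenerator L ℓ) (hℓ : 0 < ℓ) :
    IsBoundedInverse L (inv L) := by
  have h := hL.exists_inverse hℓ
  have : inv L = h.choose := dif_pos h
  rw [this]
  exact h.choose_spec

theorem IsScaleGenerator.exists_apply_inv (hL : IsScaleGenerator L ℓ) (hℓ : 0 < ℓ) (x : H) :
    ∃ hy : inv L x ∈ L.domain, L ⟨inv L x, hy⟩ = x := (hL.inv_spec hℓ x _).mp rfl

theorem IsScaleGenerator.inv_apply (hL : IsScaleGenerator L ℓ) (hℓ : 0 < ℓ) (f : L.domain) :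
    inv L (L f) = f := (hL.inv_spec hℓ _ _).mpr ⟨f.2, rfl⟩

theorem IsScaleGenerator.inv_injective (hL : IsScaleGenerator L ℓ) (hℓ : 0 < ℓ) :
    Function.Injective (inv L) := by
  intro x y hxy
  obtain ⟨hx, hx'⟩ := hL.exists_apply_inv hℓ x
  obtain ⟨hy, hy'⟩ := hL.exists_apply_inv hℓ y
  rw [← hx', ← hy']
  congr 1
  exact Subtype.ext hxy

theorem IsScaleGenerator.norm_inv_le (hL : IsScaleGenerator L ℓ) (hℓ : 0 < ℓ) : ‖inv L‖ ≤ ℓ⁻¹ := by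
  refine ContinuousLinearMap.opNorm_le_bound _ (by positivity) fun x => ?_
  obtain ⟨hx, hx'⟩ := hL.exists_apply_inv hℓ x
  have h := hL.bound ⟨inv L x, hx⟩
  rw [hx'] at h
  rw [inv_mul_eq_div, le_div_iff₀' hℓ]
  exact h

theorem IsScaleGenerator.isPositive_inv (hL : IsScaleGenerator L ℓ) (hℓ : 0 < ℓ) :
    (inv L).IsPositive := by
  have hadj := LinearPMap.adjoint_isFormalAdjoint hL.dense
  rw [LinearPMap.isSelfAdjoint_def.mp hL.selfAdjoint] at hadj
  rw [ContinuousLinearMap.isPositive_def]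
  refine ⟨fun x y => ?_, fun x => ?_⟩
  · obtain ⟨hx, hx'⟩ := hL.exists_apply_inv hℓ x
    obtain ⟨hy, hy'⟩ := hL.exists_apply_inv hℓ y
    have := hadj ⟨inv L x, hx⟩ ⟨inv L y, hy⟩
    rw [hx', hy'] at this
    exact this.symm
  · obtain ⟨hx, hx'⟩ := hL.exists_apply_inv hℓ x
    rw [ContinuousLinearMap.reApplyInnerSelf_apply]
    obtain h0 | h0 := eq_or_ne (⟨inv L x, hx⟩ : L.domain) 0
    · have : inv L x = 0 := congrArg Subtype.val h0
      simp [this]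
    · have := hL.pos _ h0
      rw [hx'] at this
      rw [real_inner_comm] at this
      exact this.le

end Generator

/-! ### Best approximation under a norm constraint. -/

section Benchmark

variable {H : Type*} [NormedAddCommGroup H] [InnerProductSpace ℝ H] [CompleteSpace H]
variable {B : H →L[ℝ] H}

/-- Weighted AM-GM with weights `a/b` and `1 - a/b` gives `t^a μ^(1 - a/b) ≤ t^b + μ`. -/
theorem rpow_mul_inv_add_le {b a μ t : ℝ} (hb : 0 < b) (ha : 0 ≤ a) (hab : a ≤ b) (hμ : 0 < μ)
    (ht : 0 ≤ t) : |t ^ a * (t ^ b + μ)⁻¹| ≤ μ ^ (a / b - 1) := by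
  have hx : 0 ≤ t ^ b := Real.rpow_nonneg ht _
  rw [abs_of_nonneg (by positivity), ← div_eq_mul_inv, div_le_iff₀ (by positivity)]
  have hθ1 : a / b ≤ 1 := (div_le_one hb).mpr hab
  have h1 := Real.geom_mean_le_arith_mean2_weighted (div_nonneg ha hb.le) (sub_nonneg.mpr hθ1) hx
    hμ.le (by ring)
  have h2 : (t ^ b) ^ (a / b) = t ^ a := by
    rw [← Real.rpow_mul ht, mul_div_cancel₀ _ hb.ne']
  have h3 : t ^ a * μ ^ (1 - a / b) ≤ t ^ b + μ := by
    rw [h2] at h1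
    have h4 := mul_le_mul_of_nonneg_right hθ1 hx
    have h5 : 0 ≤ a / b * μ := by positivity
    linarith
  calc t ^ a = μ ^ (a / b - 1) * (t ^ a * μ ^ (1 - a / b)) := by
        rw [mul_left_comm, ← Real.rpow_add hμ]
        simp
    _ ≤ _ := by gcongr

/-- Powers of `B` applied to the solution of `(B^b + μ) d = μ B^r v`. -/
theorem norm_rpow_regularized_le (hB : B.IsPositive) {b r a μ : ℝ} (hb : 0 < b) (hr : 0 ≤ r)
    (ha : 0 ≤ a) (hab : r + a ≤ b) (hμ : 0 < μ) {d v : H}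
    (hd : funcCalc B (fun t => t ^ b) d + μ • d = μ • funcCalc B (fun t => t ^ r) v) :
    ‖funcCalc B (fun t => t ^ a) d‖ ≤ μ ^ ((r + a) / b) * ‖v‖ := by
  have hcb : ContinuousOn (fun t : ℝ => t ^ b) (Icc 0 ‖B‖) := continuousOn_rpow_Icc hb.le
  have hcr : ContinuousOn (fun t : ℝ => t ^ r) (Icc 0 ‖B‖) := continuousOn_rpow_Icc hr
  have hca : ContinuousOn (fun t : ℝ => t ^ a) (Icc 0 ‖B‖) := continuousOn_rpow_Icc ha
  have hcra : ContinuousOn (fun t : ℝ => t ^ (r + a)) (Icc 0 ‖B‖) :=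
    continuousOn_rpow_Icc (by positivity)
  have hpos : ∀ t ∈ Icc 0 ‖B‖, 0 < t ^ b + μ := fun t ht => by
    have := Real.rpow_nonneg ht.1 b
    linarith
  have hcs : ContinuousOn (fun t : ℝ => t ^ b + μ) (Icc 0 ‖B‖) := hcb.add continuousOn_const
  have hci : ContinuousOn (fun t : ℝ => (t ^ b + μ)⁻¹) (Icc 0 ‖B‖) :=
    hcs.inv₀ fun t ht => (hpos t ht).ne'
  have hcai : ContinuousOn (fun t : ℝ => t ^ a * (t ^ b + μ)⁻¹) (Icc 0 ‖B‖) := hca.mul hci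
  have hcrai : ContinuousOn (fun t : ℝ => t ^ (r + a) * (t ^ b + μ)⁻¹) (Icc 0 ‖B‖) := hcra.mul hci
  -- Factoring out `t^b + μ` expresses `B^a d` as `μ B^(r+a) (B^b + μ)⁻¹ v`; its symbol is bounded
  -- by a power of `μ` as long as `r + a ≤ b`.
  have h1 : funcCalc B (fun t => t ^ a) =
      funcCalc B (fun t => t ^ a * (t ^ b + μ)⁻¹) * funcCalc B (fun t => t ^ b + μ) := by
    rw [← funcCalc_mul hB hcai hcs]
    exact funcCalc_congr fun t ht => by
      have := (hpos t ht).ne'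
      field_simp
  have h2 : funcCalc B (fun t => t ^ b + μ) d = μ • funcCalc B (fun t => t ^ r) v := by
    rw [funcCalc_add hB hcb continuousOn_const, funcCalc_const hB, ← hd]
    rfl
  have h3 : funcCalc B (fun t => t ^ a * (t ^ b + μ)⁻¹) * funcCalc B (fun t => t ^ r) =
      funcCalc B (fun t => t ^ (r + a) * (t ^ b + μ)⁻¹) := by
    rw [← funcCalc_mul hB hcai hcr]
    refine funcCalc_congr fun t ht => ?_
    simp only [Real.rpow_add_of_nonneg ht.1 hr ha]
    ring
  rw [h1, mul_apply_eq_comp, h2, map_smul, ← mul_apply_eq_comp, h3, norm_smul,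
    Real.norm_of_nonneg hμ.le]
  have h4 := (funcCalc B (fun t => t ^ (r + a) * (t ^ b + μ)⁻¹)).le_of_opNorm_le
    (norm_funcCalc_le hB hcrai fun t ht => rpow_mul_inv_add_le hb (by positivity) hab hμ ht.1) v
  calc _ ≤ μ * (μ ^ ((r + a) / b - 1) * ‖v‖) := by gcongr
    _ = _ := by
        rw [← mul_assoc, Real.rpow_sub_one hμ.ne']
        field_simp

/-- A solution of the norm constrained least squares problem satisfies a regularized normal
equation. -/
theorem exists_multiplier (hB : B.IsPositive) (hinj : Function.Injective B) {q R : ℝ} (hq : 0 ≤ q)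
    (hR : 0 < R) {w y : H} (hw : ‖w‖ ≤ R)
    (hmin : ∀ w', ‖w'‖ ≤ R →
      ‖y - funcCalc B (fun t => t ^ q) w‖ ≤ ‖y - funcCalc B (fun t => t ^ q) w'‖)
    (hd : y - funcCalc B (fun t => t ^ q) w ≠ 0) :
    ∃ μ : ℝ, 0 < μ ∧ ‖w‖ = R ∧
      funcCalc B (fun t => t ^ q) (y - funcCalc B (fun t => t ^ q) w) = μ • w := by
  set P := funcCalc B (fun t => t ^ q) with hP
  set d := y - P w
  set z := P d with hz
  have hsym : ∀ a b, ⟪P a, b⟫ = ⟪a, P b⟫ := inner_funcCalc_left hB (continuousOn_rpow_Icc hq)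
  have hz0 : z ≠ 0 := fun h => hd (funcCalc_rpow_injective hB hinj hq h)
  have hzpos : 0 < ‖z‖ := norm_pos_iff.mpr hz0
  have hK : Convex ℝ (P '' Metric.closedBall 0 R) := by
    have := (convex_closedBall (0 : H) R).linear_image P.toLinearMap
    exact this
  have hwK : P w ∈ P '' Metric.closedBall 0 R := ⟨w, by simpa using hw, rfl⟩
  -- `P w` is the nearest point to `y` in the convex image of the ball, so the variational
  -- inequality of the projection applies.
  have hvar := (norm_eq_iInf_iff_real_inner_le_zero hK hwK (u := y)).mp (by
    have : Nonempty (P '' Metric.closedBall 0 R) := ⟨⟨_, hwK⟩⟩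
    refine le_antisymm (le_ciInf ?_) (ciInf_le (f := fun w : P '' Metric.closedBall 0 R => ‖y - w‖)
      ⟨0, ?_⟩ ⟨_, hwK⟩)
    · rintro ⟨_, w', hw', rfl⟩
      exact hmin w' (by simpa using hw')
    · rintro _ ⟨_, rfl⟩
      exact norm_nonneg _)
  have hw' : ‖(R / ‖z‖) • z‖ = R := by
    rw [norm_smul, Real.norm_of_nonneg (by positivity)]
    field_simp
  -- Testing with the point of the sphere in direction `z` gives `R ‖z‖ ≤ ⟪z, w⟫`. This is equality
  -- in Cauchy-Schwarz and forces `w` to be that point.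
  have h1 := hvar (P ((R / ‖z‖) • z)) ⟨_, by simpa using hw'.le, rfl⟩
  rw [← map_sub, ← hsym, inner_sub_right, inner_smul_right] at h1
  change R / ‖z‖ * ⟪z, z⟫ - ⟪z, w⟫ ≤ 0 at h1
  have h2 : R / ‖z‖ * ⟪z, z⟫ = R * ‖z‖ := by
    rw [real_inner_self_eq_norm_sq]
    field_simp
  rw [h2] at h1
  have h3 : ‖w - (R / ‖z‖) • z‖ ^ 2 ≤ 0 := by
    rw [norm_sub_sq_real, hw', inner_smul_right, real_inner_comm]
    have h4 : R / ‖z‖ * (R * ‖z‖) ≤ R / ‖z‖ * ⟪z, w⟫ := by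
      gcongr
      linarith
    have h5 : R / ‖z‖ * (R * ‖z‖) = R ^ 2 := by field_simp
    have h6 : ‖w‖ ^ 2 ≤ R ^ 2 := by gcongr
    linarith
  have h4 : w = (R / ‖z‖) • z :=
    sub_eq_zero.mp (norm_eq_zero.mp (pow_eq_zero_iff two_ne_zero |>.mp (le_antisymm h3 (sq_nonneg _))))
  refine ⟨‖z‖ / R, by positivity, by rw [h4, hw'], ?_⟩
  rw [h4, smul_smul, div_mul_div_cancel₀ hR.ne', div_self hzpos.ne', one_smul]

/-- Error bounds for the best approximation of `B^r v` by `B^q w` with `‖w‖ ≤ R`. -/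
theorem norm_distMin_le (hB : B.IsPositive) (hinj : Function.Injective B) {p q r R Rd τ : ℝ}
    (hp : 0 ≤ p) (hr : 0 ≤ r) (hrq : r < q) (hrp : r + p ≤ 2 * q) (hR : 0 < R) (hτ : 0 < τ)
    (hτR : Rd ≤ τ ^ (q - r) * R) {v w : H} (hv : ‖v‖ ≤ Rd) (hw : ‖w‖ ≤ R)
    (hmin : ∀ w', ‖w'‖ ≤ R →
      ‖funcCalc B (fun t => t ^ r) v - funcCalc B (fun t => t ^ q) w‖ ≤
        ‖funcCalc B (fun t => t ^ r) v - funcCalc B (fun t => t ^ q) w'‖) :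
    ‖funcCalc B (fun t => t ^ r) v - funcCalc B (fun t => t ^ q) w‖ ≤ τ ^ r * Rd ∧
    ‖funcCalc B (fun t => t ^ p) (funcCalc B (fun t => t ^ r) v - funcCalc B (fun t => t ^ q) w)‖ ≤
      τ ^ (r + p) * Rd := by
  have hRd : 0 ≤ Rd := (norm_nonneg v).trans hv
  have hq : 0 < q := hr.trans_lt hrq
  obtain hd | hd := eq_or_ne (funcCalc B (fun t => t ^ r) v - funcCalc B (fun t => t ^ q) w) 0
  · rw [hd, map_zero, norm_zero]
    constructor <;> positivity
  obtain ⟨μ, hμ, hwR, hmul⟩ := exists_multiplier hB hinj hq.le hR hw hmin hd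
  set d := funcCalc B (fun t => t ^ r) v - funcCalc B (fun t => t ^ q) w with hdd
  -- Another application of `B^q` to the multiplier relation eliminates `w` and leaves a regularized
  -- equation of order `2q` for the residual.
  have heq : funcCalc B (fun t => t ^ (2 * q)) d + μ • d = μ • funcCalc B (fun t => t ^ r) v := by
    rw [two_mul, funcCalc_rpow_add hB hq.le hq.le, mul_apply_eq_comp, hmul, map_smul, ← smul_add,
      hdd, add_sub_cancel]
  have hb : 0 < 2 * q := by positivity
  have hgen : ∀ a, 0 ≤ a → r + a ≤ 2 * q →
      ‖funcCalc B (fun t => t ^ a) d‖ ≤ μ ^ ((r + a) / (2 * q)) * Rd := fun a ha hab =>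
    (norm_rpow_regularized_le hB hb hr ha hab hμ heq).trans (by gcongr)
  set τ₀ := μ ^ (1 / (2 * q)) with hτ₀
  have hτ₀0 : 0 < τ₀ := Real.rpow_pos_of_pos hμ _
  have hpow : ∀ a, μ ^ (a / (2 * q)) = τ₀ ^ a := fun a => by
    rw [hτ₀, ← Real.rpow_mul hμ.le]
    ring_nf
  -- The constraint is active, so `‖B^q d‖ = μ R`. Together with the general bound at `a = q` this
  -- reads `τ₀^(q-r) R ≤ Rd`, which limits the multiplier.
  have hle : τ₀ ≤ τ := by
    have h1 := hgen q hq.le (by linarith)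
    rw [hmul, norm_smul, hwR, Real.norm_of_nonneg hμ.le, hpow] at h1
    have hμτ : μ = τ₀ ^ (2 * q) := by
      rw [← hpow, div_self hb.ne', Real.rpow_one]
    have h2 : τ₀ ^ (2 * q) = τ₀ ^ (r + q) * τ₀ ^ (q - r) := by
      rw [← Real.rpow_add hτ₀0]
      ring_nf
    rw [hμτ, h2, mul_assoc] at h1
    have h3 := le_of_mul_le_mul_left h1 (Real.rpow_pos_of_pos hτ₀0 _)
    have h4 := le_of_mul_le_mul_right (h3.trans hτR) hR
    exact (Real.rpow_le_rpow_iff hτ₀0.le hτ.le (by linarith)).mp h4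
  constructor
  · have h1 := hgen 0 le_rfl (by linarith)
    rw [funcCalc_rpow_zero hB, add_zero, hpow] at h1
    refine (le_of_eq_of_le rfl h1).trans ?_
    gcongr
  · have h1 := hgen p hp hrp
    rw [hpow] at h1
    refine h1.trans ?_
    gcongr

end Benchmark

/-! ### Exponents and the balancing argument. -/

section Rates

theorem rpow_mul_rpow_le {N y S lam e₁ e₂ θ : ℝ} (hN : 0 ≤ N) (hy : 0 ≤ y) (hS : 0 ≤ S)
    (hlam : 0 < lam) (hθ : 0 ≤ θ) (hθ1 : θ ≤ 1) (h1 : N ≤ S * lam ^ e₁) (h2 : y ≤ S * lam ^ e₂) :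
    N ^ θ * y ^ (1 - θ) ≤ S * lam ^ (θ * e₁ + (1 - θ) * e₂) := by
  have hp1 : 0 ≤ lam ^ e₁ := Real.rpow_nonneg hlam.le _
  have hp2 : 0 ≤ lam ^ e₂ := Real.rpow_nonneg hlam.le _
  calc N ^ θ * y ^ (1 - θ) ≤ (S * lam ^ e₁) ^ θ * (S * lam ^ e₂) ^ (1 - θ) := by
        have : 0 ≤ 1 - θ := by linarith
        gcongr
    _ = (S ^ θ * S ^ (1 - θ)) * (lam ^ (θ * e₁) * lam ^ ((1 - θ) * e₂)) := by
        rw [Real.mul_rpow hS hp1, Real.mul_rpow hS hp2, ← Real.rpow_mul hlam.le,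
          ← Real.rpow_mul hlam.le, mul_comm e₁, mul_comm e₂]
        ring
    _ = _ := by
        rw [← Real.rpow_add hlam, ← Real.rpow_add_of_nonneg hS hθ (by linarith)]
        simp

set_option maxHeartbeats 1000000 in
/-- Balancing of the terms in the basic inequality for Tikhonov minimizers. -/
theorem balance_bound {s r u E w θ₁ θ₂ c lam Λ x y N bk bq G dn xh hn Rw Δ : ℝ}
    (hs0 : 0 < s) (hs1 : s ≤ 1) (hθ₁ : 0 ≤ θ₁) (hθ₁1 : θ₁ ≤ 1) (hθ₂ : 0 ≤ θ₂) (hθ₂1 : θ₂ ≤ 1)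
    (hE : E = θ₁ * (u * s) + (1 - θ₁) * (u - 1 / 2))
    (hw : w = 2 * u - 1 - (θ₂ * (u * s) + (1 - θ₂) * (u - 1 / 2)))
    (hru : u ≤ r + 1 / 2) (hrE : 2 * u ≤ r + 1 + E) (hc : 1 ≤ c) (hlam : 0 < lam) (hlam1 : lam ≤ 1)
    (hΛ : 1 ≤ Λ) (hx : 0 ≤ x) (hy : 0 ≤ y) (hN0 : 0 ≤ N) (hxh0 : 0 ≤ xh)
    (hRw0 : 0 ≤ Rw) (hΔ0 : 0 ≤ Δ)
    (hN : N ≤ c * x ^ s + c * lam ^ (u * s))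
    (hbk : bk ≤ N ^ θ₁ * y ^ (1 - θ₁)) (hbq : bq ≤ N ^ θ₂ * y ^ (1 - θ₂))
    (hG : G ≤ c * (bk + dn)) (hdn : dn ≤ c * lam ^ E) (hxh : xh ≤ c * lam ^ u) (hhn : hn ≤ c * dn)
    (hRw : Rw ≤ c * lam ^ w) (hΔ : Δ ≤ c * Λ * lam ^ (r + 1 / 2))
    (hmain : x ^ 2 + lam * y ^ 2 ≤ xh ^ 2 + Δ * (x + √lam * G) + Δ * (xh + √lam * hn) +
      2 * lam * (bq * Rw)) :
    bk + dn ≤ 33 * c ^ 4 * Λ * lam ^ E := by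
  have hpos : ∀ a : ℝ, 0 < lam ^ a := fun a => Real.rpow_pos_of_pos hlam a
  have hc0 : 0 < c := by linarith
  have hΛ0 : 0 < Λ := by linarith
  -- `S` measures `x` and `y` in units of their expected sizes; including `Λ` ensures `S ≥ 1`.
  set S := max Λ (max (x / lam ^ u) (y / lam ^ (u - 1 / 2))) with hS
  have hSΛ : Λ ≤ S := le_max_left _ _
  have hS1 : 1 ≤ S := hΛ.trans hSΛ
  have hS0 : 0 < S := by linarith
  have hxS : x ≤ S * lam ^ u :=
    (div_le_iff₀ (hpos u)).mp ((le_max_left _ _).trans (le_max_right _ _))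
  have hyS : y ≤ S * lam ^ (u - 1 / 2) :=
    (div_le_iff₀ (hpos _)).mp ((le_max_right _ _).trans (le_max_right _ _))
  have hxs : x ^ s ≤ S * lam ^ (u * s) := by
    calc x ^ s ≤ (S * lam ^ u) ^ s := by gcongr
      _ = S ^ s * lam ^ (u * s) := by
          rw [Real.mul_rpow hS0.le (hpos u).le, ← Real.rpow_mul hlam.le]
      _ ≤ S * lam ^ (u * s) := by
          have := hpos (u * s)
          gcongr
          calc S ^ s ≤ S ^ (1 : ℝ) := Real.rpow_le_rpow_of_exponent_le hS1 hs1
            _ = S := Real.rpow_one S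
  have hNS : N ≤ 2 * c * S * lam ^ (u * s) := by
    have h1 := mul_le_mul_of_nonneg_left hxs hc0.le
    have h2 : c * lam ^ (u * s) ≤ c * (S * lam ^ (u * s)) := by
      have := hpos (u * s)
      gcongr
      exact le_mul_of_one_le_left this.le hS1
    linarith
  have hyS' : y ≤ 2 * c * S * lam ^ (u - 1 / 2) := by
    have := hpos (u - 1 / 2)
    refine hyS.trans ?_
    gcongr
    exact le_mul_of_one_le_left hS0.le (by linarith)
  have hbkS : bk ≤ 2 * c * S * lam ^ E := by
    rw [hE]
    exact hbk.trans (rpow_mul_rpow_le hN0 hy (by positivity) hlam hθ₁ hθ₁1 hNS hyS')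
  have hbqS : bq ≤ 2 * c * S * lam ^ (2 * u - 1 - w) := by
    rw [hw, sub_sub_cancel]
    exact hbq.trans (rpow_mul_rpow_le hN0 hy (by positivity) hlam hθ₂ hθ₂1 hNS hyS')
  have hsq : √lam = lam ^ (1 / 2 : ℝ) := Real.sqrt_eq_rpow lam
  have hle : ∀ {a b : ℝ}, b ≤ a → lam ^ a ≤ lam ^ b := fun h =>
    Real.rpow_le_rpow_of_exponent_ge hlam hlam1 h
  have hmul : ∀ a : ℝ, lam * lam ^ a = lam ^ (1 + a) := fun a => by
    rw [Real.rpow_add hlam, Real.rpow_one]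
  set P := lam ^ (2 * u) with hP
  have hP0 : 0 < P := hpos _
  have hr1 : lam ^ (r + 1 / 2) * lam ^ u ≤ P := by
    rw [← Real.rpow_add hlam]
    exact hle (by linarith)
  have hr2 : lam ^ (r + 1 / 2) * (√lam * lam ^ E) ≤ P := by
    rw [hsq, ← Real.rpow_add hlam, ← Real.rpow_add hlam]
    exact hle (by linarith)
  have t1 : xh ^ 2 ≤ c ^ 2 * P := by
    calc xh ^ 2 ≤ (c * lam ^ u) ^ 2 := by gcongr
      _ = _ := by
        rw [mul_pow, ← Real.rpow_natCast (lam ^ u), ← Real.rpow_mul hlam.le, hP]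
        ring_nf
  have hGS : G ≤ 3 * c ^ 2 * S * lam ^ E := by
    have h2 : c ^ 2 * lam ^ E ≤ c ^ 2 * lam ^ E * S :=
      le_mul_of_one_le_right (mul_nonneg (sq_nonneg c) (hpos E).le) hS1
    calc G ≤ c * (2 * c * S * lam ^ E + c * lam ^ E) :=
          hG.trans (mul_le_mul_of_nonneg_left (add_le_add hbkS hdn) hc0.le)
      _ = 2 * c ^ 2 * S * lam ^ E + c ^ 2 * lam ^ E := by ring
      _ ≤ 3 * c ^ 2 * S * lam ^ E := by linarith
  have t2 : Δ * (x + √lam * G) ≤ 4 * c ^ 3 * Λ * S * P := by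
    have h1 : x + √lam * G ≤ S * lam ^ u + √lam * (3 * c ^ 2 * S * lam ^ E) := by gcongr
    have h2 : 0 ≤ S * lam ^ u + √lam * (3 * c ^ 2 * S * lam ^ E) := by
      have := hpos u
      have := hpos E
      positivity
    have h3 : c ≤ c ^ 3 := by
      calc c = c ^ 1 := (pow_one c).symm
        _ ≤ c ^ 3 := pow_le_pow_right₀ hc (by norm_num)
    calc _ ≤ Δ * (S * lam ^ u + √lam * (3 * c ^ 2 * S * lam ^ E)) := by gcongr
      _ ≤ c * Λ * lam ^ (r + 1 / 2) * (S * lam ^ u + √lam * (3 * c ^ 2 * S * lam ^ E)) := by gcongr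
      _ = c * (Λ * S) * (lam ^ (r + 1 / 2) * lam ^ u) +
          3 * c ^ 3 * (Λ * S) * (lam ^ (r + 1 / 2) * (√lam * lam ^ E)) := by ring
      _ ≤ c ^ 3 * (Λ * S) * P + 3 * c ^ 3 * (Λ * S) * P := by
          have := hpos (r + 1 / 2)
          have := hpos u
          gcongr
      _ = _ := by ring
  have t3 : Δ * (xh + √lam * hn) ≤ 2 * c ^ 3 * Λ * P := by
    have h1 : xh + √lam * hn ≤ c * lam ^ u + √lam * (c * (c * lam ^ E)) := by
      have : hn ≤ c * (c * lam ^ E) := hhn.trans (by gcongr)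
      gcongr
    have h2 : 0 ≤ c * lam ^ u + √lam * (c * (c * lam ^ E)) := by
      have := hpos u
      have := hpos E
      positivity
    calc _ ≤ Δ * (c * lam ^ u + √lam * (c * (c * lam ^ E))) := by gcongr
      _ ≤ c * Λ * lam ^ (r + 1 / 2) * (c * lam ^ u + √lam * (c * (c * lam ^ E))) := by gcongr
      _ = c ^ 2 * Λ * (lam ^ (r + 1 / 2) * lam ^ u) +
          c ^ 3 * Λ * (lam ^ (r + 1 / 2) * (√lam * lam ^ E)) := by ring
      _ ≤ c ^ 3 * Λ * P + c ^ 3 * Λ * P := by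
          have := hpos (r + 1 / 2)
          have := hpos u
          gcongr
          norm_num
      _ = _ := by ring
  have t4 : 2 * lam * (bq * Rw) ≤ 4 * c ^ 2 * S * P := by
    have h1 : bq * Rw ≤ 2 * c * S * lam ^ (2 * u - 1 - w) * (c * lam ^ w) := by
      have := hpos (2 * u - 1 - w)
      gcongr
    have h2 : lam * (lam ^ (2 * u - 1 - w) * lam ^ w) = P := by
      rw [← Real.rpow_add hlam, hmul, hP]
      ring_nf
    calc _ ≤ 2 * lam * (2 * c * S * lam ^ (2 * u - 1 - w) * (c * lam ^ w)) := by gcongr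
      _ = 4 * c ^ 2 * S * (lam * (lam ^ (2 * u - 1 - w) * lam ^ w)) := by ring
      _ = _ := by rw [h2]
  have hΛS : 1 ≤ Λ * S := one_le_mul_of_one_le_of_one_le hΛ hS1
  -- The factor is `11 = 1 + 4 + 2 + 4`, from `t1` to `t4`. The bound is linear in `S`.
  have hsum : x ^ 2 + lam * y ^ 2 ≤ 11 * c ^ 3 * Λ * S * P := by
    have hc23 : c ^ 2 ≤ c ^ 3 := pow_le_pow_right₀ hc (by norm_num)
    have h1 : c ^ 2 * P ≤ c ^ 3 * (Λ * S) * P := by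
      gcongr
      calc c ^ 2 ≤ c ^ 3 := hc23
        _ ≤ c ^ 3 * (Λ * S) := le_mul_of_one_le_right (by positivity) hΛS
    have h3 : 2 * c ^ 3 * Λ * P ≤ 2 * c ^ 3 * Λ * P * S :=
      le_mul_of_one_le_right (by positivity) hS1
    have h4 : 4 * c ^ 2 * S * P ≤ 4 * c ^ 3 * S * P * Λ := by
      calc 4 * c ^ 2 * S * P ≤ 4 * c ^ 3 * S * P := by gcongr
        _ ≤ _ := le_mul_of_one_le_right (by positivity) hΛ
    linarith
  have hK1 : 1 ≤ 11 * c ^ 3 := by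
    have : 1 ≤ c ^ 3 := one_le_pow₀ hc
    linarith
  -- If `S` is attained by `x` or `y`, the left side of `hsum` is at least `S² P` and one factor `S`
  -- cancels; if `S = Λ`, the bound is immediate.
  have hSK : S ≤ 11 * c ^ 3 * Λ := by
    have hsmall : ∀ a, 0 ≤ a → a ^ 2 * P ≤ x ^ 2 + lam * y ^ 2 → a = S → S ≤ 11 * c ^ 3 * Λ := by
      intro a ha h1 h2
      rw [h2] at h1
      have h3 : S * (S * P) ≤ 11 * c ^ 3 * Λ * (S * P) := by linarith
      exact le_of_mul_le_mul_right h3 (by positivity)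
    have e1 : lam ^ u * lam ^ u = P := by rw [← Real.rpow_add hlam, hP]; ring_nf
    have e2 : lam * (lam ^ (u - 1 / 2) * lam ^ (u - 1 / 2)) = P := by
      rw [← Real.rpow_add hlam, hmul, hP]
      ring_nf
    rcases max_choice Λ (max (x / lam ^ u) (y / lam ^ (u - 1 / 2))) with h | h
    · rw [hS, h]
      exact le_mul_of_one_le_left hΛ0.le hK1
    rcases max_choice (x / lam ^ u) (y / lam ^ (u - 1 / 2)) with h' | h'
    · refine hsmall (x / lam ^ u) (div_nonneg hx (hpos u).le) ?_ (by rw [hS, h, h'])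
      rw [← e1, div_pow, ← sq, div_mul_cancel₀ _ (pow_pos (hpos u) 2).ne']
      have : 0 ≤ lam * y ^ 2 := by positivity
      linarith
    · refine hsmall (y / lam ^ (u - 1 / 2)) (div_nonneg hy (hpos _).le) ?_ (by rw [hS, h, h'])
      rw [← e2, div_pow, ← sq, mul_left_comm, div_mul_cancel₀ _ (pow_pos (hpos _) 2).ne']
      have : 0 ≤ x ^ 2 := by positivity
      linarith
  have hEp := hpos E
  calc bk + dn ≤ 2 * c * S * lam ^ E + c * lam ^ E := by gcongr
    _ ≤ 2 * c * (11 * c ^ 3 * Λ) * lam ^ E + c * (11 * c ^ 3 * Λ) * lam ^ E := by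
        gcongr
        exact le_mul_of_one_le_right hc0.le (hS1.trans hSK)
    _ = _ := by ring

/-- Half of the denominator is `p + t (1 - s) + s`. -/
theorem uIndex_denom_pos {p s t : ℝ} (hp : 0 ≤ p) (hs0 : 0 < s) (hs1 : s ≤ 1) (ht : 0 ≤ t) :
    0 < 2 * (p + t) - 2 * s * (t - 1) := by
  nlinarith [mul_nonneg ht (sub_nonneg.mpr hs1)]

theorem uIndex_sub_half {p s t : ℝ} (hp : 0 ≤ p) (hs0 : 0 < s) (hs1 : s ≤ 1) (ht : 0 ≤ t) :
    uIndex p s t - 1 / 2 = s * (t - 1) / (2 * (p + t) - 2 * s * (t - 1)) := by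
  have := (uIndex_denom_pos hp hs0 hs1 ht).ne'
  rw [uIndex, div_sub' this, div_left_inj' this]
  ring

theorem uIndex_mul {p s t : ℝ} :
    uIndex p s t * s = s * (p + t) / (2 * (p + t) - 2 * s * (t - 1)) := by
  rw [uIndex]
  ring

/-- The rate comes from interpolating with weight `1/(p+1)` between the exponent `us` of `‖B^(p+1)
k‖` and the exponent `u - 1/2` of `‖k‖`. -/
theorem rateExp_eq {p s u : ℝ} (hp : 0 ≤ p) :
    rateExp p s u = 1 / (p + 1) * (u * s) + (1 - 1 / (p + 1)) * (u - 1 / 2) := by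
  have : p + 1 ≠ 0 := by positivity
  rw [rateExp]
  field_simp
  ring

theorem rateExp_uIndex {p s t : ℝ} (hp : 0 ≤ p) (hs0 : 0 < s) (hs1 : s ≤ 1) (ht : 0 ≤ t) :
    rateExp p s (uIndex p s t) = s * t / (2 * (p + t) - 2 * s * (t - 1)) := by
  have h1 := (uIndex_denom_pos hp hs0 hs1 ht).ne'
  have : p + 1 ≠ 0 := by positivity
  rw [rateExp_eq hp, uIndex_sub_half hp hs0 hs1 ht, uIndex_mul]
  field_simp
  ring

/-- Together with `two_mul_uIndex_le` this keeps the sampling terms, `λ^(r+1/2)` times `λ^u` or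
`λ^(1/2+E)`, at or below the order `λ^(2u)`. -/
theorem uIndex_le {p s t r : ℝ} (hp : 0 ≤ p) (hs0 : 0 < s) (hs1 : s ≤ 1) (ht : 0 ≤ t) (htr : t ≤ r) :
    uIndex p s t ≤ r + 1 / 2 := by
  have h1 := uIndex_denom_pos hp hs0 hs1 ht
  have h2 : s * (t - 1) / (2 * (p + t) - 2 * s * (t - 1)) ≤ t := by
    rw [div_le_iff₀ h1]
    nlinarith [mul_nonneg (mul_nonneg ht ht) (sub_nonneg.mpr hs1), mul_nonneg ht hp,
      mul_nonneg ht hs0.le]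
  linarith [uIndex_sub_half hp hs0 hs1 ht]

theorem two_mul_uIndex_le {p s t r : ℝ} (hp : 0 ≤ p) (hs0 : 0 < s) (hs1 : s ≤ 1) (ht : 0 ≤ t)
    (htr : t ≤ r) : 2 * uIndex p s t ≤ r + 1 + rateExp p s (uIndex p s t) := by
  have h1 := uIndex_denom_pos hp hs0 hs1 ht
  have h2 : 2 * (s * (t - 1) / (2 * (p + t) - 2 * s * (t - 1))) ≤
      t + s * t / (2 * (p + t) - 2 * s * (t - 1)) := by
    rw [← mul_div_assoc, div_le_iff₀ h1, add_mul, div_mul_cancel₀ _ h1.ne']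
    nlinarith [mul_nonneg (mul_nonneg ht ht) (sub_nonneg.mpr hs1), mul_nonneg ht hp,
      mul_nonneg ht hs0.le]
  rw [rateExp_uIndex hp hs0 hs1 ht]
  linarith [uIndex_sub_half hp hs0 hs1 ht]

/-- The radius exponent is the one giving the source term `λ ‖B^(q-1) k‖ ‖w‖` exactly the order
`λ^(2u)`. -/
theorem source_exponent_eq {p q s t : ℝ} (hp : 0 ≤ p) (hs0 : 0 < s) (hs1 : s ≤ 1) (ht : 0 ≤ t) :
    s * (t - q) / (2 * (p + t) - 2 * s * (t - 1)) = 2 * uIndex p s t - 1 -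
      ((q - 1) / (p + 1) * (uIndex p s t * s) +
        (1 - (q - 1) / (p + 1)) * (uIndex p s t - 1 / 2)) := by
  have h1 := (uIndex_denom_pos hp hs0 hs1 ht).ne'
  have : p + 1 ≠ 0 := by positivity
  have h3 : 2 * uIndex p s t - 1 = 2 * (uIndex p s t - 1 / 2) := by ring
  rw [h3, uIndex_sub_half hp hs0 hs1 ht, uIndex_mul]
  field_simp
  ring

end Rates

/-! ### From minimality to the error bound on a good sample. -/

section BasicInequality

variable {H : Type*} [NormedAddCommGroup H] [InnerProductSpace ℝ H] [CompleteSpace H]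
variable {X : Type*} [MeasurableSpace X]
variable {Y : Type*} [NormedAddCommGroup Y] [InnerProductSpace ℝ Y] [CompleteSpace Y]
  [SecondCountableTopology Y] [MeasurableSpace Y] [BorelSpace Y]
variable {H' : Type*} [NormedAddCommGroup H'] [InnerProductSpace ℝ H'] [CompleteSpace H']
  [RKHS ℝ H' X Y]
variable {L : H →ₗ.[ℝ] H} {ℓ : ℝ} {D : Set H} {A : H → H'} {fbar : L.domain} {m : ℕ}
  {z : Fin m → X × Y} {lam : ℝ}

/-- With `a = L (f₀ - fbar) = B^(q-1) w` the penalty of the minimizer is `‖k + a‖²`. Cancelling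
`‖a‖²` leaves a cross term, in which self-adjointness moves `B^(q-1)` onto `k`. -/
theorem IsTikhonovMinimizer.compare (hL : IsScaleGenerator L ℓ) (hℓ : 0 < ℓ) {q : ℝ} (hq : 1 ≤ q)
    {f f₀ w : H} (hf : IsTikhonovMinimizer L D A fbar z lam f) (hf₀ : f₀ ∈ D)
    (hw : f₀ - fbar = negPow L q w) :
    ∃ k, f - f₀ = inv L k ∧
      (1 / (m : ℝ)) * ∑ i, ‖A f (z i).1 - (z i).2‖ ^ 2 + lam * ‖k‖ ^ 2 ≤
      (1 / (m : ℝ)) * ∑ i, ‖A f₀ (z i).1 - (z i).2‖ ^ 2 -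
        2 * lam * ⟪funcCalc (inv L) (fun t => t ^ (q - 1)) k, w⟫ := by
  have hB := hL.isPositive_inv hℓ
  obtain ⟨-, hfL, hmin⟩ := hf
  set a := funcCalc (inv L) (fun t => t ^ (q - 1)) w with ha
  have hqw : negPow L q w = inv L a := by
    have h := funcCalc_rpow_add hB zero_le_one (sub_nonneg.mpr hq)
    rw [add_sub_cancel, funcCalc_rpow_one hB] at h
    rw [negPow, h]
    rfl
  obtain ⟨hy, hy'⟩ := hL.exists_apply_inv hℓ a
  set g : L.domain := fbar + ⟨inv L a, hy⟩ with hg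
  have hgf : (g : H) = f₀ := by
    have h : (g : H) = fbar + inv L a := rfl
    rw [h, ← hqw, ← hw, add_sub_cancel]
  have hgL : L (g - fbar) = a := by rw [hg, add_sub_cancel_left, hy']
  set k := L (⟨f, hfL⟩ - g) with hk
  have hkL : L (⟨f, hfL⟩ - fbar) = k + a := by
    rw [hk, ← hgL, ← LinearPMap.map_add, sub_add_sub_cancel]
  refine ⟨k, ?_, ?_⟩
  · rw [hk, hL.inv_apply hℓ, ← hgf]
    rfl
  · have h := hmin g (hgf ▸ hf₀)
    rw [tikhonov, tikhonov, hgL, hkL, hgf, norm_add_sq_real] at h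
    have h2 : ⟪funcCalc (inv L) (fun t => t ^ (q - 1)) k, w⟫ = ⟪k, a⟫ :=
      inner_funcCalc_left hB (continuousOn_rpow_Icc (sub_nonneg.mpr hq)) k w
    rw [h2]
    simp only at h
    linarith

/-- The sample `z` represents the noise and the `L²` norm up to an error controlled by `δ`. -/
def GoodSample (ν : Measure X) (g₀ : H') (lam δ : ℝ) (z : Fin m → X × Y) : Prop :=
  ∀ g : H', |(1 / (m : ℝ)) * ∑ i, ⟪g (z i).1, (z i).2 - g₀ (z i).1⟫| ≤
      δ * (‖injection H' ν g‖ + √lam * ‖g‖) ∧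
    |(1 / (m : ℝ)) * ∑ i, ‖g (z i).1‖ ^ 2 - ‖injection H' ν g‖ ^ 2| ≤
      δ * (‖g‖ * (‖injection H' ν g‖ + √lam * ‖g‖))

theorem goodSample_of_sum_le {ν : Measure X} {g₀ : H'} {K δ : ℝ} (hm : 0 < (m : ℝ)) (hlam : 0 ≤ lam)
    (hK : 0 ≤ K) (hKδ : K ≤ m * δ)
    (h : ∀ g : H', |∑ i, ⟪g (z i).1, (z i).2 - g₀ (z i).1⟫| ≤
        K * √(‖injection H' ν g‖ ^ 2 + lam * ‖g‖ ^ 2) ∧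
      |∑ i, (‖g (z i).1‖ ^ 2 - ‖injection H' ν g‖ ^ 2)| ≤
        K * (‖g‖ * √(‖injection H' ν g‖ ^ 2 + lam * ‖g‖ ^ 2))) :
    GoodSample ν g₀ lam δ z := by
  intro g
  obtain ⟨e1, e2⟩ := h g
  have hx := norm_nonneg (injection H' ν g)
  have hg := norm_nonneg g
  have h7 : 1 / (m : ℝ) * ∑ i, ‖g (z i).1‖ ^ 2 - ‖injection H' ν g‖ ^ 2 =
      1 / (m : ℝ) * ∑ i, (‖g (z i).1‖ ^ 2 - ‖injection H' ν g‖ ^ 2) := by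
    rw [Finset.sum_sub_distrib, Finset.sum_const, Finset.card_univ, Fintype.card_fin, nsmul_eq_mul,
      mul_sub, ← mul_assoc, one_div_mul_cancel hm.ne', one_mul]
  rw [h7]
  generalize ∑ i, (‖g (z i).1‖ ^ 2 - ‖injection H' ν g‖ ^ 2) = S₂ at e2 ⊢
  generalize ∑ i, ⟪g (z i).1, (z i).2 - g₀ (z i).1⟫ = S₁ at e1 ⊢
  generalize ‖injection H' ν g‖ = x at e1 e2 hx ⊢
  generalize ‖g‖ = y at e1 e2 hg ⊢
  have hV : √(x ^ 2 + lam * y ^ 2) ≤ x + √lam * y := by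
    refine Real.sqrt_le_iff.mpr ⟨by positivity, ?_⟩
    have h5 : (√lam * y) ^ 2 = lam * y ^ 2 := by rw [mul_pow, Real.sq_sqrt hlam]
    have h6 : 0 ≤ x * (√lam * y) := by positivity
    nlinarith
  have hm1 : ∀ a b : ℝ, |a| ≤ m * b → |1 / (m : ℝ) * a| ≤ b := fun a b hab => by
    rw [abs_mul, abs_of_pos (by positivity), one_div, inv_mul_le_iff₀ hm]
    exact hab
  refine ⟨hm1 _ _ (e1.trans ?_), hm1 _ _ (e2.trans ?_)⟩
  · rw [← mul_assoc]
    exact mul_le_mul hKδ hV (Real.sqrt_nonneg _) (hK.trans hKδ)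
  · rw [← mul_assoc (m : ℝ)]
    exact mul_le_mul hKδ (mul_le_mul_of_nonneg_left hV hg) (by positivity) (hK.trans hKδ)

theorem empirical_risk_eq (g₁ g₀ : H') (z : Fin m → X × Y) :
    (1 / (m : ℝ)) * ∑ i, ‖g₁ (z i).1 - (z i).2‖ ^ 2 =
      (1 / (m : ℝ)) * ∑ i, ‖(g₁ - g₀) (z i).1‖ ^ 2 -
      2 * ((1 / (m : ℝ)) * ∑ i, ⟪(g₁ - g₀) (z i).1, (z i).2 - g₀ (z i).1⟫) +
      (1 / (m : ℝ)) * ∑ i, ‖(z i).2 - g₀ (z i).1‖ ^ 2 := by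
  have h : ∀ i, ‖g₁ (z i).1 - (z i).2‖ ^ 2 = ‖(g₁ - g₀) (z i).1‖ ^ 2 -
      2 * ⟪(g₁ - g₀) (z i).1, (z i).2 - g₀ (z i).1⟫ + ‖(z i).2 - g₀ (z i).1‖ ^ 2 := fun i => by
    rw [← norm_sub_sq_real, RKHS.coe_sub, Pi.sub_apply, sub_sub_sub_cancel_right]
  simp only [h, Finset.sum_add_distrib, Finset.sum_sub_distrib, ← Finset.mul_sum]
  ring

/-- In the expansion of the empirical risk the fluctuation of the squared norm contributes `b`, and
the doubled noise pairing contributes `2`. -/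
theorem GoodSample.risk_bounds {ν : Measure X} {g₀ : H'} {δ b : ℝ} (hz : GoodSample ν g₀ lam δ z)
    (hδ : 0 ≤ δ) {g₁ : H'} (hb : ‖g₁ - g₀‖ ≤ b) :
    |(1 / (m : ℝ)) * ∑ i, ‖g₁ (z i).1 - (z i).2‖ ^ 2 -
        (1 / (m : ℝ)) * ∑ i, ‖(z i).2 - g₀ (z i).1‖ ^ 2 - ‖injection H' ν (g₁ - g₀)‖ ^ 2| ≤
      δ * (b + 2) * (‖injection H' ν (g₁ - g₀)‖ + √lam * ‖g₁ - g₀‖) := by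
  obtain ⟨h1, h2⟩ := hz (g₁ - g₀)
  rw [empirical_risk_eq g₁ g₀ z]
  set V := ‖injection H' ν (g₁ - g₀)‖ + √lam * ‖g₁ - g₀‖
  have hV : 0 ≤ V := by positivity
  have h3 : δ * (‖g₁ - g₀‖ * V) ≤ δ * (b * V) := by gcongr
  rw [abs_le] at h1 h2 ⊢
  constructor <;> nlinarith [h1.1, h1.2, h2.1, h2.2]

variable {fhat : H} {Q : Set H} {p q s r α d θ ℓA ϱ : ℝ} {ν : Measure X}

/-- Convergence rate of a Tikhonov minimizer, given a comparison element in the range of `L^{-q}`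
that approximates the true solution. -/
theorem norm_sub_le_of_goodSample (hL : IsScaleGenerator L ℓ) (hℓ : 0 < ℓ) (hp : 0 ≤ p) (hq1 : 1 ≤ q)
    (hq2 : q ≤ 2 + p) (hs0 : 0 < s) (hs1 : s ≤ 1) (hℓA : 0 ≤ ℓA)
    (hϱ : 0 < ϱ) (hA : OperatorAssumption L ν D A fhat Q p s α d θ ℓA ϱ) (hfhat : fhat ∈ D)
    {t c Λ δ : ℝ} (ht : 0 ≤ t) (htr : t ≤ r) (hc : 1 ≤ c) (hαc : α ≤ c) (hℓAc : ℓA ≤ c)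
    (hlam : 0 < lam) (hlam1 : lam ≤ 1) (hΛ : 1 ≤ Λ) (hδ0 : 0 ≤ δ)
    (hδ : δ * (ℓA * ϱ + 2) ≤ c * Λ * lam ^ (r + 1 / 2))
    (hz : GoodSample ν (A fhat) lam δ z) {f f₀ w : H}
    (hf : IsTikhonovMinimizer L D A fbar z lam f) (hfQ : f ∈ Q) (hf₀ : f₀ ∈ D)
    (hf₀ϱ : f₀ ∈ Metric.closedBall fhat ϱ) (hw : f₀ - fbar = negPow L q w)
    (hwc : ‖w‖ ≤ c * lam ^ (s * (t - q) / (2 * (p + t) - 2 * s * (t - 1))))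
    (hf₀d : ‖f₀ - fhat‖ ≤ c * lam ^ rateExp p s (uIndex p s t))
    (hf₀p : ‖negPow L p (f₀ - fhat)‖ ≤ c * lam ^ (uIndex p s t * s))
    (hf₀A : ‖injection H' ν (A f₀ - A fhat)‖ ≤ c * lam ^ uIndex p s t) :
    ‖f - fhat‖ ≤ 33 * c ^ 4 * Λ * lam ^ rateExp p s (uIndex p s t) := by
  have hB := hL.isPositive_inv hℓ
  have hinj := hL.inv_injective hℓ
  obtain ⟨k, hk, hmin⟩ := hf.compare hL hℓ hq1 hf₀ hw
  have hp1 : 0 < p + 1 := by linarith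
  have hfD : f ∈ Metric.closedBall fhat ϱ ∩ D := ⟨hA.large hfQ, (hA.subset hfQ).2⟩
  have hfh : fhat ∈ Metric.closedBall fhat ϱ ∩ D := ⟨Metric.mem_closedBall_self hϱ.le, hfhat⟩
  have hG := hA.lipschitz f hfD fhat hfh
  have hh := hA.lipschitz f₀ ⟨hf₀ϱ, hf₀⟩ fhat hfh
  have hGb : ‖A f - A fhat‖ ≤ ℓA * ϱ := hG.trans (by
    gcongr
    simpa [dist_eq_norm] using hfD.1)
  have hhb : ‖A f₀ - A fhat‖ ≤ ℓA * ϱ := hh.trans (by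
    gcongr
    simpa [dist_eq_norm] using hf₀ϱ)
  have hR1 := (abs_le.mp (hz.risk_bounds hδ0 hGb)).1
  have hR2 := (abs_le.mp (hz.risk_bounds hδ0 hhb)).2
  set bq := ‖funcCalc (inv L) (fun t => t ^ (q - 1)) k‖ with hbq
  set N := ‖funcCalc (inv L) (fun t => t ^ (p + 1)) k‖ with hN
  have hin : -(bq * ‖w‖) ≤ ⟪funcCalc (inv L) (fun t => t ^ (q - 1)) k, w⟫ :=
    (abs_le.mp (abs_real_inner_le_norm _ w)).1
  have hin' := mul_le_mul_of_nonneg_left hin hlam.le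
  -- Since `f - f₀ = B k`, this is the weak norm in which stability is stated.
  have hNp : N = ‖negPow L p (f - f₀)‖ := by
    rw [hN, hk, funcCalc_rpow_add hB hp zero_le_one, funcCalc_rpow_one hB]
    rfl
  have hf_split : ‖f - fhat‖ ≤ ‖inv L k‖ + ‖f₀ - fhat‖ := by
    rw [← hk]
    exact norm_sub_le_norm_sub_add_norm_sub _ _ _
  refine hf_split.trans ?_
  refine balance_bound (s := s) (r := r) (u := uIndex p s t)
    (w := s * (t - q) / (2 * (p + t) - 2 * s * (t - 1))) (θ₁ := 1 / (p + 1))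
    (θ₂ := (q - 1) / (p + 1)) (x := ‖injection H' ν (A f - A fhat)‖) (y := ‖k‖) (N := N) (bq := bq)
    (G := ‖A f - A fhat‖) (xh := ‖injection H' ν (A f₀ - A fhat)‖) (hn := ‖A f₀ - A fhat‖)
    (Rw := ‖w‖) (Δ := δ * (ℓA * ϱ + 2)) hs0 hs1 (by positivity) ?_
    (div_nonneg (by linarith) hp1.le) ?_ (rateExp_eq hp) (source_exponent_eq hp hs0 hs1 ht)
    (uIndex_le hp hs0 hs1 ht htr) (two_mul_uIndex_le hp hs0 hs1 ht htr) hc hlam hlam1 hΛ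
    (norm_nonneg _) (norm_nonneg _) (norm_nonneg _) (norm_nonneg _) (norm_nonneg _) (by positivity)
    ?_ ?_ ?_ ?_ hf₀d hf₀A ?_ hwc hδ ?_
  · rw [div_le_one hp1]; linarith
  · rw [div_le_one hp1]; linarith
  · rw [hNp, ← sub_sub_sub_cancel_right f f₀ fhat, map_sub]
    refine (norm_sub_le _ _).trans (add_le_add ((hA.stability f hfQ).trans ?_) hf₀p)
    gcongr
  · have h := norm_funcCalc_rpow_interp hB hinj hp1.le (θ := 1 / (p + 1)) (by positivity)
      (by rw [div_le_one hp1]; linarith) k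
    rwa [one_div_mul_cancel hp1.ne', funcCalc_rpow_one hB] at h
  · have h := norm_funcCalc_rpow_interp hB hinj hp1.le (θ := (q - 1) / (p + 1))
      (div_nonneg (by linarith) hp1.le) (by rw [div_le_one hp1]; linarith) k
    rwa [div_mul_cancel₀ _ hp1.ne'] at h
  · exact hG.trans (mul_le_mul hℓAc hf_split (norm_nonneg _) (by linarith))
  · exact hh.trans (by gcongr)
  · linarith

end BasicInequality

/-! ### The parameter choice and the sampling error it produces. -/

section Parameters

/-- Positivity of the parameter forces `m ≥ 2`, since `log m / m` is zero at `m = 0` and `m = 1`. -/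
theorem exists_log_eq {r : ℝ} (hr : 0 ≤ r) {m : ℕ} (h : 0 < regParam r m) :
    1 / 2 ≤ Real.log m ∧ (m : ℝ) * regParam r m ^ (2 * r + 1) = Real.log m ∧ 0 < (m : ℝ) := by
  have hr1 : 0 < 2 * r + 1 := by linarith
  have hne : Real.log m / m ≠ 0 := by
    intro h0
    rw [regParam, h0, Real.zero_rpow (by positivity)] at h
    exact h.false
  have hm2 : 2 ≤ m := by
    by_contra hlt
    have : m = 0 ∨ m = 1 := by omega
    rcases this with rfl | rfl <;> simp at hne
  have hm2' : (2 : ℝ) ≤ m := by exact_mod_cast hm2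
  have hm0 : (0 : ℝ) < m := by linarith
  have hlog : 1 / 2 ≤ Real.log m :=
    (by linarith [Real.log_two_gt_d9] : (1 / 2 : ℝ) ≤ Real.log 2).trans
      (Real.log_le_log (by norm_num) hm2')
  refine ⟨hlog, ?_, hm0⟩
  rw [regParam, ← Real.rpow_mul (by positivity), one_div_mul_cancel hr1.ne', Real.rpow_one]
  field_simp

/-- From `m λ^(2r+1) = log m` and `m log m ≥ 1` follows `λ^(2r+1) ≥ m^(-2)`. After taking logarithms
the factor `2r + 1 ≥ 1` may be dropped when `log λ < 0`. -/
theorem log_inv_regParam_le {r : ℝ} (hr : 0 ≤ r) {m : ℕ} (h : 0 < regParam r m) :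
    Real.log (1 / regParam r m) ≤ 2 * Real.log m := by
  obtain ⟨h1, h2, hm⟩ := exists_log_eq hr h
  have hm1 : (1 : ℝ) ≤ m := by
    by_contra hlt
    push Not at hlt
    linarith [Real.log_nonpos hm.le hlt.le]
  have hlow : 1 / (m : ℝ) ^ 2 ≤ regParam r m ^ (2 * r + 1) := by
    have hm2 : (2 : ℝ) ≤ m := by
      have : m ≠ 1 := fun h => by rw [h] at h1; norm_num at h1
      have h0 : m ≠ 0 := fun h => by rw [h] at hm; norm_num at hm
      exact_mod_cast (by omega : 2 ≤ m)
    have : (m : ℝ) ^ 2 * regParam r m ^ (2 * r + 1) = m * Real.log m := by rw [← h2]; ring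
    rw [div_le_iff₀' (by positivity), this]
    nlinarith
  have hlog := Real.log_le_log (by positivity) hlow
  rw [one_div, Real.log_inv, Real.log_pow, Real.log_rpow h] at hlog
  rw [one_div, Real.log_inv]
  have hpos : 0 ≤ Real.log m := by linarith
  by_cases hs : 0 ≤ Real.log (regParam r m)
  · push_cast at hlog
    linarith
  · push Not at hs
    push_cast at hlog
    nlinarith

theorem one_le_log_four_div {η : ℝ} (h0 : 0 < η) (h1 : η < 1) : 1 ≤ Real.log (4 / η) := by
  have h2 : Real.log 4 = 2 * Real.log 2 := by
    rw [show (4 : ℝ) = 2 ^ 2 by norm_num, Real.log_pow]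
    norm_num
  have h3 : Real.log 4 ≤ Real.log (4 / η) := by
    refine Real.log_le_log (by norm_num) ?_
    rw [le_div_iff₀ h0]
    linarith
  linarith [Real.log_two_gt_d9]

/-- The factor of `log m` in the bound of the effective dimension. -/
noncomputable def dimConst (κ Cdec lam₀ : ℝ) : ℝ := 2 * Cdec + 2 * (κ ^ 2 / lam₀)

/-- The scale of the exponential moments. -/
noncomputable def momentConst (κ M : ℝ) : ℝ := 1 + 2 * (κ * M) + 4 * κ ^ 2

/-- The constant in the bound of the sampling error. -/
noncomputable def samplingConst (κ M σ Cdec lam₀ : ℝ) : ℝ :=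
  (1 + dimConst κ Cdec lam₀ * (σ ^ 2 / 2 + κ ^ 2)) * momentConst κ M

variable {X : Type*} [MeasurableSpace X]
variable {Y : Type*} [NormedAddCommGroup Y] [InnerProductSpace ℝ Y] [CompleteSpace Y]
  [SecondCountableTopology Y] [MeasurableSpace Y] [BorelSpace Y]
variable {H' : Type*} [NormedAddCommGroup H'] [InnerProductSpace ℝ H'] [CompleteSpace H']
  [RKHS ℝ H' X Y] [TopologicalSpace.SeparableSpace H']
variable {κ M σ Cdec lam₀ r : ℝ} {ρ : Measure (X × Y)} [IsProbabilityMeasure ρ] {g₀ : H'} {m : ℕ}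

/-- Above `lam₀` the crude bound is a constant, and `log m ≥ 1/2` absorbs it at the cost of a factor
two. -/
theorem effDim_regParam_le (hK : KernelAssumption (X := X) (Y := Y) H' κ) (hκ : 0 ≤ κ)
    (hCdec : 0 < Cdec) (hlam₀ : 0 < lam₀) (hr : 0 ≤ r)
    (hdec : ∀ lam : ℝ, 0 < lam → lam ≤ lam₀ → effDim H' ρ.fst lam ≤ Cdec * Real.log (1 / lam))
    (h : 0 < regParam r m) :
    effDim H' ρ.fst (regParam r m) ≤ dimConst κ Cdec lam₀ * Real.log m := by
  have h1 := (exists_log_eq hr h).1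
  have hk : 0 ≤ κ ^ 2 / lam₀ := by positivity
  rw [dimConst]
  by_cases hle : regParam r m ≤ lam₀
  · have h2 := mul_le_mul_of_nonneg_left (log_inv_regParam_le hr h) hCdec.le
    have h3 := hdec _ h hle
    nlinarith
  · push Not at hle
    have h2 := effDim_le (ν := ρ.fst) hK hκ h
    have h3 : κ ^ 2 / regParam r m ≤ κ ^ 2 / lam₀ := by gcongr
    nlinarith

set_option maxHeartbeats 1000000 in
theorem measure_not_goodSample_le (hK : KernelAssumption (X := X) (Y := Y) H' κ) (hκ : 0 ≤ κ)
    (hM : 0 < M) (h2 : Integrable (fun z : X × Y => ‖z.2‖ ^ 2) ρ)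
    (hc : ∀ᵐ x ∂ρ.fst, ∫ y, y ∂(ρ.condKernel x) = g₀ x)
    (hn : ∀ᵐ x ∂ρ.fst, ∫⁻ y, ENNReal.ofReal (Real.exp (‖y - g₀ x‖ / M) - ‖y - g₀ x‖ / M - 1)
      ∂(ρ.condKernel x) ≤ ENNReal.ofReal (σ ^ 2 / (2 * M ^ 2)))
    (hCdec : 0 < Cdec) (hlam₀ : 0 < lam₀) (hr : 0 ≤ r)
    (hdec : ∀ lam : ℝ, 0 < lam → lam ≤ lam₀ → effDim H' ρ.fst lam ≤ Cdec * Real.log (1 / lam))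
    (h : 0 < regParam r m) (h1 : regParam r m ≤ 1) {η : ℝ} (hη : 0 < η) (hη1 : η < 1) :
    (Measure.pi fun _ : Fin m => ρ) {z | ¬ GoodSample ρ.fst g₀ (regParam r m)
      (samplingConst κ M σ Cdec lam₀ * Real.log (4 / η) * regParam r m ^ (r + 1 / 2)) z} ≤
      ENNReal.ofReal η := by
  obtain ⟨hlog, hmlam, hm⟩ := exists_log_eq hr h
  have hN := effDim_regParam_le (ρ := ρ) hK hκ hCdec hlam₀ hr hdec h
  have hN0 := effDim_nonneg (H' := H') (ν := ρ.fst) h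
  have hΛ := one_le_log_four_div hη hη1
  set lam := regParam r m
  set Λ := Real.log (4 / η) with hΛdef
  set N := effDim H' ρ.fst lam
  set CN := dimConst κ Cdec lam₀ with hCN
  have hCN0 : 0 ≤ CN := by rw [hCN, dimConst]; positivity
  set Ct := momentConst κ M with hCt
  have hκM : 0 ≤ κ * M := by positivity
  have hCt1 : 1 ≤ Ct := by rw [hCt, momentConst]; nlinarith [sq_nonneg κ]
  have hCt2 : 2 * (κ * M) ≤ Ct := by rw [hCt, momentConst]; nlinarith [sq_nonneg κ]
  have hCt3 : 4 * κ ^ 2 ≤ Ct := by rw [hCt, momentConst]; nlinarith [sq_nonneg κ]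
  have hCt0 : 0 < Ct := by linarith
  set P := lam ^ (r + 1 / 2) with hP
  have hP0 : 0 < P := Real.rpow_pos_of_pos h _
  -- Because `m P² = log m`, this scale makes `m t² N` bounded independently of `m`, while a
  -- deviation divided by `m t` has order `P`.
  set t := 1 / (Ct * m * P) with ht
  have ht0 : 0 < t := by positivity
  have hPP : m * P ^ 2 = Real.log m := by
    rw [← hmlam, hP, ← Real.rpow_natCast, ← Real.rpow_mul h.le]
    ring_nf
  have hPs : 1 / 2 ≤ m * P * √lam := by
    have h3 : P ≤ √lam := by
      rw [Real.sqrt_eq_rpow]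
      exact Real.rpow_le_rpow_of_exponent_ge h h1 (by linarith)
    calc (1 / 2 : ℝ) ≤ m * P ^ 2 := by rw [hPP]; exact hlog
      _ = m * P * P := by ring
      _ ≤ _ := by gcongr
  have hsmall : ∀ a, 2 * a ≤ Ct → t * a ≤ √lam := by
    intro a ha
    rw [ht, one_div, inv_mul_le_iff₀ (by positivity)]
    calc a ≤ Ct * (1 / 2) := by linarith
      _ ≤ Ct * (m * P * √lam) := by gcongr
      _ = _ := by ring
  set c₀ := CN * (σ ^ 2 / 2 + κ ^ 2) with hc₀
  have hc₀0 : 0 ≤ c₀ := by positivity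
  have hmt : m * t ^ 2 * N ≤ CN := by
    have h3 : m * t ^ 2 = 1 / (Ct ^ 2 * Real.log m) := by
      rw [← hPP, ht]
      field_simp
    have hlog0 : 0 < Real.log m := by linarith
    rw [h3, one_div, inv_mul_le_iff₀ (by positivity)]
    have h4 : 1 ≤ Ct ^ 2 := one_le_pow₀ hCt1
    calc N ≤ 1 * (CN * Real.log m) := by rw [one_mul]; exact hN
      _ ≤ Ct ^ 2 * (CN * Real.log m) := by gcongr
      _ = _ := by ring
  have hev := measure_sampling_le (σ := σ) (c₀ := c₀) (Λ := Λ) (m := m) hK hκ hM h2 hc hn h ht0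
    (hsmall _ hCt2) (hsmall _ (by linarith)) (by
      calc _ ≤ CN * (σ ^ 2 / 2) := by gcongr
        _ ≤ c₀ := by rw [hc₀]; gcongr; linarith [sq_nonneg κ]) (by
      calc _ ≤ CN * κ ^ 2 := by gcongr
        _ ≤ c₀ := by rw [hc₀]; gcongr; linarith [sq_nonneg σ])
  have h4 : 4 * Real.exp (-Λ) = η := by
    rw [hΛdef, Real.exp_neg, Real.exp_log (by positivity)]
    field_simp
  rw [h4] at hev
  have hfac : (Λ + c₀) / t ≤ m * (samplingConst κ M σ Cdec lam₀ * Λ * P) := by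
    rw [ht, div_div_eq_mul_div, div_one, samplingConst, ← hCt, ← hCN, ← hc₀]
    -- Uses `Λ ≥ 1`.
    have h5 : Λ + c₀ ≤ (1 + c₀) * Λ := by nlinarith
    calc _ ≤ (1 + c₀) * Λ * (Ct * m * P) := by gcongr
      _ = _ := by ring
  refine (measure_mono ?_).trans hev
  intro z hz hgood
  exact hz (goodSample_of_sum_le hm h.le (by positivity) hfac hgood)

end Parameters

/-! ### Bounds for the comparison elements. -/

section Comparison

variable {H : Type*} [NormedAddCommGroup H] [InnerProductSpace ℝ H] [CompleteSpace H]
variable {L : H →ₗ.[ℝ] H} {ℓ p q s r Rd lam : ℝ}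

theorem IsScaleGenerator.exists_negPow_eq (hL : IsScaleGenerator L ℓ) (hℓ : 0 < ℓ) (hq : 0 ≤ q)
    (hqr : q ≤ r) {v : H} (hv : ‖v‖ ≤ Rd) :
    ∃ w, negPow L r v = negPow L q w ∧ ‖w‖ ≤ ℓ⁻¹ ^ (r - q) * Rd := by
  have hB := hL.isPositive_inv hℓ
  have h := funcCalc_rpow_add hB hq (sub_nonneg.mpr hqr)
  rw [add_sub_cancel] at h
  refine ⟨funcCalc (inv L) (fun t => t ^ (r - q)) v, by rw [negPow, h]; rfl, ?_⟩
  refine (ContinuousLinearMap.le_opNorm _ _).trans ?_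
  exact mul_le_mul (norm_funcCalc_rpow_le hB (sub_nonneg.mpr hqr) (hL.norm_inv_le hℓ)) hv
    (norm_nonneg _) (by positivity)

/-- The factor in the scale at which the distance minimizer resolves the true solution. -/
noncomputable def distScale (p q s r Rd : ℝ) : ℝ :=
  Rd ^ ((1 - ((p + q) - s * (q - 1)) / ((p + r) - s * (r - 1))) / (q - r))

theorem IsDistMinimizer.norm_sub_le (hL : IsScaleGenerator L ℓ) (hℓ : 0 < ℓ) (hp : 0 ≤ p)
    (hs0 : 0 < s) (hs1 : s ≤ 1) (hr : 0 ≤ r) (hrq : r ≤ q) (hrp : r + p ≤ 2 * q) (hRd : 0 ≤ Rd)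
    (hlam : 0 < lam) {fbar fhat fR v : H} (hv : fhat - fbar = negPow L r v) (hvR : ‖v‖ ≤ Rd)
    (hfR : IsDistMinimizer L q fbar fhat (benchRadius p q s r Rd lam) fR) :
    ‖fR - fhat‖ ≤ distScale p q s r Rd ^ r * Rd * lam ^ rateExp p s (uIndex p s r) ∧
    ‖negPow L p (fR - fhat)‖ ≤ distScale p q s r Rd ^ (r + p) * Rd * lam ^ (uIndex p s r * s) := by
  have hden := uIndex_denom_pos hp hs0 hs1 hr
  have hden' : 0 < (p + r) - s * (r - 1) := by linarith
  have hτc : 0 ≤ distScale p q s r Rd := Real.rpow_nonneg hRd _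
  -- In the degenerate cases there is no error: if `Rd = 0`, both elements equal `fbar`; if `r = q`,
  -- the radius is `Rd` and `fhat` itself is admissible.
  suffices hzero : fR = fhat ∨ (0 < Rd ∧ r < q) by
    obtain h0 | ⟨hRd0, hrq'⟩ := hzero
    · rw [h0, sub_self, map_zero, norm_zero]
      constructor <;> positivity
    obtain ⟨hmin, w, hw, hwR⟩ := hfR
    rw [isMinOn_iff] at hmin
    have hsub : ∀ w', fbar + negPow L q w' - fhat = -(negPow L r v - negPow L q w') := fun w' => by
      rw [← hv]
      abel
    have hfRw : fR - fhat = -(negPow L r v - negPow L q w) := by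
      rw [← hsub, ← hw]
      abel
    -- The solution of `τ^(q-r) R = Rd`; its powers `r` and `r + p` produce the exponents `rateExp`
    -- and `us` in `lam`.
    set τ := distScale p q s r Rd * lam ^ (s / (2 * (p + r) - 2 * s * (r - 1))) with hτ
    have hτ0 : 0 < τ := mul_pos (Real.rpow_pos_of_pos hRd0 _) (Real.rpow_pos_of_pos hlam _)
    have hτpow : ∀ a, τ ^ a = distScale p q s r Rd ^ a *
        lam ^ (s * a / (2 * (p + r) - 2 * s * (r - 1))) := fun a => by
      rw [hτ, Real.mul_rpow hτc (by positivity), ← Real.rpow_mul hlam.le, div_mul_eq_mul_div]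
    have hqr : q - r ≠ 0 := (sub_pos.mpr hrq').ne'
    have hτR : Rd ≤ τ ^ (q - r) * benchRadius p q s r Rd lam := by
      rw [hτpow, benchRadius, distScale, ← Real.rpow_mul hRd, div_mul_cancel₀ _ hqr,
        mul_mul_mul_comm, ← Real.rpow_add hRd0, ← Real.rpow_add hlam, sub_add_cancel,
        Real.rpow_one, ← add_div, ← mul_add, sub_add_sub_cancel, sub_self, mul_zero, zero_div,
        Real.rpow_zero, mul_one]
    have hR0 : 0 < benchRadius p q s r Rd lam :=
      mul_pos (Real.rpow_pos_of_pos hRd0 _) (Real.rpow_pos_of_pos hlam _)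
    obtain ⟨h1, h2⟩ := norm_distMin_le (hL.isPositive_inv hℓ) (hL.inv_injective hℓ) hp hr hrq' hrp
      hR0 hτ0 hτR hvR hwR (fun w' hw' => by
        have h := hmin (fbar + negPow L q w') ⟨w', add_sub_cancel_left _ _, hw'⟩
        rwa [hfRw, hsub, norm_neg, norm_neg] at h)
    rw [hfRw, map_neg, norm_neg, norm_neg, rateExp_uIndex hp hs0 hs1 hr, uIndex_mul, add_comm p r,
      mul_right_comm, mul_right_comm (distScale p q s r Rd ^ (r + p))]
    rw [hτpow, add_comm p r] at h1 h2
    exact ⟨h1, h2⟩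
  obtain ⟨hmin, w, hw, hwR⟩ := hfR
  rw [isMinOn_iff] at hmin
  obtain hRd0 | hRd0 := hRd.eq_or_lt
  · left
    have hk : 0 < ((p + q) - s * (q - 1)) / ((p + r) - s * (r - 1)) :=
      div_pos (by linarith [uIndex_denom_pos hp hs0 hs1 (hr.trans hrq)]) hden'
    rw [benchRadius, ← hRd0, Real.zero_rpow hk.ne', zero_mul] at hwR
    rw [← hRd0] at hvR
    rw [norm_le_zero_iff.mp hwR, map_zero, sub_eq_zero] at hw
    rw [norm_le_zero_iff.mp hvR, map_zero, sub_eq_zero] at hv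
    rw [hw, hv]
  · obtain hrq' | hrq' := hrq.eq_or_lt
    · left
      have h := hmin fhat ⟨v, by rw [← hrq', hv], by
        rwa [benchRadius, ← hrq', div_self hden'.ne', sub_self, mul_zero, zero_div, Real.rpow_zero,
          Real.rpow_one, mul_one]⟩
      rw [sub_self, norm_zero, norm_le_zero_iff, sub_eq_zero] at h
      exact h
    · exact Or.inr ⟨hRd0, hrq'⟩

/-- Converts the weak error of the comparison element into a bound on its residual, with the
converse stability estimate as `h`. -/
theorem le_rpow_of_mul_rpow_le {α β s u x b c : ℝ} (hα : 0 < α) (hβ : 0 < β) (hs : 0 < s)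
    (hx : 0 ≤ x) (hc : 0 ≤ c) (hlam : 0 < lam) (h : α * x ^ s ≤ β * b) (hb : b ≤ c * lam ^ (u * s)) :
    x ≤ (β / α * c) ^ (1 / s) * lam ^ u := by
  have h1 : x ^ s ≤ β / α * c * lam ^ (u * s) := by
    rw [div_mul_eq_mul_div, div_mul_eq_mul_div, le_div_iff₀' hα]
    refine h.trans ?_
    rw [mul_assoc]
    exact mul_le_mul_of_nonneg_left hb hβ.le
  have h2 := Real.rpow_le_rpow (Real.rpow_nonneg hx s) h1 (z := 1 / s) (by positivity)
  rwa [← Real.rpow_mul hx, mul_one_div_cancel hs.ne', Real.rpow_one,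
    Real.mul_rpow (by positivity) (by positivity), ← Real.rpow_mul hlam.le, mul_assoc,
    mul_one_div_cancel hs.ne', mul_one] at h2

end Comparison

/-! ### The rate in probability for a given comparison element. -/

section Rate

variable {H : Type*} [NormedAddCommGroup H] [InnerProductSpace ℝ H] [CompleteSpace H]
variable {X : Type*} [MeasurableSpace X]
variable {Y : Type*} [NormedAddCommGroup Y] [InnerProductSpace ℝ Y] [CompleteSpace Y]
  [SecondCountableTopology Y] [MeasurableSpace Y] [BorelSpace Y]
variable {H' : Type*} [NormedAddCommGroup H'] [InnerProductSpace ℝ H'] [CompleteSpace H']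
  [RKHS ℝ H' X Y] [TopologicalSpace.SeparableSpace H']
variable {ρ : Measure (X × Y)} [IsProbabilityMeasure ρ]
variable {L : H →ₗ.[ℝ] H} {D : Set H} {A : H → H'} {fhat : H} {fbar : L.domain} {Q : Set H}
variable {p q s r α ℓL ℓA ϱ κ M σ Cdec lam₀ d θ : ℝ} {m : ℕ} {fz : (Fin m → X × Y) → H}

theorem samplingConst_nonneg (hκ : 0 ≤ κ) (hM : 0 < M) (hCdec : 0 < Cdec) (hlam₀ : 0 < lam₀) :
    0 ≤ samplingConst κ M σ Cdec lam₀ := by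
  rw [samplingConst, dimConst, momentConst]
  positivity

/-- The rate of convergence in probability, given a comparison element. -/
theorem measure_not_norm_sub_le_le (hp : 0 ≤ p) (hq1 : 1 ≤ q) (hq2 : q ≤ 2 + p) (hs0 : 0 < s)
    (hs1 : s ≤ 1) (hr : 0 ≤ r) (hℓL : 0 < ℓL) (hℓA : 0 ≤ ℓA) (hϱ : 0 < ϱ) (hκ : 0 ≤ κ)
    (hM : 0 < M) (hCdec : 0 < Cdec) (hlam₀ : 0 < lam₀) (hL : IsScaleGenerator L ℓL)
    (hT : TrueSolution ρ D A fhat) (hN : NoiseCondition ρ A fhat M σ)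
    (hK : KernelAssumption (X := X) (Y := Y) H' κ)
    (hA : OperatorAssumption L ρ.fst D A fhat Q p s α d θ ℓA ϱ)
    (hdec : ∀ lam : ℝ, 0 < lam → lam ≤ lam₀ → effDim H' ρ.fst lam ≤ Cdec * Real.log (1 / lam))
    (hlam : 0 < regParam r m) (hlam1 : regParam r m ≤ 1)
    (hfz : ∀ᵐ z ∂(Measure.pi fun _ : Fin m => ρ),
      IsTikhonovMinimizer L D A fbar z (regParam r m) (fz z) ∧ fz z ∈ Q)
    {t c C : ℝ} (ht : 0 ≤ t) (htr : t ≤ r) (hc : 1 ≤ c) (hαc : α ≤ c) (hℓAc : ℓA ≤ c)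
    (hsc : samplingConst κ M σ Cdec lam₀ * (ℓA * ϱ + 2) ≤ c) (hC : 33 * c ^ 4 ≤ C)
    {f₀ w : H} (hf₀ : f₀ ∈ D) (hf₀ϱ : f₀ ∈ Metric.closedBall fhat ϱ)
    (hw : f₀ - fbar = negPow L q w)
    (hwc : ‖w‖ ≤ c * regParam r m ^ (s * (t - q) / (2 * (p + t) - 2 * s * (t - 1))))
    (hf₀d : ‖f₀ - fhat‖ ≤ c * regParam r m ^ rateExp p s (uIndex p s t))
    (hf₀p : ‖negPow L p (f₀ - fhat)‖ ≤ c * regParam r m ^ (uIndex p s t * s))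
    (hf₀A : ‖injection H' ρ.fst (A f₀ - A fhat)‖ ≤ c * regParam r m ^ uIndex p s t)
    {η : ℝ} (hη : 0 < η) (hη1 : η < 1) :
    (Measure.pi fun _ : Fin m => ρ) {z | ¬ ‖fz z - fhat‖ ≤
      C * regParam r m ^ rateExp p s (uIndex p s t) * Real.log (4 / η)} ≤ ENNReal.ofReal η := by
  refine le_trans (measure_mono_ae ?_) (measure_not_goodSample_le (σ := σ) hK hκ hM hT.secondMoment
    hT.condExp hN hCdec hlam₀ hr hdec hlam hlam1 hη hη1)
  have hΛ := one_le_log_four_div hη hη1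
  have hS := samplingConst_nonneg (σ := σ) hκ hM hCdec hlam₀
  filter_upwards [hfz] with z hz hbad hgood
  refine hbad ((norm_sub_le_of_goodSample hL hℓL hp hq1 hq2 hs0 hs1 hℓA hϱ hA
    (interior_subset hT.mem_interior) ht htr hc hαc hℓAc hlam hlam1 hΛ (by positivity) ?_ hgood hz.1
    hz.2 hf₀ hf₀ϱ hw hwc hf₀d hf₀p hf₀A).trans ?_)
  · rw [mul_right_comm, mul_right_comm _ _ (ℓA * ϱ + 2)]
    gcongr
  · rw [mul_right_comm]
    gcongr

end Rate
end HilbertScale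

/-! ### The two cases of the theorem. -/

open HilbertScale in
theorem mainTheorem5
    (p q s r α β ℓL ℓA ϱ κ M σ Rd Cdec lam₀ : ℝ)
    (hp : 0 ≤ p) (hq1 : 1 ≤ q) (hq2 : q ≤ 2 + p) (hs0 : 0 < s) (hs1 : s ≤ 1) (hr : 0 ≤ r)
    (hα : 0 < α) (hβ : 0 < β) (hℓL : 0 < ℓL) (hℓA : 0 ≤ ℓA) (hϱ : 0 < ϱ) (hκ : 0 ≤ κ)
    (hM : 0 < M) (hσ : 0 ≤ σ) (hRd : 0 ≤ Rd) (hCdec : 0 < Cdec)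
    (hlam₀ : 0 < lam₀) (hlam₀' : lam₀ < 1) :
    ∃ C : ℝ, 0 < C ∧
      ∀ (H : Type*) [NormedAddCommGroup H] [InnerProductSpace ℝ H] [CompleteSpace H]
        [TopologicalSpace.SeparableSpace H]
        (X : Type*) [TopologicalSpace X] [PolishSpace X] [MeasurableSpace X] [BorelSpace X]
        (Y : Type*) [NormedAddCommGroup Y] [InnerProductSpace ℝ Y] [CompleteSpace Y]
        [SecondCountableTopology Y] [MeasurableSpace Y] [BorelSpace Y]
        (H' : Type*) [NormedAddCommGroup H'] [InnerProductSpace ℝ H'] [CompleteSpace H']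
        [TopologicalSpace.SeparableSpace H'] [RKHS ℝ H' X Y]
        (ρ : Measure (X × Y)) [IsProbabilityMeasure ρ]
        (L : H →ₗ.[ℝ] H) (D : Set H) (A : H → H') (fhat : H) (fbar : L.domain) (Q : Set H)
        (d θ : ℝ),
        IsScaleGenerator L ℓL →
        (fbar : H) ∈ D →
        TrueSolution ρ D A fhat →
        NoiseCondition ρ A fhat M σ →
        KernelAssumption H' κ →
        0 < d → 0 ≤ θ →
        OperatorAssumption L ρ.fst D A fhat Q p s α d θ ℓA ϱ →
        -- source condition
        (∃ v : H, fhat - fbar = negPow L r v ∧ ‖v‖ ≤ Rd) →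
        -- converse of the conditional stability estimate
        (∀ f ∈ Q, α * ‖injection H' ρ.fst (A f - A fhat)‖ ^ s ≤ β * ‖negPow L p (f - fhat)‖) →
        -- logarithmic decay of the effective dimension
        (∀ lam : ℝ, 0 < lam → lam ≤ lam₀ → effDim H' ρ.fst lam ≤ Cdec * Real.log (1 / lam)) →
        ∀ (m : ℕ),
          0 < regParam r m → regParam r m ≤ 1 →
          effDim H' ρ.fst (regParam r m) ≤ m * regParam r m →
          ∀ fz : (Fin m → X × Y) → H,
            (∀ᵐ z ∂(Measure.pi fun _ : Fin m => ρ),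
              IsTikhonovMinimizer L D A fbar z (regParam r m) (fz z) ∧ fz z ∈ Q) →
            (q ≤ r → ∀ η : ℝ, 0 < η → η < 1 →
              (Measure.pi fun _ : Fin m => ρ) {z | ¬ ‖fz z - fhat‖ ≤
                C * regParam r m ^ rateExp p s (uIndex p s q) * Real.log (4 / η)} ≤
                  ENNReal.ofReal η) ∧
            (r ≤ q → r + p ≤ 2 * q →
              (∃ fR ∈ Q, IsDistMinimizer L q fbar fhat
                (benchRadius p q s r Rd (regParam r m)) fR) →
              ∀ η : ℝ, 0 < η → η < 1 →
              (Measure.pi fun _ : Fin m => ρ) {z | ¬ ‖fz z - fhat‖ ≤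
                C * regParam r m ^ rateExp p s (uIndex p s r) * Real.log (4 / η)} ≤
                  ENNReal.ofReal η) := by
  have hS := samplingConst_nonneg (σ := σ) hκ hM hCdec hlam₀
  have hq0 : 0 ≤ q := by linarith
  set S := samplingConst κ M σ Cdec lam₀ * (ℓA * ϱ + 2) with hSdef
  have hS0 : 0 ≤ S := by positivity
  set k := ((p + q) - s * (q - 1)) / ((p + r) - s * (r - 1)) with hk
  set a₁ := ℓL⁻¹ ^ (r - q) * Rd with ha₁
  have ha₁0 : 0 ≤ a₁ := by positivity
  have hτ : 0 ≤ distScale p q s r Rd := Real.rpow_nonneg hRd _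
  set b₁ := Rd ^ k with hb₁
  have hb₁0 : 0 ≤ b₁ := Real.rpow_nonneg hRd _
  set b₂ := distScale p q s r Rd ^ r * Rd with hb₂
  have hb₂0 : 0 ≤ b₂ := by positivity
  set b₃ := distScale p q s r Rd ^ (r + p) * Rd with hb₃
  have hb₃0 : 0 ≤ b₃ := by positivity
  set b₄ := (β / α * b₃) ^ (1 / s) with hb₄
  have hb₄0 : 0 ≤ b₄ := by positivity
  -- Each constant dominates every bound required of the comparison element in its case; the summand
  -- `1` makes it at least one.
  set ca := 1 + α + ℓA + S + a₁ with hca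
  set cb := 1 + α + ℓA + S + b₁ + b₂ + b₃ + b₄ with hcb
  have hca0 : 0 < ca := by positivity
  have hcb0 : 0 < cb := by positivity
  refine ⟨33 * ca ^ 4 + 33 * cb ^ 4, by positivity, ?_⟩
  intro H _ _ _ _ X _ _ _ _ Y _ _ _ _ _ _ H' _ _ _ _ _ ρ _ L D A fhat fbar Q d θ hL _ hT hN hK
    _ _ hA ⟨v, hv, hvR⟩ hconv hdec m hlam hlam1 _ fz hfz
  have hfhat := interior_subset hT.mem_interior
  constructor
  · intro hqr η hη hη1
    -- The solution is smooth enough to be its own comparison element: its errors vanish, and with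
    -- `t = q` the exponent of the source bound is zero.
    obtain ⟨w, hw, hwR⟩ := hL.exists_negPow_eq hℓL hq0 hqr hvR
    refine measure_not_norm_sub_le_le (c := ca) (t := q) (f₀ := fhat) (w := w) hp hq1 hq2 hs0 hs1 hr
      hℓL hℓA hϱ hκ hM hCdec hlam₀ hL hT hN hK hA hdec hlam hlam1 hfz hq0 hqr (by linarith)
      (by linarith) (by linarith) (by linarith) (le_add_of_nonneg_right (by positivity)) hfhat
      (Metric.mem_closedBall_self hϱ.le) (hv.trans hw) ?_ ?_ ?_ ?_ hη hη1
    · rw [sub_self, mul_zero, zero_div, Real.rpow_zero, mul_one]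
      linarith
    all_goals
      simp only [sub_self, map_zero, norm_zero]
      positivity
  · rintro hrq hrp ⟨fR, hfRQ, hfR⟩ η hη hη1
    obtain ⟨h1, h2⟩ := hfR.norm_sub_le hL hℓL hp hs0 hs1 hr hrq hrp hRd hlam hv hvR
    -- Membership of `fR` in `Q` makes the converse estimate available, so the weak error bound `h2`
    -- yields a residual of order `λ^u`.
    have h3 := le_rpow_of_mul_rpow_le hα hβ hs0 (norm_nonneg _) hb₃0 hlam (hconv fR hfRQ) h2
    obtain ⟨-, w, hw, hwR⟩ := hfR
    have hcmp : ∀ {x b e : ℝ}, x ≤ b * regParam r m ^ e → b ≤ cb → x ≤ cb * regParam r m ^ e :=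
      fun h hb => h.trans (mul_le_mul_of_nonneg_right hb (Real.rpow_nonneg hlam.le _))
    exact measure_not_norm_sub_le_le (c := cb) (t := r) (f₀ := fR) (w := w) hp hq1 hq2 hs0 hs1 hr
      hℓL hℓA hϱ hκ hM hCdec hlam₀ hL hT hN hK hA hdec hlam hlam1 hfz hr le_rfl (by linarith)
      (by linarith) (by linarith) (by linarith) (le_add_of_nonneg_left (by positivity))
      (hA.subset hfRQ).2 (hA.large hfRQ) hw (hcmp hwR (by linarith)) (hcmp h1 (by linarith))
      (hcmp h2 (by linarith)) (hcmp h3 (by linarith)) hη hη1
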